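/- **Setting.** A vocabulary has objects, object variables, numeric variables and predicates. A predicate is either an *object predicate* (no numeric position) or a *numeric predicate* (exactly the last position is numeric); a numeric predicate is *ordinary* or a *limit* predicate, and a limit predicate has type $\min$ or $\max$. Object terms are objects and object variables; numeric terms are built from integers and numeric variables with $+,-,\times$. A *rule* $r$ has the form $\bigwedge_i\alpha_i\wedge\bigwedge_j\beta_j\to\alpha$, where the standard body atoms $\alpha_i$ and the head $\alpha$ are atoms over predicates, the $\beta_j$ are comparison atoms $(s_1<s_2)$ or $(s_1\le s_2)$ between numeric terms, and each variable of $r$ occurs in some $\alpha_i$. The rule is a *limit rule* if its body is empty or its head is an object or a limit atom. As usual, numeric body atoms are assumed to be function-free (their numeric argument is an integer or a variable), and each numeric variable occurs in at most one standard body atom of a rule. A *program* is a finite set of rules. A limit rule $r$ is *limit-linear* if each numeric term in $r$ has the form $s_0+\sum_{i=1}^n s_i\times m_i$ where the $m_i$ are distinct numeric variables occurring in limit body atoms of $r$, $s_0$ contains no variable occurring in a limit body atom of $r$, and each $s_i$ with $i\ge1$ is a product of integers and variables not occurring in limit body atoms of $r$. (Order and bracketing of sums and products are immaterial, $s_0=0$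 and $s_i=1$ may be left out, and summands may be subtracted.) A program is limit-linear if all its rules are. The *semi-grounding* of a program $\mathcal P$ consists of all rules obtained from a rule $r\in\mathcal P$ by replacing each object variable with an object occurring in $\mathcal P$ and each numeric variable that occurs in no limit body atom of $r$ with an integer occurring in $\mathcal P$. A limit-linear program $\mathcal P$ is *type-consistent* if each rule $r$ obtained from its semi-grounding by simplifying all numeric terms as much as possible satisfies the following: - each numeric term in $r$ is of the form $k_0+\sum_{i=1}^n k_i\times m_i$ with distinct variables $m_i$, an integer $k_0$, and nonzero integers $k_i$ (the coefficient of $m_i$); - if the head of $r$ is a limit atom with numeric argument $s$, then each variable occurring in $s$ with a positive (negative) coefficient occurs in a limit body atom of $r$ of the same type as (of a different type than) the head; - for each comparison $(s_1<s_2)$ or $(s_1\le s_2)$ in $r$, each variable occurring in $s_1$ with a positive (negative) coefficient occurs in a $\min$ ($\max$) body atom of $r$, and each variable occurring in $s_2$ with a positive (negative) coefficient occurs in a $\max$ ($\min$) body atom of $r$. Programs are given as words over a fixed finite alphabet, with integers and the names of predicates, objects and variables written in binary. **Proposition.** Checking whether a limit-linear program is type-consistent can be accomplished in $\textsc{LogSpace}$: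 there is a language $L$ decided by a deterministic Turing machine with a read-only input tape and work tapes of length $O(\log n)$ on inputs of length $n$ such that, for each limit-linear program $\mathcal P$, the representation of $\mathcal P$ belongs to $L$ if and only if $\mathcal P$ is type-consistent. -/

import Mathlib

/-! ### Deterministic logarithmic space -/

namespace Space

/-- Head movements. -/
inductive Move where
  | left
  | stay
  | right

/-- What the input head can read: an input symbol or one of the two end markers. -/
inductive InCell (A : Type) where
  | leftEnd
  | sym (a : A)
  | rightEnd

/-- A deterministic Turing machine with a two-way read-only input tape and finitely many
work tapes, each infinite to the right. The machine halts when `step` returns `none`. -/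
structure Machine (A : Type) where
  State : Type
  finiteState : Finite State
  Work : Type
  finiteWork : Finite Work
  tapes : ℕ
  blank : Work
  start : State
  accept : Set State
  /-- New state, movement of the input head, and for each work tape the symbol written and the
  movement of its head. -/
  step : State → InCell A → (Fin tapes → Work) → Option (State × Move × (Fin tapes → Work × Move))

/-- A configuration. Position `0` of the input tape holds the left end marker, positions
`1, …, |w|` the input word `w`, and position `|w| + 1` the right end marker. -/
structure Config {A : Type} (M : Machine A) where
  state : M.State
  inPos : ℕ
  tape : Fin M.tapes → ℕ → M.Work
  pos : Fin M.tapes → ℕ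

variable {A : Type}

/-- The content of cell `p` of the input tape with input `w`. -/
def readInput (w : List A) : ℕ → InCell A
  | 0 => .leftEnd
  | p + 1 => match w[p]? with
    | some a => .sym a
    | none => .rightEnd

/-- The position after a movement on a tape that is infinite to the right. -/
def Move.apply : Move → ℕ → ℕ
  | .left, p => p - 1
  | .stay, p => p
  | .right, p => p + 1

namespace Machine

/-- All heads at position `0`, all work tapes blank. -/
def init (M : Machine A) : Config M where
  state := M.start
  inPos := 0
  tape := fun _ _ => M.blank
  pos := fun _ => 0

/-- One step on input `w`; the input head never leaves the marked part of the input tape. -/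
def next (M : Machine A) (w : List A) (c : Config M) : Option (Config M) :=
  (M.step c.state (readInput w c.inPos) (fun i => c.tape i (c.pos i))).map fun a =>
    { state := a.1
      inPos := min (a.2.1.apply c.inPos) (w.length + 1)
      tape := fun i => Function.update (c.tape i) (c.pos i) (a.2.2 i).1
      pos := fun i => (a.2.2 i).2.apply (c.pos i) }

/-- `c` occurs in the run of `M` on input `w`. -/
def Reaches (M : Machine A) (w : List A) (c : Config M) : Prop :=
  Relation.ReflTransGen (fun c₁ c₂ => M.next w c₁ = some c₂) M.init c

/-- On every input `w`, the machine halts, its halting state is accepting exactly if `w ∈ L`, and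
on each work tape it visits only the first `s |w|` cells. -/
def DecidesInSpace (M : Machine A) (L : Language A) (s : ℕ → ℕ) : Prop :=
  ∀ w : List A,
    (∃ c, M.Reaches w c ∧ M.next w c = none ∧ (c.state ∈ M.accept ↔ w ∈ L)) ∧
    ∀ c, M.Reaches w c → ∀ i, c.pos i < s w.length

end Machine

/-- The class `LogSpace` of languages over the alphabet `A`. -/
def LogSpace (A : Type) : Set (Language A) :=
  {L | ∃ (M : Machine A) (k : ℕ), M.DecidesInSpace L (fun n => k * (Nat.log 2 n + 1))}

end Space

/-! ### Limit Datalog over the integers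

Predicates, objects and variables are named by natural numbers; object variables and numeric
variables are separate. -/

namespace LimitDatalog

/-- Object terms. -/
inductive ObjTerm where
  | obj (a : ℕ)
  | var (x : ℕ)

/-- Numeric terms. -/
inductive NumTerm where
  | int (k : ℤ)
  | var (m : ℕ)
  | add (s t : NumTerm)
  | sub (s t : NumTerm)
  | mul (s t : NumTerm)

/-- The type of a numeric predicate: ordinary numeric, or one of the two types of limit
predicates. -/
inductive NumKind where
  | ordinary
  | min
  | max

/-- Standard atoms: object atoms `B(t₁, …, tₙ)` and numeric atoms `B(t₁, …, tₙ, s)`, whose last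
position is numeric. A predicate is determined by its type, its name and its arity. -/
inductive Atom where
  | object (name : ℕ) (args : List ObjTerm)
  | numeric (kind : NumKind) (name : ℕ) (args : List ObjTerm) (s : NumTerm)

/-- Comparison atoms `(s₁ < s₂)` and `(s₁ ≤ s₂)`. -/
inductive Comparison where
  | lt (s₁ s₂ : NumTerm)
  | le (s₁ s₂ : NumTerm)

/-- Rules: standard body, comparison body, head. -/
structure Rule where
  sbody : List Atom
  cbody : List Comparison
  head : Atom

/-- A program is a finite set of rules, presented as a list. -/
abbrev Program := List Rule

/-! #### Occurrences of variables and constants -/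

def ObjTerm.vars : ObjTerm → List ℕ
  | .obj _ => []
  | .var x => [x]

def ObjTerm.objs : ObjTerm → List ℕ
  | .obj a => [a]
  | .var _ => []

def NumTerm.vars : NumTerm → List ℕ
  | .int _ => []
  | .var m => [m]
  | .add s t => s.vars ++ t.vars
  | .sub s t => s.vars ++ t.vars
  | .mul s t => s.vars ++ t.vars

def NumTerm.ints : NumTerm → List ℤ
  | .int k => [k]
  | .var _ => []
  | .add s t => s.ints ++ t.ints
  | .sub s t => s.ints ++ t.ints
  | .mul s t => s.ints ++ t.ints

def Atom.args : Atom → List ObjTerm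
  | .object _ ts => ts
  | .numeric _ _ ts _ => ts

/-- The numeric terms that are arguments of an atom (at most one). -/
def Atom.terms : Atom → List NumTerm
  | .object _ _ => []
  | .numeric _ _ _ s => [s]

def Atom.objVars (α : Atom) : List ℕ := α.args.flatMap ObjTerm.vars

def Atom.numVars (α : Atom) : List ℕ := α.terms.flatMap NumTerm.vars

def Comparison.lhs : Comparison → NumTerm
  | .lt s _ => s
  | .le s _ => s

def Comparison.rhs : Comparison → NumTerm
  | .lt _ t => t
  | .le _ t => t

namespace Rule

/-- The standard atoms of a rule. -/
def atoms (r : Rule) : List Atom := r.head :: r.sbody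

/-- The numeric terms of a rule: the numeric arguments of its standard atoms and the two sides of
its comparison atoms. -/
def terms (r : Rule) : List NumTerm :=
  r.atoms.flatMap Atom.terms ++ r.cbody.flatMap fun c => [c.lhs, c.rhs]

def objVars (r : Rule) : List ℕ := r.atoms.flatMap Atom.objVars

def numVars (r : Rule) : List ℕ := r.terms.flatMap NumTerm.vars

/-- Variable `m` occurs in a body atom of `r` whose predicate is numeric of type `κ`. -/
def OccursIn (r : Rule) (κ : NumKind) (m : ℕ) : Prop :=
  ∃ name args s, Atom.numeric κ name args s ∈ r.sbody ∧ m ∈ s.vars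

/-- Variable `m` occurs in a limit body atom of `r`. -/
def IsLimitVar (r : Rule) (m : ℕ) : Prop := r.OccursIn .min m ∨ r.OccursIn .max m

end Rule

/-- The integers occurring in a program. -/
def Program.ints (P : Program) : List ℤ := P.flatMap fun r => r.terms.flatMap NumTerm.ints

/-- The objects occurring in a program. -/
def Program.objs (P : Program) : List ℕ :=
  P.flatMap fun r => r.atoms.flatMap fun α => α.args.flatMap ObjTerm.objs

/-! #### Limit-linear programs -/

/-- Integers and numeric variables. -/
def NumTerm.FunctionFree : NumTerm → Prop
  | .int _ => True
  | .var _ => True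
  | _ => False

/-- Products of integers and of variables outside `V`. -/
inductive CoeffTerm (V : ℕ → Prop) : NumTerm → Prop
  | int (k : ℤ) : CoeffTerm V (.int k)
  | var {x : ℕ} (hx : ¬ V x) : CoeffTerm V (.var x)
  | mul {s t : NumTerm} (hs : CoeffTerm V s) (ht : CoeffTerm V t) : CoeffTerm V (.mul s t)

/-- Products, in any order and bracketing, of the variable `m` of `V` (occurring once) and
factors as in `CoeffTerm`. -/
inductive Summand (V : ℕ → Prop) (m : ℕ) : NumTerm → Prop
  | var (hm : V m) : Summand V m (.var m)
  | mulLeft {s t : NumTerm} (hs : CoeffTerm V s) (ht : Summand V m t) : Summand V m (.mul s t)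
  | mulRight {s t : NumTerm} (hs : Summand V m s) (ht : CoeffTerm V t) : Summand V m (.mul s t)

/-- The term is of the form `s₀ + s₁ × m₁ + ⋯ + sₙ × mₙ` where the `mᵢ` (listed in the last
argument) belong to `V`, `s₀` contains no variable of `V` and the `sᵢ`, `i ≥ 1`, are products of
integers and variables outside `V`. The form is understood up to the order and the bracketing of
sums and products, `s₀ = 0` and `sᵢ = 1` can be left out (as in `m + 1`), and summands can be
subtracted (as in `m - 1`). -/
inductive LinearForm (V : ℕ → Prop) : NumTerm → List ℕ → Prop
  | free {t : NumTerm} (ht : ∀ x ∈ t.vars, ¬ V x) : LinearForm V t []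
  | summand {t : NumTerm} {m : ℕ} (ht : Summand V m t) : LinearForm V t [m]
  | add {s t : NumTerm} {ms ns : List ℕ} (hs : LinearForm V s ms) (ht : LinearForm V t ns) :
      LinearForm V (.add s t) (ms ++ ns)
  | sub {s t : NumTerm} {ms ns : List ℕ} (hs : LinearForm V s ms) (ht : LinearForm V t ns) :
      LinearForm V (.sub s t) (ms ++ ns)

/-- Object and limit atoms. -/
def Atom.IsObjectOrLimit : Atom → Prop
  | .object _ _ => True
  | .numeric .ordinary _ _ _ => False
  | .numeric .min _ _ _ => True
  | .numeric .max _ _ _ => True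

/-- Limit-linear rules. -/
structure Rule.IsLimitLinear (r : Rule) : Prop where
  /-- each object variable of the rule occurs in a standard body atom -/
  safeObj : ∀ x ∈ r.objVars, ∃ α ∈ r.sbody, x ∈ α.objVars
  /-- each numeric variable of the rule occurs in a standard body atom -/
  safeNum : ∀ m ∈ r.numVars, ∃ α ∈ r.sbody, m ∈ α.numVars
  /-- the body is empty, or the head is an object or a limit atom -/
  limit : (r.sbody = [] ∧ r.cbody = []) ∨ r.head.IsObjectOrLimit
  /-- numeric body atoms are function-free -/
  functionFree : ∀ α ∈ r.sbody, ∀ s ∈ α.terms, s.FunctionFree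
  /-- each numeric variable occurs in at most one standard body atom -/
  atMostOne : ∀ α ∈ r.sbody, ∀ β ∈ r.sbody, ∀ m ∈ α.numVars, m ∈ β.numVars → α = β
  /-- each numeric term is limit-linear, with distinct variables `mᵢ` -/
  linear : ∀ t ∈ r.terms, ∃ ms : List ℕ, ms.Nodup ∧ LinearForm r.IsLimitVar t ms

/-- Limit-linear programs. -/
def Program.IsLimitLinear (P : Program) : Prop := ∀ r ∈ P, r.IsLimitLinear

/-! #### Semi-grounding -/

def ObjTerm.subst (σ : ℕ → ObjTerm) : ObjTerm → ObjTerm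
  | .obj a => .obj a
  | .var x => σ x

def NumTerm.subst (τ : ℕ → NumTerm) : NumTerm → NumTerm
  | .int k => .int k
  | .var m => τ m
  | .add s t => .add (s.subst τ) (t.subst τ)
  | .sub s t => .sub (s.subst τ) (t.subst τ)
  | .mul s t => .mul (s.subst τ) (t.subst τ)

def Atom.subst (σ : ℕ → ObjTerm) (τ : ℕ → NumTerm) : Atom → Atom
  | .object name args => .object name (args.map (ObjTerm.subst σ))
  | .numeric κ name args s => .numeric κ name (args.map (ObjTerm.subst σ)) (s.subst τ)

def Comparison.subst (τ : ℕ → NumTerm) : Comparison → Comparison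
  | .lt s t => .lt (s.subst τ) (t.subst τ)
  | .le s t => .le (s.subst τ) (t.subst τ)

def Rule.subst (σ : ℕ → ObjTerm) (τ : ℕ → NumTerm) (r : Rule) : Rule where
  sbody := r.sbody.map (Atom.subst σ τ)
  cbody := r.cbody.map (Comparison.subst τ)
  head := r.head.subst σ τ

/-- The semi-grounding of `P`: all rules obtained from a rule `r` of `P` by replacing each object
variable with an object of `P` and each numeric variable that occurs in no limit body atom of `r`
with an integer of `P`. -/
def Program.semiGrounding (P : Program) : Set Rule :=
  {r' | ∃ r ∈ P, ∃ (σ : ℕ → ObjTerm) (τ : ℕ → NumTerm),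
    (∀ x ∈ r.objVars, ∃ a ∈ P.objs, σ x = .obj a) ∧
    (∀ m ∈ r.numVars, r.IsLimitVar m → τ m = .var m) ∧
    (∀ m ∈ r.numVars, ¬ r.IsLimitVar m → ∃ k ∈ P.ints, τ m = .int k) ∧
    r' = r.subst σ τ}

/-! #### Type-consistency -/

/-- A simplified numeric term `k₀ + ∑ kᵢ × mᵢ` with distinct variables `mᵢ` and nonzero integers
`kᵢ`: the function `coeff` maps each `mᵢ` to `kᵢ` and every other variable to `0`. -/
structure LinTerm where
  const : ℤ
  coeff : ℕ →₀ ℤ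

/-- Simplification of a numeric term: multiply and add out, collect equal variables and drop those
with coefficient zero. The result is `none` if a product of two nonconstant terms is met, which
does not happen in the semi-grounding of a limit-linear program. -/
noncomputable def NumTerm.simplify : NumTerm → Option LinTerm
  | .int k => some ⟨k, 0⟩
  | .var m => some ⟨0, Finsupp.single m 1⟩
  | .add s t => s.simplify.bind fun f => t.simplify.bind fun g =>
      some ⟨f.const + g.const, f.coeff + g.coeff⟩
  | .sub s t => s.simplify.bind fun f => t.simplify.bind fun g =>
      some ⟨f.const - g.const, f.coeff - g.coeff⟩
  | .mul s t => s.simplify.bind fun f => t.simplify.bind fun g =>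
      if f.coeff = 0 then some ⟨f.const * g.const, f.const • g.coeff⟩
      else if g.coeff = 0 then some ⟨f.const * g.const, g.const • f.coeff⟩
      else none

namespace Rule

/-- Each variable occurring with positive coefficient in the simplified form of `s` occurs in a
body atom of type `κ`, and each one occurring with negative coefficient in one of type `κ'`. -/
def SignsMatch (r : Rule) (s : NumTerm) (κ κ' : NumKind) : Prop :=
  ∀ f, s.simplify = some f → ∀ m,
    (0 < f.coeff m → r.OccursIn κ m) ∧ (f.coeff m < 0 → r.OccursIn κ' m)

/-- The condition on the head. -/
def HeadConsistent (r : Rule) : Prop :=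
  match r.head with
  | .object _ _ => True
  | .numeric .ordinary _ _ _ => True
  | .numeric .min _ _ s => r.SignsMatch s .min .max
  | .numeric .max _ _ s => r.SignsMatch s .max .min

/-- A semi-ground rule is type-consistent after simplification of its numeric terms. -/
structure TypeConsistent (r : Rule) : Prop where
  linear : ∀ t ∈ r.terms, ∃ f, t.simplify = some f
  head : r.HeadConsistent
  comparisons : ∀ c ∈ r.cbody, r.SignsMatch c.lhs .min .max ∧ r.SignsMatch c.rhs .max .min

end Rule

/-- A program is type-consistent if all rules of its semi-grounding are, after simplification. -/
def Program.TypeConsistent (P : Program) : Prop := ∀ r ∈ P.semiGrounding, r.TypeConsistent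

/-! #### Representation of programs as words -/

/-- The alphabet: two binary digits; markers that precede a negative integer's digits, integers,
numeric variables, objects, object variables and the four types of predicates; brackets and the
arithmetic functions; a marker that precedes a comparison atom and the two comparison predicates;
the arrow and the end of a rule. -/
inductive Sym where
  | bit (b : Bool)
  | neg | int | numVar | obj | objVar
  | objectPred | ordinaryPred | minPred | maxPred
  | lpar | rpar | plus | minus | times
  | cmp | lt | le
  | arrow | ruleEnd

/-- Binary representation, least significant digit first. -/
def encodeNat (n : ℕ) : List Sym := n.bits.map Sym.bit

def encodeInt (k : ℤ) : List Sym :=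
  .int :: ((if k < 0 then [.neg] else []) ++ encodeNat k.natAbs)

def ObjTerm.encode : ObjTerm → List Sym
  | .obj a => .obj :: encodeNat a
  | .var x => .objVar :: encodeNat x

def NumTerm.encode : NumTerm → List Sym
  | .int k => encodeInt k
  | .var m => .numVar :: encodeNat m
  | .add s t => .lpar :: (s.encode ++ .plus :: (t.encode ++ [.rpar]))
  | .sub s t => .lpar :: (s.encode ++ .minus :: (t.encode ++ [.rpar]))
  | .mul s t => .lpar :: (s.encode ++ .times :: (t.encode ++ [.rpar]))

def NumKind.encode : NumKind → Sym
  | .ordinary => .ordinaryPred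
  | .min => .minPred
  | .max => .maxPred

def Atom.encode : Atom → List Sym
  | .object name args => .objectPred :: (encodeNat name ++ args.flatMap ObjTerm.encode)
  | .numeric κ name args s =>
      κ.encode :: (encodeNat name ++ args.flatMap ObjTerm.encode ++ s.encode)

def Comparison.encode : Comparison → List Sym
  | .lt s t => .cmp :: (s.encode ++ .lt :: t.encode)
  | .le s t => .cmp :: (s.encode ++ .le :: t.encode)

def Rule.encode (r : Rule) : List Sym :=
  r.sbody.flatMap Atom.encode ++ r.cbody.flatMap Comparison.encode ++
    .arrow :: (r.head.encode ++ [.ruleEnd])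

def Program.encode (P : Program) : List Sym := P.flatMap Rule.encode

end LimitDatalog

/-! Only signs of coefficients matter, and signs can be found without arithmetic on the numbers in
the program. In a limit-linear term each limit variable `m` occurs exactly once among the summands,
so after semi-grounding its coefficient is `(-1) ^ n` times the product of the leaves that multiply
it. Here `n` is the number of subtractions having `m` in their right operand, and the multiplying
leaves are those whose lowest common ancestor with `m` is a product (`LinearForm.simplify_subst`).
These leaves are integers and variables that range independently over the integers of the program.

Which signs such a product attains is a parity question (`signAttained_iff`). No integer factor may
be zero. Given that, the sign with all variables positive depends on the parity of `n` plus the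
number of negative integer factors. Making all variables negative adds the number of variable
factors. If the program has integers of both signs and some variable occurs an odd number of times
among the factors, both signs are attained. If every variable occurs an even number of times, the
variables have no influence. A program is therefore type-consistent iff no limit variable in a
comparison or limit head, in a rule that has instances, attains a sign whose required type it lacks.

All of this is read off the word by `Violates`, which uses quantifiers over positions, parities of
numbers of positions, comparison of names digit by digit, and scans that count open brackets. The
scan between two leaves reveals whether their lowest common ancestor is a product.

For the space bound, such predicates are evaluated with a fixed number of registers holding
positions, at most `|w| + 1`. `Frag` describes programs for these registers, and `Frag.mem_logSpace`
executes them on a Turing machine storing the registers in binary on parallel tracks of one work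
tape. `LS` and `LSP` collect the functions and relations computable in this way. They are closed
under connectives, bounded quantifiers, parity counting and runs of one-counter automata
(`LS.fold`).

For correctness, `LeafPlace` records a leaf of a term together with its surroundings in the
encoding. It translates each predicate on positions into the corresponding statement about rules
(`mem_consistentWords_iff`), and `Program.typeConsistent_iff` relates the latter to the
semi-grounding. -/

namespace Space

/-! ### Registers in binary on the tracks of a work tape -/

/-- Operations on natural-number registers; `lt` is a test. -/
inductive RegOp (ι : Type) where
  | nop
  | zero (i : ι)
  | inc (i : ι)
  | lt (i j : ι)

namespace RegOp

variable {ι : Type} [DecidableEq ι]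

/-- The outcome of a test (`false` for other operations) and the new registers. -/
def exec : RegOp ι → (ι → ℕ) → Bool × (ι → ℕ)
  | nop, ρ => (false, ρ)
  | zero i, ρ => (false, Function.update ρ i 0)
  | inc i, ρ => (false, Function.update ρ i (ρ i + 1))
  | lt i j, ρ => (decide (ρ i < ρ j), ρ)

/-- The carry with which the transducer of an operation starts. -/
def carry : RegOp ι → Bool
  | inc _ => true
  | _ => false

/-- The transducer of an operation, which processes the digits of all registers at once, least
significant digits first. -/
def trans : RegOp ι → Bool → (ι → Bool) → Bool × (ι → Bool)
  | nop, c, a => (c, a)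
  | zero i, c, a => (c, Function.update a i false)
  | inc i, c, a => (c && a i, Function.update a i (xor (a i) c))
  | lt i j, c, a => (if a i = a j then c else a j, a)

end RegOp

variable {ι : Type}

/-- The numbers whose digits, least significant first, are on the tracks. -/
def trackVal : List (ι → Bool) → ι → ℕ
  | [], _ => 0
  | a :: l, i => (a i).toNat + 2 * trackVal l i

/-- One pass of a transducer over the tracks, which are extended by one cell if the transducer
produces a digit other than zero there. -/
noncomputable def pass (f : Bool → (ι → Bool) → Bool × (ι → Bool)) :
    Bool → List (ι → Bool) → Bool × List (ι → Bool)
  | c, [] => ((f c fun _ => false).1,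
      open Classical in if (f c fun _ => false).2 = (fun _ => false) then []
        else [(f c fun _ => false).2])
  | c, a :: l => ((pass f (f c a).1 l).1, (f c a).2 :: (pass f (f c a).1 l).2)

/-- The source of the space bound: a new cell is kept only if it holds a nonzero digit, and then
some register is at least `2 ^ l.length`. Bounded registers thus force logarithmically many cells.
-/
theorem pass_length (f : Bool → (ι → Bool) → Bool × (ι → Bool)) (l : List (ι → Bool)) (c : Bool) :
    (pass f c l).2.length = l.length ∨
      (pass f c l).2.length = l.length + 1 ∧ ∃ i, 2 ^ l.length ≤ trackVal (pass f c l).2 i := by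
  classical
  induction l generalizing c with
  | nil =>
    by_cases h : (f c fun _ => false).2 = (fun _ => false)
    · simp [pass, h]
    · right
      obtain ⟨i, hi⟩ := Function.ne_iff.1 h
      refine ⟨by simp [pass, h], i, ?_⟩
      simp only [Bool.not_eq_false] at hi
      simp [pass, h, trackVal, hi]
  | cons a l ih =>
    rcases ih (f c a).1 with h | ⟨h, i, hi⟩
    · left
      simp [pass, h]
    · right
      refine ⟨by simp [pass, h], i, ?_⟩
      simp only [pass, trackVal, List.length_cons, pow_succ]
      omega

theorem trackVal_pass_nop [DecidableEq ι] (l : List (ι → Bool)) (c : Bool) :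
    (pass (RegOp.trans (.nop : RegOp ι)) c l).1 = c ∧
      trackVal (pass (RegOp.trans .nop) c l).2 = trackVal l := by
  induction l generalizing c with
  | nil => simp [pass, RegOp.trans]
  | cons a l ih =>
    refine ⟨(ih c).1, funext fun i => ?_⟩
    have := congrFun (ih c).2 i
    simp only [pass, RegOp.trans, trackVal] at this ⊢
    rw [this]

theorem trackVal_pass_zero [DecidableEq ι] (k : ι) (l : List (ι → Bool)) (c : Bool) :
    (pass (RegOp.trans (.zero k)) c l).1 = c ∧
      trackVal (pass (RegOp.trans (.zero k)) c l).2 = Function.update (trackVal l) k 0 := by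
  induction l generalizing c with
  | nil =>
    have : Function.update (fun _ : ι => false) k false = fun _ => false := by
      funext j; by_cases h : j = k <;> simp [Function.update, h]
    refine ⟨by simp [pass, RegOp.trans], ?_⟩
    funext i
    by_cases h : i = k <;> simp [pass, RegOp.trans, trackVal, Function.update, h]
  | cons a l ih =>
    refine ⟨(ih c).1, funext fun i => ?_⟩
    have := congrFun (ih c).2 i
    simp only [pass, RegOp.trans, trackVal] at this ⊢
    rw [this]
    by_cases h : i = k
    · subst h; simp
    · simp [h]

/-- The carry is always absorbed: one that survives all stored digits becomes the top digit in the
cell past the end. -/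
theorem trackVal_pass_inc [DecidableEq ι] (k : ι) (l : List (ι → Bool)) (c : Bool) :
    (pass (RegOp.trans (.inc k)) c l).1 = false ∧
      trackVal (pass (RegOp.trans (.inc k)) c l).2 =
        Function.update (trackVal l) k (trackVal l k + c.toNat) := by
  induction l generalizing c with
  | nil =>
    refine ⟨by simp [pass, RegOp.trans], ?_⟩
    funext i
    cases c
    · have : Function.update (fun _ : ι => false) k false = fun _ => false := by
        funext j; by_cases h : j = k <;> simp [Function.update, h]
      by_cases h : i = k <;> simp [pass, RegOp.trans, trackVal, Function.update, h]
    · have : Function.update (fun _ : ι => false) k true ≠ fun _ => false := by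
        intro h
        simpa using congrFun h k
      by_cases h : i = k
      · subst h
        simp [pass, RegOp.trans, this, trackVal]
      · simp [pass, RegOp.trans, this, trackVal, h]
  | cons a l ih =>
    refine ⟨(ih _).1, funext fun i => ?_⟩
    have := congrFun (ih (c && a k)).2 i
    simp only [pass, RegOp.trans, trackVal] at this ⊢
    rw [this]
    by_cases h : i = k
    · subst h
      cases c <;> cases h : a i <;> simp <;> omega
    · simp [h]

/-- With least significant digits first, the last difference met decides the comparison. The
transducer state is the verdict so far, and its initial value `c` decides in case of equality. -/
theorem trackVal_pass_lt [DecidableEq ι] (i j : ι) (l : List (ι → Bool)) (c : Bool) :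
    (pass (RegOp.trans (.lt i j)) c l).1 =
        decide (trackVal l i < trackVal l j ∨ trackVal l i = trackVal l j ∧ c = true) ∧
      trackVal (pass (RegOp.trans (.lt i j)) c l).2 = trackVal l := by
  induction l generalizing c with
  | nil => simp [pass, RegOp.trans, trackVal]
  | cons a l ih =>
    refine ⟨?_, funext fun m => ?_⟩
    · simp only [pass, RegOp.trans]
      rw [(ih _).1]
      rw [Bool.eq_iff_iff]
      rw [decide_eq_true_iff, decide_eq_true_iff]
      simp only [trackVal]
      cases hi : a i <;> cases hj : a j <;> cases c <;> simp <;> omega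
    · have := congrFun (ih (if a i = a j then c else a j)).2 m
      simp only [pass, RegOp.trans, trackVal] at this ⊢
      rw [this]

/-- A pass of the transducer of an operation performs the operation. -/
theorem trackVal_pass [DecidableEq ι] (o : RegOp ι) (l : List (ι → Bool)) :
    (pass o.trans o.carry l).1 = (o.exec (trackVal l)).1 ∧
      trackVal (pass o.trans o.carry l).2 = (o.exec (trackVal l)).2 := by
  cases o with
  | nop => exact trackVal_pass_nop l _
  | zero i => exact trackVal_pass_zero i l _
  | inc i => exact trackVal_pass_inc i l _
  | lt i j => simpa [RegOp.carry, RegOp.exec] using trackVal_pass_lt i j l false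

/-! ### Fragments of register machines -/

/-- A piece of a program for a machine with a two-way read-only input tape and `K` registers. It is
entered with a value in `S` and left with a value in `T`. -/
structure Frag (A : Type) (K : ℕ) (S T : Type) where
  State : Type
  finiteState : Finite State
  entry : S → State
  step : State → InCell A → Move × RegOp (Fin K) × (Bool → State ⊕ T)

namespace Frag

variable {A : Type} {K : ℕ} {S T : Type}

/-- One step; the registers must remain at most the length of the marked input. -/
def Step (F : Frag A K S T) (w : List A) (c c' : (F.State ⊕ T) × ℕ × (Fin K → ℕ)) : Prop :=
  ∃ q, c.1 = .inl q ∧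
    c' = (((F.step q (readInput w c.2.1)).2.2 ((F.step q (readInput w c.2.1)).2.1.exec c.2.2).1),
      min ((F.step q (readInput w c.2.1)).1.apply c.2.1) (w.length + 1),
      ((F.step q (readInput w c.2.1)).2.1.exec c.2.2).2) ∧
    ∀ i, c'.2.2 i ≤ w.length + 1

/-- Entered with `s`, the head at `p` and registers `ρ`, the fragment is left with `t`, the head at
`p'` and registers `ρ'`. -/
def Runs (F : Frag A K S T) (w : List A) (s : S) (p : ℕ) (ρ : Fin K → ℕ) (t : T) (p' : ℕ)
    (ρ' : Fin K → ℕ) : Prop :=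
  Relation.ReflTransGen (F.Step w) (.inl (F.entry s), p, ρ) (.inr t, p', ρ')

/-! ### Simulation of a fragment by a Turing machine with one work tape -/

/-- States of the Turing machine that executes a fragment. -/
inductive TMState (Q : Type) (K : ℕ) where
  | init
  | main (q : Q)
  | pass (f : Bool → (Fin K → Bool) → Bool × (Fin K → Bool)) (c : Bool) (k : Bool → Q)
  | rewind (q : Q)

/-- A `pass` state carries the transducer itself, which is harmless because there are only finitely
many functions on `Bool` and `Fin K → Bool`. -/
instance {Q : Type} [Finite Q] : Finite (TMState Q K) := by
  let g : TMState Q K → Option (Q ⊕ Q ⊕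
      (Bool → (Fin K → Bool) → Bool × (Fin K → Bool)) × Bool × (Bool → Q)) := fun
    | .init => none
    | .main q => some (.inl q)
    | .rewind q => some (.inr (.inl q))
    | .pass f c k => some (.inr (.inr (f, c, k)))
  refine Finite.of_injective g fun x y h => ?_
  cases x <;> cases y <;> simp_all [g]

/-- The Turing machine that executes a fragment. Its work tape has a marker in the first cell,
followed by the digits of the registers. -/
noncomputable def machine (F : Frag A K Unit Bool) : Machine A where
  State := TMState (F.State ⊕ Bool) K
  finiteState := by have := F.finiteState; infer_instance
  Work := Option (Option (Fin K → Bool))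
  finiteWork := inferInstance
  tapes := 1
  blank := none
  start := .init
  accept := {.main (.inr true)}
  step st cell x := match st with
    | .init => some (.main (.inl (F.entry ())), .stay, fun _ => (some none, .stay))
    | .main (.inr _) => none
    | .main (.inl q) => some (.pass (F.step q cell).2.1.trans (F.step q cell).2.1.carry
        (F.step q cell).2.2, (F.step q cell).1, fun _ => (x 0, .right))
    | .pass f c k => match x 0 with
      | some (some a) => some (.pass f (f c a).1 k, .stay, fun _ => (some (some (f c a).2), .right))
      | _ => some (.rewind (k (f c fun _ => false).1), .stay, fun _ =>
          (open Classical in if (f c fun _ => false).2 = (fun _ => false) then none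
            else some (some (f c fun _ => false).2), .left))
    | .rewind q => match x 0 with
      | some none => some (.main q, .stay, fun _ => (some none, .stay))
      | y => some (.rewind q, .stay, fun _ => (y, .left))

/-- The work tape: a marker, then the tracks. -/
def workTape (l : List (Fin K → Bool)) : ℕ → Option (Option (Fin K → Bool))
  | 0 => some none
  | x + 1 => l[x]?.map some

/-- The configuration with tracks `l` and the work head at `x`. -/
def conf (F : Frag A K Unit Bool) (st : TMState (F.State ⊕ Bool) K) (p : ℕ)
    (l : List (Fin K → Bool)) (x : ℕ) : Config F.machine where
  state := st
  inPos := p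
  tape := fun _ => workTape l
  pos := fun _ => x

theorem update_workTape_append (l₁ l₂ : List (Fin K → Bool)) (a b : Fin K → Bool) :
    Function.update (workTape (l₁ ++ a :: l₂)) (l₁.length + 1) (some (some b)) =
      workTape (l₁ ++ b :: l₂) := by
  funext x
  rcases x with _ | x
  · simp [workTape]
  · by_cases h : x = l₁.length
    · subst h; simp [workTape]
    · rw [Function.update_of_ne (by omega)]
      simp only [workTape]
      congr 1
      rcases lt_or_gt_of_ne h with h | h
      · rw [List.getElem?_append_left h, List.getElem?_append_left h]
      · rw [List.getElem?_append_right h.le, List.getElem?_append_right h.le]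
        obtain ⟨y, hy⟩ : ∃ y, x - l₁.length = y + 1 := ⟨x - l₁.length - 1, by omega⟩
        simp [hy]

theorem update_workTape_snoc (l : List (Fin K → Bool)) (b : Fin K → Bool) :
    Function.update (workTape l) (l.length + 1) (some (some b)) = workTape (l ++ [b]) := by
  funext x
  rcases x with _ | x
  · simp [workTape]
  · by_cases h : x = l.length
    · subst h; simp [workTape]
    · rw [Function.update_of_ne (by omega)]
      simp only [workTape]
      congr 1
      rcases lt_or_gt_of_ne h with h | h
      · rw [List.getElem?_append_left h]
      · rw [List.getElem?_append_right h.le, List.getElem?_eq_none h.le,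
          List.getElem?_eq_none (by simp; omega)]

/-- A step of the Turing machine that does not leave the first `b` cells. -/
def SpaceStep (F : Frag A K Unit Bool) (w : List A) (b : ℕ) (c c' : Config F.machine) : Prop :=
  F.machine.next w c = some c' ∧ ∀ i, c'.pos i < b

theorem rewind_run (F : Frag A K Unit Bool) (w : List A) (b : ℕ) (q : F.State ⊕ Bool) {p : ℕ}
    (hp : p ≤ w.length + 1) (l : List (Fin K → Bool)) (x : ℕ) (hx : x < b) (hxl : x ≤ l.length) :
    Relation.ReflTransGen (F.SpaceStep w b) (F.conf (.rewind q) p l x)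
      (F.conf (.main q) p l 0) := by
  induction x with
  | zero =>
    refine .single ⟨?_, fun _ => hx⟩
    simp only [Machine.next, machine, conf, workTape, Option.map_some, Move.apply,
      min_eq_left hp, Option.some.injEq, Config.mk.injEq, true_and, and_true]
    funext _
    exact Function.update_eq_self 0 (workTape l)
  | succ x ih =>
    refine .head ⟨?_, fun _ => ?_⟩ (ih (by omega) (by omega))
    · have : l[x]? = some l[x] := List.getElem?_eq_getElem (by omega)
      simp only [Machine.next, machine, conf, workTape, this, Option.map_some, Move.apply,
        min_eq_left hp, Option.some.injEq, Config.mk.injEq, true_and]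
      refine ⟨?_, by funext; simp⟩
      funext _
      conv_rhs => rw [← Function.update_eq_self (x + 1) (workTape l)]
      simp [workTape, this]
    · simp only [conf]; omega

/-- The work head separates the rewritten cells `l₁` from the cells `l₂` still to be read. The bound
`b` leaves room for the marker and for the blank cell where the pass ends. -/
theorem pass_run (F : Frag A K Unit Bool) (w : List A) (b : ℕ)
    (f : Bool → (Fin K → Bool) → Bool × (Fin K → Bool)) (k : Bool → F.State ⊕ Bool) {p : ℕ}
    (hp : p ≤ w.length + 1) (l₁ l₂ : List (Fin K → Bool)) (c : Bool)
    (hb : l₁.length + l₂.length + 1 < b) :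
    Relation.ReflTransGen (F.SpaceStep w b) (F.conf (.pass f c k) p (l₁ ++ l₂) (l₁.length + 1))
      (F.conf (.main (k (Space.pass f c l₂).1)) p (l₁ ++ (Space.pass f c l₂).2) 0) := by
  induction l₂ generalizing l₁ c with
  | nil =>
    simp only [Space.pass, List.append_nil]
    refine .head (b := F.conf (.rewind (k (f c fun _ => false).1)) p _ l₁.length) ⟨?_, fun _ => ?_⟩
      (rewind_run F w b _ hp _ _ (by omega) (by simp))
    · simp only [Machine.next, machine, conf, workTape, List.getElem?_eq_none le_rfl,
        Option.map_none, Option.map_some, Move.apply,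
        min_eq_left hp, Option.some.injEq, Config.mk.injEq, true_and]
      refine ⟨?_, by funext; simp⟩
      funext _
      split_ifs with h
      · conv_rhs => rw [List.append_nil, ← Function.update_eq_self (l₁.length + 1) (workTape l₁)]
        simp [workTape]
      · exact update_workTape_snoc _ _
    · simp only [conf]; omega
  | cons a l₂ ih =>
    have := ih (l₁ ++ [(f c a).2]) (f c a).1 (by simp at hb ⊢; omega)
    simp only [List.append_assoc, List.singleton_append, List.length_append, List.length_singleton]
      at this
    refine .head ⟨?_, fun _ => ?_⟩ this
    · have h : (l₁ ++ a :: l₂)[l₁.length]? = some a := by simp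
      simp only [Machine.next, machine, conf, workTape, h, Option.map_some, Move.apply,
        min_eq_left hp, Option.some.injEq, Config.mk.injEq, true_and, and_true]
      funext _
      exact update_workTape_append _ _ _ _
    · simp only [conf, List.length_cons] at hb ⊢; omega

/-- A step of the fragment is one pass and one rewind. `Frag.Step` keeps registers at most `|w| +
1`, so by `pass_length` the tracks never exceed `log (|w| + 1) + 1` cells. The marker and the blank
cell after the tracks account for the `3` in the bound. -/
theorem machine_step (F : Frag A K Unit Bool) (w : List A) {c c' : (F.State ⊕ Bool) × ℕ × (Fin K → ℕ)}
    (h : F.Step w c c') {l : List (Fin K → Bool)} (hl : trackVal l = c.2.2)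
    (hlen : l.length ≤ Nat.log 2 (w.length + 1) + 1) :
    ∃ l', trackVal l' = c'.2.2 ∧ l'.length ≤ Nat.log 2 (w.length + 1) + 1 ∧
      Relation.ReflTransGen (F.SpaceStep w (Nat.log 2 (w.length + 1) + 3))
        (F.conf (.main c.1) c.2.1 l 0) (F.conf (.main c'.1) c'.2.1 l' 0) := by
  obtain ⟨st, p, ρ⟩ := c
  obtain ⟨q, rfl, rfl, hB⟩ := h
  simp only at hl hB ⊢
  subst hl
  set o := (F.step q (readInput w p)).2.1
  obtain ⟨h₁, h₂⟩ := trackVal_pass o l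
  refine ⟨(Space.pass o.trans o.carry l).2, h₂, ?_, ?_⟩
  · rcases pass_length o.trans l o.carry with h | ⟨h, i, hi⟩
    · omega
    · rw [h₂] at hi
      have := Nat.le_log_of_pow_le (by norm_num) (hi.trans (hB i))
      omega
  · have hrun := pass_run F w (Nat.log 2 (w.length + 1) + 3) o.trans
      (F.step q (readInput w p)).2.2 (p := min ((F.step q (readInput w p)).1.apply p)
      (w.length + 1)) (min_le_right _ _) [] l o.carry (by simp; omega)
    rw [h₁] at hrun
    refine .head ⟨?_, fun _ => ?_⟩ hrun
    · simp only [Machine.next, machine, conf, Move.apply, Option.map_some, List.nil_append,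
        Option.some.injEq, Config.mk.injEq, List.length_nil, and_true]
      refine ⟨rfl, trivial, ?_⟩
      funext _
      exact Function.update_eq_self 0 (workTape l)
    · simp [conf]

theorem machine_run (F : Frag A K Unit Bool) (w : List A) {c c' : (F.State ⊕ Bool) × ℕ × (Fin K → ℕ)}
    (h : Relation.ReflTransGen (F.Step w) c c') {l : List (Fin K → Bool)} (hl : trackVal l = c.2.2)
    (hlen : l.length ≤ Nat.log 2 (w.length + 1) + 1) :
    ∃ l', Relation.ReflTransGen (F.SpaceStep w (Nat.log 2 (w.length + 1) + 3))
        (F.conf (.main c.1) c.2.1 l 0) (F.conf (.main c'.1) c'.2.1 l' 0) := by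
  induction h using Relation.ReflTransGen.head_induction_on generalizing l with
  | refl => exact ⟨l, .refl⟩
  | head h _ ih =>
    obtain ⟨l', h₁, h₂, h₃⟩ := machine_step F w h hl hlen
    obtain ⟨l'', h₄⟩ := ih h₁ h₂
    exact ⟨l'', h₃.trans h₄⟩

/-- The machine is deterministic, so every reachable configuration lies on the one halting run,
along which the bound is known. -/
theorem pos_lt_of_spaceStep (F : Frag A K Unit Bool) (w : List A) {b : ℕ} {c f : Config F.machine}
    (h : Relation.ReflTransGen (F.SpaceStep w b) c f) (hf : F.machine.next w f = none)
    (hc : ∀ i, c.pos i < b) {d : Config F.machine}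
    (hd : Relation.ReflTransGen (fun c₁ c₂ => F.machine.next w c₁ = some c₂) c d) :
    ∀ i, d.pos i < b := by
  induction h using Relation.ReflTransGen.head_induction_on with
  | refl =>
    rcases hd.cases_head with rfl | ⟨e, he, _⟩
    · exact hc
    · simp [hf] at he
  | head h _ ih =>
    rcases hd.cases_head with rfl | ⟨e, he, hed⟩
    · exact hc
    · obtain rfl : _ = e := Option.some.inj (h.1.symm.trans he)
      exact ih h.2 hed

/-- A fragment that decides a language with small registers gives a machine in logarithmic
space. -/
theorem mem_logSpace (F : Frag A K Unit Bool) (L : Language A)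
    (h : ∀ w, ∃ b p ρ, F.Runs w () 0 (fun _ => 0) b p ρ ∧ (b = true ↔ w ∈ L)) :
    L ∈ LogSpace A := by
  -- The run uses `log (n + 1) + 3 ≤ log n + 4` cells, which is at most `4 * (log n + 1)`.
  refine ⟨F.machine, 4, fun w => ?_⟩
  obtain ⟨b, p, ρ, hr, hb⟩ := h w
  obtain ⟨l, hl⟩ := machine_run F w hr (l := []) (by funext; simp [trackVal]) (by simp)
  simp only at hl
  have h₀ : F.SpaceStep w (Nat.log 2 (w.length + 1) + 3) F.machine.init
      (F.conf (.main (.inl (F.entry ()))) 0 [] 0) := by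
    refine ⟨?_, fun _ => by simp [conf]⟩
    simp only [Machine.next, machine, conf, Machine.init, Move.apply, Option.map_some,
      Option.some.injEq, Config.mk.injEq, and_true, true_and]
    refine ⟨by simp, ?_⟩
    funext _ x
    cases x <;> simp [workTape]
  have hrun := Relation.ReflTransGen.head h₀ hl
  have hnone : F.machine.next w (F.conf (.main (.inr b)) p l 0) = none := by
    simp [Machine.next, machine, conf]
  refine ⟨⟨_, Relation.ReflTransGen.mono (fun _ _ h => h.1) _ _ hrun, hnone, ?_⟩, fun c hc i => ?_⟩
  · rw [← hb]
    change TMState.main (Sum.inr b) = TMState.main (Sum.inr true) ↔ b = true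
    simp
  · refine (pos_lt_of_spaceStep F w hrun hnone (by simp [Machine.init]) hc i).trans_le ?_
    have : Nat.log 2 (w.length + 1) ≤ Nat.log 2 w.length + 1 := by
      rcases Nat.eq_zero_or_pos w.length with h | h
      · simp [h]
      · rw [← Nat.log_mul_base (by norm_num) h.ne']
        exact Nat.log_mono_right (by omega)
    simp only
    omega

end Frag

end Space

namespace Space

namespace Frag

variable {A : Type} {K : ℕ} {S T U : Type}

/-! ### Combining fragments -/

/-- A single step. -/
def atom [Finite S] (g : S → InCell A → Move × RegOp (Fin K) × (Bool → T)) : Frag A K S T where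
  State := S
  finiteState := inferInstance
  entry := id
  step s c := ((g s c).1, (g s c).2.1, fun b => .inr ((g s c).2.2 b))

/-- Execute `F`; then, depending on the outcome, continue with `G` or leave. -/
def bind (F : Frag A K S T) {T' : Type} (g : T → T' ⊕ U) (G : Frag A K T' U) : Frag A K S U where
  State := F.State ⊕ G.State
  finiteState := by have := F.finiteState; have := G.finiteState; infer_instance
  entry s := .inl (F.entry s)
  step
    | .inl q, c => ((F.step q c).1, (F.step q c).2.1, fun b =>
        ((F.step q c).2.2 b).elim (fun q => .inl (.inl q))
          fun t => (g t).elim (fun t' => .inl (.inr (G.entry t'))) .inr)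
    | .inr q, c => ((G.step q c).1, (G.step q c).2.1, fun b =>
        ((G.step q c).2.2 b).elim (fun q => .inl (.inr q)) .inr)

/-- Execute `F`, then `G`. -/
def seq (F : Frag A K S T) (G : Frag A K T U) : Frag A K S U := F.bind .inl G

/-- Execute `F` until the outcome is in `T`. -/
def iter (F : Frag A K S (S ⊕ T)) : Frag A K S T where
  State := F.State
  finiteState := F.finiteState
  entry := F.entry
  step q c := ((F.step q c).1, (F.step q c).2.1, fun b =>
    ((F.step q c).2.2 b).elim .inl fun t => t.elim (fun s => .inl (F.entry s)) .inr)

/-- Execute `F` while keeping a value in `D`. -/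
def lift (D : Type) [Finite D] (F : Frag A K S T) : Frag A K (D × S) (D × T) where
  State := D × F.State
  finiteState := by have := F.finiteState; infer_instance
  entry s := (s.1, F.entry s.2)
  step q c := ((F.step q.2 c).1, (F.step q.2 c).2.1, fun b =>
    ((F.step q.2 c).2.2 b).elim (fun q' => .inl (q.1, q')) fun t => .inr (q.1, t))

/-- Convert the input and the outcome of `F`. -/
def conv {S' T' : Type} (F : Frag A K S T) (f : S' → S) (g : T → T') : Frag A K S' T' where
  State := F.State
  finiteState := F.finiteState
  entry s := F.entry (f s)
  step q c := ((F.step q c).1, (F.step q c).2.1, fun b =>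
    ((F.step q c).2.2 b).elim .inl fun t => .inr (g t))

/-- A simulation principle: if `φ` respects the action of every internal state, runs carry over.
Since `φ` may send an outcome of `F` to a state of `G`, it covers sequencing and loops as well as
relabelling. -/
theorem reaches_map {S' T' : Type} {F : Frag A K S T} {G : Frag A K S' T'} {w : List A}
    (φ : F.State ⊕ T → G.State ⊕ T')
    (hφ : ∀ q, ∃ q', φ (.inl q) = .inl q' ∧
      ∀ c, G.step q' c = ((F.step q c).1, (F.step q c).2.1, fun b => φ ((F.step q c).2.2 b)))
    {x y : F.State ⊕ T} {p p' : ℕ} {ρ ρ' : Fin K → ℕ}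
    (h : Relation.ReflTransGen (F.Step w) (x, p, ρ) (y, p', ρ')) :
    Relation.ReflTransGen (G.Step w) (φ x, p, ρ) (φ y, p', ρ') := by
  refine Relation.ReflTransGen.lift (fun c : (F.State ⊕ T) × ℕ × (Fin K → ℕ) => (φ c.1, c.2))
    ?_ _ _ h
  rintro ⟨x, p, ρ⟩ c ⟨q, hq, rfl, hB⟩
  obtain rfl : x = .inl q := hq
  obtain ⟨q', hq', hs⟩ := hφ q
  refine ⟨q', hq', ?_, hB⟩
  simp [hs]

variable {w : List A} {s : S} {t : T} {u : U} {p p' p'' : ℕ} {ρ ρ' ρ'' : Fin K → ℕ}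

theorem runs_atom [Finite S] (g : S → InCell A → Move × RegOp (Fin K) × (Bool → T))
    (hB : ∀ i, ((g s (readInput w p)).2.1.exec ρ).2 i ≤ w.length + 1) :
    (atom g).Runs w s p ρ ((g s (readInput w p)).2.2 ((g s (readInput w p)).2.1.exec ρ).1)
      (min ((g s (readInput w p)).1.apply p) (w.length + 1))
      ((g s (readInput w p)).2.1.exec ρ).2 :=
  .single ⟨s, rfl, rfl, hB⟩

theorem Runs.bind {T' : Type} {t' : T'} {F : Frag A K S T} {g : T → T' ⊕ U} {G : Frag A K T' U}
    (h₁ : F.Runs w s p ρ t p' ρ') (hg : g t = .inl t') (h₂ : G.Runs w t' p' ρ' u p'' ρ'') :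
    (F.bind g G).Runs w s p ρ u p'' ρ'' := by
  have h₁' := reaches_map (G := F.bind g G) (fun x => x.elim (fun q => .inl (.inl q))
    fun t => (g t).elim (fun t' => .inl (.inr (G.entry t'))) .inr) (fun q => ⟨_, rfl, fun _ => rfl⟩) h₁
  have h₂' := reaches_map (G := F.bind g G) (fun x => x.elim (fun q => .inl (.inr q)) .inr)
    (fun _ => ⟨_, rfl, fun _ => rfl⟩) h₂
  simp only [Sum.elim_inr, Sum.elim_inl, hg] at h₁' h₂'
  exact h₁'.trans h₂'

theorem Runs.bind_exit {T' : Type} {F : Frag A K S T} {g : T → T' ⊕ U} {G : Frag A K T' U}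
    (h₁ : F.Runs w s p ρ t p' ρ') (hg : g t = .inr u) : (F.bind g G).Runs w s p ρ u p' ρ' := by
  have h₁' := reaches_map (G := F.bind g G) (fun x => x.elim (fun q => .inl (.inl q))
    fun t => (g t).elim (fun t' => .inl (.inr (G.entry t'))) .inr) (fun q => ⟨_, rfl, fun _ => rfl⟩) h₁
  simp only [Sum.elim_inr, Sum.elim_inl, hg] at h₁'
  exact h₁'

theorem Runs.seq {F : Frag A K S T} {G : Frag A K T U} (h₁ : F.Runs w s p ρ t p' ρ')
    (h₂ : G.Runs w t p' ρ' u p'' ρ'') : (F.seq G).Runs w s p ρ u p'' ρ'' :=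
  h₁.bind rfl h₂

theorem Runs.iter_exit {F : Frag A K S (S ⊕ T)} (h : F.Runs w s p ρ (.inr t) p' ρ') :
    F.iter.Runs w s p ρ t p' ρ' :=
  reaches_map (F := F) (G := F.iter)
    (Sum.elim .inl (Sum.elim (fun s => .inl (F.entry s)) .inr))
    (fun _ => ⟨_, rfl, fun _ => rfl⟩) h

theorem Runs.iter_next {F : Frag A K S (S ⊕ T)} {s' : S} (h₁ : F.Runs w s p ρ (.inl s') p' ρ')
    (h₂ : F.iter.Runs w s' p' ρ' t p'' ρ'') : F.iter.Runs w s p ρ t p'' ρ'' :=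
  (reaches_map (F := F) (G := F.iter)
    (Sum.elim .inl (Sum.elim (fun s => .inl (F.entry s)) .inr))
    (fun _ => ⟨_, rfl, fun _ => rfl⟩) h₁).trans h₂

theorem Runs.lift {D : Type} [Finite D] {F : Frag A K S T} (h : F.Runs w s p ρ t p' ρ') (d : D) :
    (F.lift D).Runs w (d, s) p ρ (d, t) p' ρ' :=
  reaches_map (F := F) (G := F.lift D) (fun x => x.elim (fun q' => .inl (d, q')) fun t => .inr (d, t))
    (fun _ => ⟨_, rfl, fun _ => rfl⟩) h

theorem Runs.conv {S' T' : Type} {F : Frag A K S T} {f : S' → S} {s' : S'} {g : T → T'}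
    (h : F.Runs w (f s') p ρ t p' ρ') : (F.conv f g).Runs w s' p ρ (g t) p' ρ' :=
  reaches_map (F := F) (G := F.conv f g) (fun x => x.elim .inl fun t => .inr (g t))
    (fun _ => ⟨_, rfl, fun _ => rfl⟩) h

/-- A run starts in a state and ends in an outcome, so it has a last step, and every step includes
the register bound. -/
theorem Runs.bounded {F : Frag A K S T} (h : F.Runs w s p ρ t p' ρ') (i : Fin K) :
    ρ' i ≤ w.length + 1 := by
  rcases h.cases_tail with h | ⟨c, -, hc⟩
  · simp at h
  · obtain ⟨_, _, _, h⟩ := hc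
    exact h i

/-! ### Moving the input head to the position stored in a register -/

/-- Move the input head to the left end marker. -/
def rewind : Frag A K Unit Unit :=
  iter (atom fun _ c => match c with
    | .leftEnd => (.stay, .nop, fun _ => .inr ())
    | _ => (.left, .nop, fun _ => .inl ()))

theorem rewind_runs (hρ : ∀ i, ρ i ≤ w.length + 1) (p : ℕ) :
    (rewind : Frag A K Unit Unit).Runs w () p ρ () 0 ρ := by
  -- The head position is also truncated to the marked input, so from a position beyond it one left
  -- move can skip several cells.
  induction p using Nat.strong_induction_on with
  | _ p ih =>
    rcases p with _ | p
    · exact Runs.iter_exit (runs_atom _ hρ)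
    · have h : ∀ c : InCell A, c ≠ .leftEnd → ((match c with
          | .leftEnd => (.stay, .nop, fun _ => .inr ())
          | _ => (.left, .nop, fun _ => .inl ()) :
            Move × RegOp (Fin K) × (Bool → Unit ⊕ Unit))) = (.left, .nop, fun _ => .inl ()) := by
        rintro (_ | _ | _) h <;> simp_all
      have hne : readInput w (p + 1) ≠ .leftEnd := by
        simp only [readInput]
        split <;> simp
      have h₁ := runs_atom (K := K) (S := Unit) (w := w) (s := ()) (p := p + 1) (ρ := ρ)
        (fun _ c => (match c with
          | .leftEnd => (.stay, .nop, fun _ => .inr ())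
          | _ => (.left, .nop, fun _ => .inl ()) :
            Move × RegOp (Fin K) × (Bool → Unit ⊕ Unit))) (by rw [h _ hne]; exact hρ)
      simp only [RegOp.exec, Move.apply] at h₁
      exact Runs.iter_next h₁ (ih _ (by omega))

/-- Move the input head to the right as often as register `i` says; register `z` is used for
counting. -/
def advance (z i : Fin K) : Frag A K Unit Unit :=
  (atom fun _ _ => (.stay, .zero z, fun _ => ())).seq
    (iter ((atom fun _ _ => (.stay, .lt z i, id)).seq
      (atom fun b _ => if b then (.right, .inc z, fun _ => .inl ())
        else (.stay, .nop, fun _ => .inr ()))))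

theorem advance_runs {z i : Fin K} (hzi : z ≠ i) (hρ : ∀ i, ρ i ≤ w.length + 1)
    (hp : p ≤ w.length + 1) :
    (advance z i : Frag A K Unit Unit).Runs w () p ρ () (min (p + ρ i) (w.length + 1))
      (Function.update ρ z (ρ i)) := by
  have hB : ∀ x, x ≤ w.length + 1 → ∀ j, Function.update ρ z x j ≤ w.length + 1 := by
    intro x hx j
    by_cases h : j = z
    · simpa [h] using hx
    · simpa [h] using hρ j
  refine Runs.seq (runs_atom _ (hB 0 (by omega))) ?_
  simp only [Move.apply, RegOp.exec, min_eq_left hp]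
  -- Here `x` moves have been made and counted in `z`, and `m` remain.
  suffices h : ∀ m x, x + m = ρ i → (iter ((atom fun _ _ => (.stay, .lt z i, id)).seq
      (atom fun b _ => if b then (.right, .inc z, fun _ => .inl ())
        else (.stay, .nop, fun _ => .inr ()))) : Frag A K Unit Unit).Runs w ()
      (min (p + x) (w.length + 1)) (Function.update ρ z x) () (min (p + ρ i) (w.length + 1))
      (Function.update ρ z (ρ i)) by
    have := h (ρ i) 0 (by simp)
    simpa [min_eq_left hp] using this
  intro m
  induction m with
  | zero =>
    intro x hx
    obtain rfl : x = ρ i := by simpa using hx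
    refine Runs.iter_exit (Runs.seq (runs_atom _ (hB _ (hρ i))) ?_)
    simp only [RegOp.exec, Function.update_self, Function.update_of_ne hzi.symm, lt_irrefl,
      decide_false, id, Move.apply, min_assoc, min_self]
    have := runs_atom (K := K) (w := w) (s := false) (p := min (p + ρ i) (w.length + 1))
      (ρ := Function.update ρ z (ρ i))
      (fun (b : Bool) _ => if b then (.right, .inc z, fun _ => .inl ())
        else (.stay, .nop, fun _ => .inr ()) :
        Bool → InCell A → Move × RegOp (Fin K) × (Bool → Unit ⊕ Unit)) (hB _ (hρ i))
    simpa [RegOp.exec, Move.apply] using this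
  | succ m ih =>
    intro x hx
    refine Runs.iter_next (Runs.seq (runs_atom _ (hB _ (by have := hρ i; omega))) ?_)
      (ih (x + 1) (by omega))
    simp only [RegOp.exec, Function.update_self, Function.update_of_ne hzi.symm,
      id, Move.apply, min_assoc, min_self]
    rw [decide_eq_true (by omega)]
    have := runs_atom (K := K) (w := w) (s := true) (p := min (p + x) (w.length + 1))
      (ρ := Function.update ρ z x)
      (fun (b : Bool) _ => if b then (.right, .inc z, fun _ => .inl ())
        else (.stay, .nop, fun _ => .inr ()) :
        Bool → InCell A → Move × RegOp (Fin K) × (Bool → Unit ⊕ Unit)) (by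
          simpa [RegOp.exec] using hB (x + 1) (by have := hρ i; omega))
    have hmin : min (min (p + x) (w.length + 1) + 1) (w.length + 1) =
      min (p + (x + 1)) (w.length + 1) := by omega
    simpa [RegOp.exec, Move.apply, hmin] using this

end Frag

/-! ### Functions with finitely many values computable in logarithmic space -/

/-- The assignment with `a` in front. -/
def push {β : Type} (a : β) (v : ℕ → β) : ℕ → β
  | 0 => a
  | i + 1 => v i

theorem comp_push {β γ : Type} (f : β → γ) (a : β) (v : ℕ → β) :
    (fun i => f (push a v i)) = push (f a) fun i => f (v i) := by
  funext i
  cases i <;> rfl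

variable {A : Type}

/-- The value `f w v`, where `w` is the input and `v` assigns positions to variables, is computable
with registers that contain numbers up to `|w| + 1`: the register of variable `i` is `e i`, the
first `d` registers are preserved, and `D` further ones can be used. -/
def LS {α : Type} (f : List A → (ℕ → ℕ) → α) : Prop :=
  ∃ D : ℕ, ∀ (K d : ℕ) (e : ℕ → Fin K), (∀ i, (e i : ℕ) < d) → d + D ≤ K →
    ∃ F : Frag A K Unit α, ∀ (w : List A) (p : ℕ) (ρ : Fin K → ℕ), (∀ i, ρ i ≤ w.length + 1) →
      ∃ p' ρ', F.Runs w () p ρ (f w fun i => ρ (e i)) p' ρ' ∧ ∀ i : Fin K, (i : ℕ) < d → ρ' i = ρ i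

namespace LS

variable {α β : Type} {f : List A → (ℕ → ℕ) → α} {g : List A → (ℕ → ℕ) → β}

theorem mem_logSpace {f : List A → (ℕ → ℕ) → Bool} (hf : LS f) :
    ({w | f w (fun _ => 0) = true} : Language A) ∈ LogSpace A := by
  obtain ⟨D, h⟩ := hf
  -- All variables share register `0`, which initially contains `0`.
  obtain ⟨F, hF⟩ := h (1 + D) 1 (fun _ => ⟨0, by omega⟩) (by simp) le_rfl
  refine F.mem_logSpace _ fun w => ?_
  obtain ⟨p', ρ', hr, -⟩ := hF w 0 (fun _ => 0) (by simp)
  exact ⟨_, p', ρ', hr, Iff.rfl⟩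

theorem map (hf : LS f) (g : α → β) : LS fun w v => g (f w v) := by
  obtain ⟨D, h⟩ := hf
  refine ⟨D, fun K d e he hK => ?_⟩
  obtain ⟨F, hF⟩ := h K d e he hK
  refine ⟨F.conv id g, fun w p ρ hρ => ?_⟩
  obtain ⟨p', ρ', hr, hp⟩ := hF w p ρ hρ
  exact ⟨p', ρ', Frag.Runs.conv (f := id) (s' := ()) hr, hp⟩

/-- The first value is kept in the finite control while the second is computed. The scratch
registers can be reused, so the maximum of the two demands suffices. -/
theorem pair [Finite α] (hf : LS f) (hg : LS g) : LS fun w v => (f w v, g w v) := by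
  obtain ⟨D, h⟩ := hf
  obtain ⟨D', h'⟩ := hg
  refine ⟨max D D', fun K d e he hK => ?_⟩
  obtain ⟨F, hF⟩ := h K d e he (by omega)
  obtain ⟨G, hG⟩ := h' K d e he (by omega)
  refine ⟨(F.conv id fun a => (a, ())).seq (G.lift α), fun w p ρ hρ => ?_⟩
  obtain ⟨p', ρ', hr, hp⟩ := hF w p ρ hρ
  obtain ⟨p'', ρ'', hr', hp'⟩ := hG w p' ρ' hr.bounded
  have he' : (fun i => ρ' (e i)) = fun i => ρ (e i) := funext fun i => hp _ (he i)
  rw [he'] at hr'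
  exact ⟨p'', ρ'', Frag.Runs.seq (Frag.Runs.conv (f := id) (s' := ()) hr) (hr'.lift _),
    fun i hi => (hp' i hi).trans (hp i hi)⟩

theorem map₂ {γ : Type} [Finite α] (hf : LS f) (hg : LS g) (h : α → β → γ) :
    LS fun w v => h (f w v) (g w v) :=
  (hf.pair hg).map fun x => h x.1 x.2

theorem lt (i j : ℕ) : LS fun (_ : List A) v => decide (v i < v j) := by
  refine ⟨0, fun K d e _ _ => ⟨.atom fun _ _ => (.stay, .lt (e i) (e j), id), ?_⟩⟩
  exact fun w p ρ hρ => ⟨_, _, Frag.runs_atom _ hρ, fun _ _ => rfl⟩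

/-- Every position past the end reads as the right end marker, so truncating head positions does not
affect what is read. -/
theorem readInput_min (w : List A) (p : ℕ) : readInput w (min p (w.length + 1)) = readInput w p := by
  rcases le_total p (w.length + 1) with h | h
  · rw [min_eq_left h]
  · rw [min_eq_right h]
    obtain ⟨x, rfl⟩ : ∃ x, p = x + 1 := ⟨p - 1, by omega⟩
    simp only [readInput, List.getElem?_eq_none (le_refl w.length),
      List.getElem?_eq_none (show w.length ≤ x by omega)]

theorem read (i : ℕ) : LS fun (w : List A) v => readInput w (v i) := by
  refine ⟨1, fun K d e he hK => ⟨Frag.seq .rewind (Frag.seq (.advance ⟨d, by omega⟩ (e i))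
    (.atom fun _ c => (.stay, .nop, fun _ => c))), fun w p ρ hρ => ?_⟩⟩
  have hz : (⟨d, by omega⟩ : Fin K) ≠ e i := fun h => (he i).ne (by rw [← h])
  have hadv := Frag.advance_runs hz hρ (w := w) (Nat.zero_le _)
  have h₁ := Frag.runs_atom (T := InCell A) (w := w) (s := ()) (p := min (0 + ρ (e i)) (w.length + 1))
    (ρ := Function.update ρ ⟨d, by omega⟩ (ρ (e i))) (fun _ c => (.stay, .nop, fun _ => c)) hadv.bounded
  simp only [readInput_min, zero_add] at h₁
  simp only [zero_add] at hadv
  refine ⟨_, _, .seq (Frag.rewind_runs hρ p) (.seq hadv h₁), fun j hj => ?_⟩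
  simp only [RegOp.exec]
  rw [Function.update_of_ne]
  rintro rfl
  simp at hj

/-- The head is advanced twice, so the sum of the positions is never stored. It could exceed the
bound on registers. -/
theorem readAdd (i j : ℕ) : LS fun (w : List A) v => readInput w (v i + v j) := by
  refine ⟨1, fun K d e he hK => ⟨Frag.seq .rewind (Frag.seq (.advance ⟨d, by omega⟩ (e i))
    (Frag.seq (.advance ⟨d, by omega⟩ (e j))
    (.atom fun _ c => (.stay, .nop, fun _ => c)))), fun w p ρ hρ => ?_⟩⟩
  have hz : ∀ i, (⟨d, by omega⟩ : Fin K) ≠ e i := fun i h => (he i).ne (by rw [← h])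
  have hadv := Frag.advance_runs (hz i) hρ (w := w) (Nat.zero_le _)
  have hadv' := Frag.advance_runs (hz j) hadv.bounded (w := w) (min_le_right (0 + ρ (e i)) _)
  have h₁ := Frag.runs_atom (T := InCell A) (w := w) (s := ())
    (p := min (min (0 + ρ (e i)) (w.length + 1) + ρ (e j)) (w.length + 1))
    (ρ := Function.update (Function.update ρ ⟨d, by omega⟩ (ρ (e i))) ⟨d, by omega⟩ (ρ (e j)))
    (fun _ c => (.stay, .nop, fun _ => c)) (by
      have := hadv'.bounded
      rwa [Function.update_of_ne (hz j).symm] at this)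
  have hmin : min (min (ρ (e i)) (w.length + 1) + ρ (e j)) (w.length + 1) =
    min (ρ (e i) + ρ (e j)) (w.length + 1) := by omega
  rw [Function.update_of_ne (hz j).symm] at hadv'
  simp only [zero_add, hmin, readInput_min] at h₁ hadv hadv'
  refine ⟨_, _, .seq (Frag.rewind_runs hρ p) (.seq hadv (.seq hadv' h₁)), fun m hm => ?_⟩
  have : m ≠ ⟨d, by omega⟩ := fun h => hm.ne (by rw [h])
  simp [RegOp.exec, Function.update_of_ne this]

end LS

end Space

/-! ### One-counter automata running over the positions of the input -/

namespace Space

variable {A : Type}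

/-- One step of a one-counter automaton that reads `x`. -/
def counterStep {S α : Type} (δ : S → Bool → α → S × Move) (c : S × ℕ) (x : α) : S × ℕ :=
  ((δ c.1 (decide (c.2 = 0)) x).1, (δ c.1 (decide (c.2 = 0)) x).2.apply c.2)

namespace Frag

variable {K : ℕ} {S α : Type}

/-- The operation on the registers `a` and `b`, whose difference is a counter, for a movement of the
counter. -/
def counterOp (a b : Fin K) (isZero : Bool) : Move → RegOp (Fin K)
  | .left => if isZero then .nop else .inc b
  | .stay => .nop
  | .right => .inc a

/-- The body of the loop in `foldLoop`. -/
def foldBody [Finite S] [Finite α] (F : Frag A K Unit α) (δ : S → Bool → α → S × Move)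
    (t a b z : Fin K) : Frag A K S (S ⊕ S) :=
  Frag.bind
    (((rewind.seq (advance z t)).lift S).conv (fun s => (s, ())) Prod.fst |>.seq
      ((atom fun s _ => (.right, .nop, fun _ => s)).seq
        (atom fun s c => match c with
          | .rightEnd => (.stay, .nop, fun _ => .inr s)
          | _ => (.stay, .inc t, fun _ => .inl s))))
    (fun x : S ⊕ S => x.elim .inl fun s => .inr (.inr s))
    (((F.lift S).conv (fun s => (s, ())) id).seq
      ((atom fun x _ => (.stay, .lt b a, fun r => (x, !r))).seq
        (atom fun x _ => (.stay, counterOp a b x.2 (δ x.1.1 x.2 x.1.2).2,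
          fun _ => .inl (δ x.1.1 x.2 x.1.2).1))))

/-- Execute a one-counter automaton on the values computed by `F`, for all positions of the input
in register `t`. -/
def foldLoop [Finite S] [Finite α] (F : Frag A K Unit α) (δ : S → Bool → α → S × Move) (s₀ : S)
    (t a b z : Fin K) : Frag A K Unit S :=
  (atom fun _ _ => (.stay, .zero t, fun _ => ())).seq
    ((atom fun _ _ => (.stay, .zero a, fun _ => ())).seq
      ((atom fun _ _ => (.stay, .zero b, fun _ => s₀)).seq (foldBody F δ t a b z).iter))

theorem readInput_succ_of_lt {w : List A} {j : ℕ} (hj : j < w.length) :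
    readInput w (j + 1) = .sym w[j] := by
  simp [readInput, List.getElem?_eq_getElem hj]

theorem readInput_length_succ (w : List A) : readInput w (w.length + 1) = .rightEnd := by
  simp [readInput]

variable [Finite S] [Finite α] {F : Frag A K Unit α} {δ : S → Bool → α → S × Move}
  {t a b z : Fin K} {w : List A} {p : ℕ} {ρ : Fin K → ℕ}

theorem foldBody_exit (hz : z ≠ t) (hρ : ∀ i, ρ i ≤ w.length + 1) (ht : ρ t = w.length) (s : S) :
    (foldBody F δ t a b z).Runs w s p ρ (.inr s) (w.length + 1) (Function.update ρ z w.length) := by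
  have h₁ := Runs.seq (rewind_runs hρ p) (advance_runs hz hρ (Nat.zero_le _))
  have h₂ := (h₁.lift s).conv (f := fun s => (s, ())) (s' := s) (g := Prod.fst)
  rw [ht, zero_add, min_eq_left (by omega)] at h₂
  have h₃ := runs_atom (T := S) (w := w) (s := s) (p := w.length)
    (ρ := Function.update ρ z w.length) (fun s _ => (.right, .nop, fun _ => s)) h₂.bounded
  simp only [Move.apply, min_self, RegOp.exec] at h₃
  have h₄ := runs_atom (T := S ⊕ S) (w := w) (s := s) (p := w.length + 1)
    (ρ := Function.update ρ z w.length) (fun s c => match c with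
          | .rightEnd => (.stay, .nop, fun _ => .inr s)
          | _ => (.stay, .inc t, fun _ => .inl s))
    (by rw [readInput_length_succ]; exact h₂.bounded)
  simp only [readInput_length_succ, Move.apply, min_self, RegOp.exec] at h₄
  exact Runs.bind_exit (h₂.seq (h₃.seq h₄)) rfl

/-- Register `t` holds the number of positions already processed and is incremented before `F`
starts, so `F` sees the current position counted from `1`. Registers can only be incremented or
cleared, so the counter is represented by the difference of `a` and `b`. -/
theorem foldBody_next (hz : z ≠ t) (hρ : ∀ i, ρ i ≤ w.length + 1)
    (ht : ρ t < w.length) (s : S) {x : α} {p' : ℕ} {ρ' : Fin K → ℕ}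
    (hF : F.Runs w () (ρ t + 1) (Function.update (Function.update ρ z (ρ t)) t (ρ t + 1)) x p' ρ')
    (ha : ρ' a ≤ w.length) (hb : ρ' b ≤ ρ' a) :
    ∃ p'', (foldBody F δ t a b z).Runs w s p ρ
      (.inl (counterStep δ (s, ρ' a - ρ' b) x).1) p''
      ((counterOp a b (decide (ρ' a - ρ' b = 0))
        (δ s (decide (ρ' a - ρ' b = 0)) x).2).exec ρ').2 := by
  have h₁ := Runs.seq (rewind_runs hρ p) (advance_runs hz hρ (Nat.zero_le _))
  have h₂ := (h₁.lift s).conv (f := fun s => (s, ())) (s' := s) (g := Prod.fst)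
  rw [zero_add, min_eq_left (by omega)] at h₂
  have h₃ := runs_atom (T := S) (w := w) (s := s) (p := ρ t)
    (ρ := Function.update ρ z (ρ t)) (fun s _ => (.right, .nop, fun _ => s)) h₂.bounded
  simp only [Move.apply, min_eq_left (show ρ t + 1 ≤ w.length + 1 by omega), RegOp.exec] at h₃
  have hupd : Function.update ρ z (ρ t) t = ρ t := Function.update_of_ne hz.symm _ _
  have h₄ := runs_atom (T := S ⊕ S) (w := w) (s := s) (p := ρ t + 1)
    (ρ := Function.update ρ z (ρ t)) (fun s c => match c with
          | .rightEnd => (.stay, .nop, fun _ => .inr s)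
          | _ => (.stay, .inc t, fun _ => .inl s))
    (by
      rw [readInput_succ_of_lt ht]
      intro i
      simp only [RegOp.exec, hupd]
      by_cases hi : i = t
      · subst hi; simp; omega
      · rw [Function.update_of_ne hi]; exact h₂.bounded i)
  simp only [readInput_succ_of_lt ht, Move.apply,
    min_eq_left (show ρ t + 1 ≤ w.length + 1 by omega), RegOp.exec, hupd] at h₄
  have h₅ := (hF.lift s).conv (f := fun s => (s, ())) (s' := s) (g := id)
  have h₆ := runs_atom (T := (S × α) × Bool) (w := w) (s := (s, x)) (p := p')
    (ρ := ρ') (fun x _ => (.stay, .lt b a, fun r => (x, !r))) h₅.bounded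
  have h₇ := runs_atom (T := S ⊕ S) (w := w) (s := ((s, x), decide (ρ' a - ρ' b = 0)))
    (p := min (Move.stay.apply p') (w.length + 1)) (ρ := ρ')
    (fun x _ => (.stay, counterOp a b x.2 (δ x.1.1 x.2 x.1.2).2,
          fun _ => .inl (δ x.1.1 x.2 x.1.2).1)) (by
      have hB := h₅.bounded
      intro i
      simp only
      cases (δ s (decide (ρ' a - ρ' b = 0)) x).2 with
      | left =>
        by_cases h : ρ' a - ρ' b = 0
        · simpa [counterOp, RegOp.exec, h] using hB i
        · by_cases hi : i = b
          · subst hi; simp [counterOp, RegOp.exec, h]; omega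
          · simpa [counterOp, RegOp.exec, h, hi] using hB i
      | stay => exact hB i
      | right =>
        by_cases hi : i = a
        · subst hi; simp [counterOp, RegOp.exec]; omega
        · simpa [counterOp, RegOp.exec, hi] using hB i)
  have hz : (!decide (ρ' b < ρ' a)) = decide (ρ' a - ρ' b = 0) := by
    rw [Bool.eq_iff_iff]
    simp
    omega
  simp only [RegOp.exec, hz] at h₆
  exact ⟨_, Runs.bind (h₂.seq (h₃.seq h₄)) rfl (h₅.seq (h₆.seq h₇))⟩

end Frag

namespace LS

variable {α S : Type} {f : List A → (ℕ → ℕ) → α}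

/-- Run a one-counter automaton on the values of `f` at the positions of the input. -/
theorem fold [Finite α] [Finite S] (hf : LS f) (δ : S → Bool → α → S × Move) (s₀ : S) :
    LS fun w v => ((List.range w.length).foldl
      (fun c t => counterStep δ c (f w (push (t + 1) v))) (s₀, 0)).1 := by
  obtain ⟨D, h⟩ := hf
  -- Four registers are added: the position `t`, the pair `a`, `b` for the counter, and the scratch
  -- register `z`. Only the first three must survive `F`, which is therefore given `d + 3` protected
  -- registers.
  refine ⟨D + 4, fun K d e he hK => ?_⟩
  set t : Fin K := ⟨d, by omega⟩ with ht
  set a : Fin K := ⟨d + 1, by omega⟩ with ha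
  set b : Fin K := ⟨d + 2, by omega⟩ with hb
  set z : Fin K := ⟨d + 3, by omega⟩ with hz
  obtain ⟨F, hF⟩ := h K (d + 3) (push t e) (by
    rintro (_ | i)
    · simp [push, ht]
    · have := he i
      simp only [push]
      omega) (by omega)
  refine ⟨F.foldLoop δ s₀ t a b z, fun w p ρ hρ => ?_⟩
  have hta : t ≠ a := by simp [ht, ha]
  have htb : t ≠ b := by simp [ht, hb]
  have hab : a ≠ b := by simp [ha, hb]
  have hzt : z ≠ t := by simp [hz, ht]
  have hza : z ≠ a := by simp [hz, ha]
  have hzb : z ≠ b := by simp [hz, hb]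
  have hlow : ∀ i : Fin K, (i : ℕ) < d → i ≠ t ∧ i ≠ a ∧ i ≠ b ∧ i ≠ z := by
    intro i hi
    simp only [ht, ha, hb, hz, ne_eq, Fin.ext_iff]
    omega
  -- the loop
  have loop : ∀ m j, j + m = w.length → ∀ (s : S) (p : ℕ) (ρ : Fin K → ℕ),
      (∀ i, ρ i ≤ w.length + 1) → ρ t = j → ρ a ≤ j → ρ b ≤ ρ a →
      ∃ p' ρ', (Frag.foldBody F δ t a b z).iter.Runs w s p ρ
        ((List.range' j m).foldl (fun c t => counterStep δ c
          (f w (push (t + 1) fun i => ρ (e i)))) (s, ρ a - ρ b)).1 p' ρ' ∧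
        ∀ i : Fin K, (i : ℕ) < d → ρ' i = ρ i := by
    intro m
    induction m with
    | zero =>
      intro j hj s p ρ hρ h₁ _ _
      refine ⟨_, _, Frag.Runs.iter_exit (Frag.foldBody_exit hzt hρ (by omega) s), fun i hi => ?_⟩
      exact Function.update_of_ne (hlow i hi).2.2.2 _ _
    | succ m ih =>
      intro j hj s p ρ hρ h₁ h₂ h₃
      set ρ₁ := Function.update (Function.update ρ z (ρ t)) t (ρ t + 1) with hρ₁
      have hρ₁B : ∀ i, ρ₁ i ≤ w.length + 1 := by
        intro i
        by_cases hi : i = t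
        · subst hi; simp [hρ₁]; omega
        · by_cases hi' : i = z
          · subst hi'; simp [hρ₁, hi]; omega
          · simpa [hρ₁, hi, hi'] using hρ i
      obtain ⟨p', ρ', hr, hpres⟩ := hF w (ρ t + 1) ρ₁ hρ₁B
      have hρ₁low : ∀ i : Fin K, (i : ℕ) < d → ρ₁ i = ρ i := by
        intro i hi
        simp [hρ₁, (hlow i hi).1, (hlow i hi).2.2.2]
      have hval : (fun i => ρ₁ (push t e i)) = push (j + 1) fun i => ρ (e i) := by
        rw [comp_push]
        congr 1
        · simp [hρ₁, h₁]
        · exact funext fun i => hρ₁low _ (he i)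
      rw [hval] at hr
      have hρ't : ρ' t = j + 1 := by
        rw [hpres t (by simp [ht])]; simp [hρ₁, h₁]
      have hρ'a : ρ' a = ρ a := by
        rw [hpres a (by simp [ha])]; simp [hρ₁, hta.symm, hza.symm]
      have hρ'b : ρ' b = ρ b := by
        rw [hpres b (by simp [hb])]; simp [hρ₁, htb.symm, hzb.symm]
      have hρ'low : ∀ i : Fin K, (i : ℕ) < d → ρ' i = ρ i := fun i hi =>
        (hpres i (by omega)).trans (hρ₁low i hi)
      obtain ⟨p'', hbody⟩ := Frag.foldBody_next (p := p) (δ := δ) (a := a) (b := b) hzt hρ (by omega) s hr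
        (by omega) (by omega)
      rw [hρ'a, hρ'b] at hbody
      set ρ₂ := ((Frag.counterOp a b (decide (ρ a - ρ b = 0))
        (δ s (decide (ρ a - ρ b = 0)) (f w (push (j + 1) fun i => ρ (e i)))).2).exec ρ').2 with hρ₂
      -- A decrement increments `b` and is skipped at zero, so `b ≤ a` persists. Register `a` grows
      -- at most once per position, which keeps both registers within the bound.
      have hcount : ρ₂ a - ρ₂ b = (counterStep δ (s, ρ a - ρ b)
          (f w (push (j + 1) fun i => ρ (e i)))).2 ∧ ρ₂ a ≤ j + 1 ∧ ρ₂ b ≤ ρ₂ a ∧ ρ₂ t = j + 1 ∧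
          ∀ i : Fin K, (i : ℕ) < d → ρ₂ i = ρ i := by
        simp only [hρ₂, counterStep]
        cases (δ s (decide (ρ a - ρ b = 0)) (f w (push (j + 1) fun i => ρ (e i)))).2 with
        | left =>
          by_cases h0 : ρ a - ρ b = 0
          · simp only [Frag.counterOp, RegOp.exec, h0, Move.apply, decide_true, if_true]
            refine ⟨by omega, by omega, by omega, hρ't, hρ'low⟩
          · simp only [Frag.counterOp, RegOp.exec, h0, Move.apply, decide_false,
              Bool.false_eq_true, if_false]
            refine ⟨?_, ?_, ?_, ?_, ?_⟩
            · simp [hab]; omega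
            · simp [hab]; omega
            · simp [hab]; omega
            · simpa [htb] using hρ't
            · intro i hi; simpa [(hlow i hi).2.2.1] using hρ'low i hi
        | stay => exact ⟨by simp [Frag.counterOp, RegOp.exec, Move.apply]; omega,
            by simp [Frag.counterOp, RegOp.exec]; omega,
            by simp [Frag.counterOp, RegOp.exec]; omega, hρ't, hρ'low⟩
        | right =>
          simp only [Frag.counterOp, RegOp.exec, Move.apply]
          refine ⟨?_, ?_, ?_, ?_, ?_⟩
          · simp [hab.symm]; omega
          · simp; omega
          · simp [hab.symm]; omega
          · simpa [hta] using hρ't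
          · intro i hi; simpa [(hlow i hi).2.1] using hρ'low i hi
      obtain ⟨p₃, ρ₃, hrun, hlow₃⟩ := ih (j + 1) (by omega) _ p'' ρ₂ hbody.bounded hcount.2.2.2.1
        hcount.2.1 hcount.2.2.1
      refine ⟨p₃, ρ₃, ?_, fun i hi => (hlow₃ i hi).trans (hcount.2.2.2.2 i hi)⟩
      have hval₂ : (fun i => ρ₂ (e i)) = fun i => ρ (e i) :=
        funext fun i => hcount.2.2.2.2 _ (he i)
      rw [hcount.1, hval₂] at hrun
      rw [List.range'_succ, List.foldl_cons]
      exact Frag.Runs.iter_next hbody hrun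
  set ρ₀ := Function.update (Function.update (Function.update ρ t 0) a 0) b 0 with hρ₀
  have hzero : ∀ (ρ : Fin K → ℕ) (i : Fin K), (∀ j, ρ j ≤ w.length + 1) →
      ∀ j, Function.update ρ i 0 j ≤ w.length + 1 := by
    intro ρ i hρ j
    by_cases hj : j = i
    · simp [hj]
    · simpa [hj] using hρ j
  have hlow₀ : ∀ i : Fin K, (i : ℕ) < d → ρ₀ i = ρ i := fun i hi => by
    simp [hρ₀, hlow i hi]
  have h₁ := Frag.runs_atom (A := A) (w := w) (s := ()) (T := Unit) (p := p) (ρ := ρ)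
    (fun _ _ => (.stay, .zero t, fun _ => ())) (hzero _ _ hρ)
  have h₂ := Frag.runs_atom (A := A) (w := w) (s := ()) (T := Unit)
    (p := min (Move.stay.apply p) (w.length + 1)) (ρ := Function.update ρ t 0)
    (fun _ _ => (.stay, .zero a, fun _ => ())) (hzero _ _ h₁.bounded)
  have h₃ := Frag.runs_atom (A := A) (w := w) (s := ()) (T := S)
    (p := min (Move.stay.apply (min (Move.stay.apply p) (w.length + 1))) (w.length + 1))
    (ρ := Function.update (Function.update ρ t 0) a 0)
    (fun _ _ => (.stay, .zero b, fun _ => s₀)) (hzero _ _ h₂.bounded)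
  obtain ⟨p', ρ', hrun, hpres⟩ := loop w.length 0 (by simp) s₀ _ ρ₀ h₃.bounded
    (by simp [hρ₀, hta, htb]) (by simp [hρ₀, hab]) (by simp [hρ₀])
  have hval₀ : (fun i => ρ₀ (e i)) = fun i => ρ (e i) := funext fun i => hlow₀ _ (he i)
  rw [hval₀, ← List.range_eq_range', show ρ₀ a - ρ₀ b = 0 by simp [hρ₀, hab]] at hrun
  exact ⟨p', ρ', h₁.seq (h₂.seq (h₃.seq hrun)), fun i hi => (hpres i hi).trans (hlow₀ i hi)⟩

end LS

end Space

namespace Space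

variable {A : Type}

/-! ### Relations decidable in logarithmic space -/

/-- Relations between positions of the input that are decidable in logarithmic space. -/
def LSP (R : List A → (ℕ → ℕ) → Prop) : Prop :=
  LS fun w v => (open Classical in decide (R w v))

instance [Finite A] : Finite (InCell A) := by
  let g : InCell A → Option (Option A) := fun
    | .leftEnd => none
    | .rightEnd => some none
    | .sym a => some (some a)
  refine Finite.of_injective g fun x y h => ?_
  cases x <;> cases y <;> simp_all [g]

/-- A counter that never moves can be dropped, so finite automata are a special case of `LS.fold`.
-/
theorem foldl_counterStep_stay {S α β : Type} (δ : S → α → S) (g : β → α) (l : List β) (s : S)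
    (c : ℕ) :
    l.foldl (fun c t => counterStep (fun s _ x => (δ s x, .stay)) c (g t)) (s, c) =
      (l.foldl (fun s t => δ s (g t)) s, c) := by
  induction l generalizing s with
  | nil => rfl
  | cons t l ih => exact ih _

/-- A fold over a part of the input is a pass over the whole input that is idle outside the
interval. -/
theorem foldl_range_interval {S : Type} (step : S → A → S) (w : List A) (lo hi : ℕ) (s : S) (m : ℕ)
    (hm : m ≤ w.length) :
    (List.range m).foldl (fun c t => if lo ≤ t ∧ t < hi then
      (match readInput w (t + 1) with | .sym a => step c a | _ => c) else c) s =
        ((w.take (min m hi)).drop lo).foldl step s := by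
  induction m with
  | zero => simp
  | succ m ih =>
    rw [List.range_succ, List.foldl_append, ih (by omega)]
    simp only [List.foldl_cons, List.foldl_nil, Frag.readInput_succ_of_lt (show m < w.length by omega)]
    split_ifs with h
    · rw [min_eq_left (by omega), min_eq_left (by omega), List.take_succ_eq_append_getElem (by omega),
        List.drop_append_of_le_length (by simp; omega), List.foldl_append]
      simp
    · by_cases hlo : lo ≤ m
      · rw [min_eq_right (by omega), min_eq_right (by omega)]
      · rw [List.drop_eq_nil_of_le (by simp; omega), List.drop_eq_nil_of_le (by simp; omega)]

namespace LS

variable {S : Type}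

theorem congr {α : Type} {f g : List A → (ℕ → ℕ) → α} (hf : LS f) (h : ∀ w v, f w v = g w v) :
    LS g := by
  have : f = g := funext fun w => funext fun v => h w v
  rwa [← this]

/-- The end points need not be computed. It is enough that `b` tests whether the current position
lies between them. -/
theorem foldInterval [Finite A] [Finite S] {b : List A → (ℕ → ℕ) → Bool} (hb : LS b)
    (lo hi : List A → (ℕ → ℕ) → ℕ)
    (h : ∀ w v t, t < w.length → (b w (push (t + 1) v) = true ↔ lo w v ≤ t ∧ t < hi w v))
    (δ : S → Bool → A → S × Move) (s₀ : S) :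
    LS fun w v => (((w.take (hi w v)).drop (lo w v)).foldl (counterStep δ) (s₀, 0)).1 := by
  have key := (hb.pair (read 0)).fold (S := S) (fun s z x => if x.1 then
    (match x.2 with | .sym a => δ s z a | _ => (s, .stay)) else (s, .stay)) s₀
  convert key using 3 with w v
  have := foldl_range_interval (counterStep δ) w (lo w v) (hi w v) (s₀, 0) w.length le_rfl
  rw [List.take_eq_take_min, min_comm, ← this]
  congr 1
  refine List.foldl_ext _ _ _ fun c t ht => ?_
  have ht' : t < w.length := List.mem_range.1 ht
  have hbt := h w v t ht'
  by_cases hc : lo w v ≤ t ∧ t < hi w v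
  · have hR : readInput w (push (t + 1) v 0) = .sym w[t] := Frag.readInput_succ_of_lt ht'
    simp only [hc, Frag.readInput_succ_of_lt ht', counterStep, hbt.2 hc, hR]
    simp
  · have : b w (push (t + 1) v) = false := by
      rw [Bool.eq_false_iff]
      exact fun h => hc (hbt.1 h)
    simp [hc, counterStep, this, Move.apply]

end LS

/-- The symbols strictly between the positions `p` and `q`. -/
def seg (w : List A) (p q : ℕ) : List A := (w.take (q - 1)).drop p

namespace LS

variable {S : Type} [Finite A] [Finite S]

theorem foldSeg (δ : S → Bool → A → S × Move) (s₀ : S) (i j : ℕ) :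
    LS fun w v => ((seg w (v i) (v j)).foldl (counterStep δ) (s₀, 0)).1 :=
  foldInterval ((lt (i + 1) 0).map₂ (lt 0 (j + 1)) Bool.and) (fun _ v => v i) (fun _ v => v j - 1)
    (fun w v t _ => by
      change (decide (v i < t + 1) && decide (t + 1 < v j)) = true ↔ _
      rw [Bool.and_eq_true, decide_eq_true_iff, decide_eq_true_iff]
      omega) δ s₀

theorem foldPrefix (δ : S → A → S) (s₀ : S) (i : ℕ) :
    LS fun w v => (w.take (v i - 1)).foldl δ s₀ := by
  have := foldInterval (lt 0 (i + 1)) (fun (_ : List A) _ => 0) (fun _ v => v i - 1)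
    (fun w v t _ => by
      change decide (t + 1 < v i) = true ↔ _
      rw [decide_eq_true_iff]
      omega) (fun s _ x => (δ s x, .stay)) s₀
  have h := fun (w : List A) (v : ℕ → ℕ) =>
    foldl_counterStep_stay δ id (w.take (v i - 1)) s₀ 0
  simp only [id] at h
  simpa only [List.drop_zero, h] using this

theorem foldSuffix (δ : S → A → S) (s₀ : S) (i : ℕ) :
    LS fun w v => (w.drop (v i)).foldl δ s₀ := by
  have := foldInterval (lt (i + 1) 0) (fun (_ : List A) v => v i) (fun w _ => w.length)
    (fun w v t ht => by simp [push]; omega) (fun s _ x => (δ s x, .stay)) s₀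
  have h := fun (w : List A) (v : ℕ → ℕ) =>
    foldl_counterStep_stay δ id (w.drop (v i)) s₀ 0
  simp only [id] at h
  simpa only [List.take_length, h] using this

end LS

theorem LS.rel {α : Type} {f : List A → (ℕ → ℕ) → α} (hf : LS f) (P : α → Prop) :
    LSP fun w v => P (f w v) :=
  hf.map fun a => (open Classical in decide (P a))

/-! ### Closure under connectives, bounded quantifiers and parity -/

namespace LSP

variable {R R' : List A → (ℕ → ℕ) → Prop}

theorem lt (i j : ℕ) : LSP fun (_ : List A) v => v i < v j := by
  refine (LS.lt (A := A) i j).congr fun w v => ?_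
  rw [decide_eq_decide]

theorem rel₂ (h : LSP R) (h' : LSP R') (P : Prop → Prop → Prop) :
    LSP fun w v => P (R w v) (R' w v) := by
  classical
  refine ((LS.pair h h').map fun x =>
    (open Classical in decide (P (x.1 = true) (x.2 = true)))).congr fun w v => ?_
  rw [decide_eq_decide, decide_eq_true_eq, decide_eq_true_eq]

theorem not (h : LSP R) : LSP fun w v => ¬ R w v := h.rel₂ h fun a _ => ¬ a

theorem and (h : LSP R) (h' : LSP R') : LSP fun w v => R w v ∧ R' w v := h.rel₂ h' And

theorem or (h : LSP R) (h' : LSP R') : LSP fun w v => R w v ∨ R' w v := h.rel₂ h' Or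

theorem imp (h : LSP R) (h' : LSP R') : LSP fun w v => R w v → R' w v :=
  h.rel₂ h' fun a b => a → b

theorem xor (h : LSP R) (h' : LSP R') : LSP fun w v => Xor (R w v) (R' w v) := h.rel₂ h' Xor

theorem of_iff (h : LSP R) (hR : ∀ w v, R' w v ↔ R w v) : LSP R' := by
  have : R' = R := funext fun w => funext fun v => propext (hR w v)
  rwa [this]

/-- A one-bit automaton records whether a witness has been met. The bound position becomes variable
`0` and all other variables are shifted by one, as with de Bruijn indices. -/
theorem ex (h : LSP R) : LSP fun w v => ∃ t < w.length, R w (push (t + 1) v) := by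
  classical
  have := (LS.fold h (fun (s : Bool) _ x => (s || x, .stay)) false).rel fun b => b = true
  refine this.of_iff fun w v => ?_
  rw [foldl_counterStep_stay (fun s x => s || x)]
  have hfold : ∀ (l : List ℕ) (s : Bool),
      (l.foldl (fun s t => s || decide (R w (push (t + 1) v))) s = true ↔
        s = true ∨ ∃ t ∈ l, R w (push (t + 1) v)) := by
    intro l
    induction l with
    | nil => simp
    | cons a l ih =>
      intro s
      rw [List.foldl_cons, ih]
      simp [or_assoc]
  rw [hfold]
  simp

theorem all (h : LSP R) : LSP fun w v => ∀ t < w.length, R w (push (t + 1) v) :=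
  h.not.ex.not.of_iff fun w v => by simp

/-- One bit suffices to follow the parity of a count. -/
theorem odd_countP (h : LSP R) : LSP fun w v => Odd ((List.range w.length).countP
    fun t => (open Classical in decide (R w (push (t + 1) v)))) := by
  classical
  have := (LS.fold h (fun (s : Bool) _ x => (Bool.xor s x, .stay)) false).rel fun b => b = true
  refine this.of_iff fun w v => ?_
  rw [foldl_counterStep_stay (fun s x => Bool.xor s x)]
  have hfold : ∀ (l : List ℕ) (s : Bool),
      (l.foldl (fun s t => Bool.xor s (decide (R w (push (t + 1) v)))) s = true ↔
        Odd (s.toNat + l.countP fun t => decide (R w (push (t + 1) v)))) := by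
    intro l
    induction l with
    | nil => intro s; cases s <;> simp
    | cons a l ih =>
      intro s
      rw [List.foldl_cons, ih, List.countP_cons]
      by_cases h : R w (push (a + 1) v) <;> cases s <;> simp [h, parity_simps]
  rw [hfold]
  simp

end LSP

end Space

namespace LimitDatalog

open Space

instance : Finite Sym := by
  let g : Bool ⊕ Fin 19 → Sym := fun
    | .inl b => .bit b
    | .inr i => ![.neg, .int, .numVar, .obj, .objVar, .objectPred, .ordinaryPred, .minPred,
        .maxPred, .lpar, .rpar, .plus, .minus, .times, .cmp, .lt, .le, .arrow, .ruleEnd] i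
  refine Finite.of_surjective g fun a => ?_
  cases a with
  | bit b => exact ⟨.inl b, rfl⟩
  | neg => exact ⟨.inr 0, rfl⟩
  | int => exact ⟨.inr 1, rfl⟩
  | numVar => exact ⟨.inr 2, rfl⟩
  | obj => exact ⟨.inr 3, rfl⟩
  | objVar => exact ⟨.inr 4, rfl⟩
  | objectPred => exact ⟨.inr 5, rfl⟩
  | ordinaryPred => exact ⟨.inr 6, rfl⟩
  | minPred => exact ⟨.inr 7, rfl⟩
  | maxPred => exact ⟨.inr 8, rfl⟩
  | lpar => exact ⟨.inr 9, rfl⟩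
  | rpar => exact ⟨.inr 10, rfl⟩
  | plus => exact ⟨.inr 11, rfl⟩
  | minus => exact ⟨.inr 12, rfl⟩
  | times => exact ⟨.inr 13, rfl⟩
  | cmp => exact ⟨.inr 14, rfl⟩
  | lt => exact ⟨.inr 15, rfl⟩
  | le => exact ⟨.inr 16, rfl⟩
  | arrow => exact ⟨.inr 17, rfl⟩
  | ruleEnd => exact ⟨.inr 18, rfl⟩

/-! ### Predicates on the positions of a word

Positions are counted from `1`. -/

/-- The symbol at position `p` is `a`. -/
def SymAt (w : List Sym) (p : ℕ) (a : Sym) : Prop := readInput w p = .sym a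

/-- Keep the last symbol that tells which term follows. -/
def markerStep : Option Sym → Sym → Option Sym
  | _, .objectPred => some .objectPred
  | _, .ordinaryPred => some .ordinaryPred
  | _, .minPred => some .minPred
  | _, .maxPred => some .maxPred
  | _, .cmp => some .cmp
  | _, .lt => some .lt
  | _, .le => some .le
  | c, _ => c

/-- The last predicate or comparison symbol in `u`. -/
def marker (u : List Sym) : Option Sym := u.foldl markerStep none

def endStep : Option Bool → Sym → Option Bool
  | none, .arrow => some true
  | none, .ruleEnd => some false
  | c, _ => c

/-- In `v`, an arrow comes before the first end of a rule. -/
def InBody (v : List Sym) : Prop := v.foldl endStep none = some true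

/-- The digit at position `p`, if any. -/
def digit : InCell Sym → Option Bool
  | .sym (.bit b) => some b
  | _ => none

/-- The names that follow the positions `p` and `q` are equal. -/
def SameName (w : List Sym) (p q : ℕ) : Prop :=
  ∀ t < w.length, (∀ s < w.length, s + 1 < t + 1 → digit (readInput w (p + (s + 1))) ≠ none) →
    digit (readInput w (p + (t + 1))) = digit (readInput w (q + (t + 1)))

/-- There is no end of a rule between the positions `p` and `q`. -/
def SameRule (w : List Sym) (p q : ℕ) : Prop :=
  .ruleEnd ∉ seg w p q ∧ .ruleEnd ∉ seg w q p

/-- The variable at `p` occurs in a standard body atom with predicate symbol `c` of the same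
rule. -/
def Occ (w : List Sym) (c : Sym) (p : ℕ) : Prop :=
  ∃ t < w.length, SymAt w (t + 1) .numVar ∧ marker (w.take (t + 1 - 1)) = some c ∧
    InBody (w.drop (t + 1)) ∧ SameRule w p (t + 1) ∧ SameName w p (t + 1)

/-- The variable at `p` occurs in a limit body atom. -/
def OccLimit (w : List Sym) (p : ℕ) : Prop := Occ w .minPred p ∨ Occ w .maxPred p

/-- When the segment of a word that follows a symbol has been scanned: `init` if the scan has not
left the operand where it started, `times` if the last function symbol found outside of brackets
opened during the scan is a product, `other` if not, and `dead` if the scan left the term. -/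
inductive ScanState where
  | init
  | times
  | other
  | dead

instance : Finite ScanState := by
  refine Finite.of_surjective
    (![.init, .times, .other, .dead] : Fin 4 → ScanState) fun s => ?_
  cases s
  · exact ⟨0, rfl⟩
  · exact ⟨1, rfl⟩
  · exact ⟨2, rfl⟩
  · exact ⟨3, rfl⟩

/-- Symbols within numeric terms that are not brackets or functions. -/
def IsLeafSym : Sym → Bool
  | .bit _ => true
  | .neg => true
  | .int => true
  | .numVar => true
  | _ => false

/-- The transitions of the scan; the counter contains the number of open brackets. -/
def scanTrans : ScanState → Bool → Sym → ScanState × Move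
  | .dead, _, _ => (.dead, .stay)
  | s, _, .lpar => (s, .right)
  | _, true, .rpar => (.other, .stay)
  | s, false, .rpar => (s, .left)
  | _, true, .times => (.times, .stay)
  | s, false, .times => (s, .stay)
  | _, true, .plus => (.other, .stay)
  | s, false, .plus => (s, .stay)
  | _, true, .minus => (.other, .stay)
  | s, false, .minus => (s, .stay)
  | s, _, a => (if IsLeafSym a then s else .dead, .stay)

def scan (c : ScanState × ℕ) (l : List Sym) : ScanState × ℕ := l.foldl (counterStep scanTrans) c

/-- The lowest common ancestor in a term of the leaves at `p` and `q` is a product. -/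
def Factor (w : List Sym) (p q : ℕ) : Prop :=
  (scan (.init, 0) (seg w p q)).1 = .times ∨ (scan (.init, 0) (seg w q p)).1 = .times

/-- An integer with sign given by `P` is at position `q`. -/
def IntAt (w : List Sym) (P : Option Sym → Prop) (q : ℕ) : Prop :=
  SymAt w q .int ∧ P (w.drop q).head?

def IsNegStart (c : Option Sym) : Prop := c = some .neg

def IsPosStart (c : Option Sym) : Prop := ∃ b, c = some (.bit b)

/-- The number zero has no binary digits, so the symbol after its marker is neither a sign nor a
digit. -/
def IsZeroStart (c : Option Sym) : Prop := ¬ IsNegStart c ∧ ¬ IsPosStart c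

/-- The number of positions `q` for which `R q` holds. -/
noncomputable def count (w : List Sym) (R : ℕ → Prop) : ℕ :=
  (List.range w.length).countP fun t => (open Classical in decide (R (t + 1)))

/-- The position `p` is in the right operand of the subtraction at `q`. -/
def Subtracted (w : List Sym) (p q : ℕ) : Prop :=
  SymAt w q .minus ∧ q < p ∧ (scan (.init, 0) (seg w q p)).1 = .init

/-- The coefficient of the variable at `p` is negative if all variable factors are positive and no
factor is zero. -/
def BaseNeg (w : List Sym) (p : ℕ) : Prop :=
  Xor (Odd (count w fun q => Subtracted w p q))
    (Odd (count w fun q => Factor w p q ∧ IntAt w IsNegStart q))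

def Occurs (w : List Sym) (R : ℕ → Prop) : Prop := ∃ t < w.length, R (t + 1)

/-- The coefficient of the variable at `p` can be positive (`ε = false`) or negative
(`ε = true`). -/
def Attains (w : List Sym) (p : ℕ) (ε : Bool) : Prop :=
  ¬ Occurs w (fun q => Factor w p q ∧ IntAt w IsZeroStart q) ∧
    ((¬ Occurs w (fun q => Factor w p q ∧ SymAt w q .numVar) ∧ (BaseNeg w p ↔ ε = true)) ∨
    (Occurs w (IntAt w IsPosStart) ∧ (BaseNeg w p ↔ ε = true)) ∨
    (Occurs w (IntAt w IsNegStart) ∧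
      (Xor (BaseNeg w p) (Odd (count w fun q => Factor w p q ∧ SymAt w q .numVar)) ↔ ε = true)) ∨
    (Occurs w (IntAt w IsPosStart) ∧ Occurs w (IntAt w IsNegStart) ∧
      Occurs w fun q => (Factor w p q ∧ SymAt w q .numVar) ∧
        Odd (count w fun q' => Factor w p q' ∧ SymAt w q' .numVar ∧ SameName w q q')))

/-- The rule at `p` has instances in the semi-grounding. -/
def Groundable (w : List Sym) (p : ℕ) : Prop :=
  (∀ t < w.length, SymAt w (t + 1) .objVar → SameRule w p (t + 1) →
    Occurs w fun q => SymAt w q .obj) ∧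
  (∀ t < w.length, SymAt w (t + 1) .numVar → SameRule w p (t + 1) →
    OccLimit w (t + 1) ∨ Occurs w fun q => SymAt w q .int)

/-- In the term at `p`, variables with positive coefficients must be of type `min`. -/
def MinTarget (w : List Sym) (p : ℕ) : Prop :=
  marker (w.take (p - 1)) = some .cmp ∨
    marker (w.take (p - 1)) = some .minPred ∧ ¬ InBody (w.drop p)

/-- In the term at `p`, variables with positive coefficients must be of type `max`. -/
def MaxTarget (w : List Sym) (p : ℕ) : Prop :=
  marker (w.take (p - 1)) = some .lt ∨ marker (w.take (p - 1)) = some .le ∨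
    marker (w.take (p - 1)) = some .maxPred ∧ ¬ InBody (w.drop p)

/-- The variable at `p` violates type-consistency. -/
def Violates (w : List Sym) (p : ℕ) : Prop :=
  SymAt w p .numVar ∧ OccLimit w p ∧ Groundable w p ∧
    (MinTarget w p ∧ (Attains w p false ∧ ¬ Occ w .minPred p ∨
        Attains w p true ∧ ¬ Occ w .maxPred p) ∨
      MaxTarget w p ∧ (Attains w p false ∧ ¬ Occ w .maxPred p ∨
        Attains w p true ∧ ¬ Occ w .minPred p))

/-! ### The predicates are decidable in logarithmic space -/

theorem lsp_symAt (i : ℕ) (a : Sym) : LSP fun w v => SymAt w (v i) a :=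
  (LS.read i).rel fun c => c = .sym a

theorem lsp_marker (i : ℕ) (a : Sym) : LSP fun w v => marker (w.take (v i - 1)) = some a :=
  (LS.foldPrefix markerStep none i).rel fun c => c = some a

theorem lsp_inBody (i : ℕ) : LSP fun w v => InBody (w.drop (v i)) :=
  (LS.foldSuffix endStep none i).rel fun c => c = some true

/-- As in the proofs below, the closure properties follow the shape of the definition. Each
quantifier raises the index of every outer variable by one, and `0` is the innermost bound position.
-/
theorem lsp_sameName (i j : ℕ) : LSP fun w v => SameName w (v i) (v j) :=
  LSP.all (LSP.imp
    (LSP.all ((LSP.lt 0 1).imp ((LS.readAdd (i + 2) 0).rel fun c => digit c ≠ none)))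
    (((LS.readAdd (i + 1) 0).pair (LS.readAdd (j + 1) 0)).rel fun c => digit c.1 = digit c.2))

theorem lsp_scan (i j : ℕ) (s : ScanState) :
    LSP fun w v => (scan (.init, 0) (seg w (v i) (v j))).1 = s :=
  (LS.foldSeg scanTrans .init i j).rel fun c => c = s

theorem lsp_notMem_seg (i j : ℕ) : LSP fun w v => Sym.ruleEnd ∉ seg w (v i) (v j) := by
  classical
  refine ((LS.foldSeg (fun (s : Bool) _ (a : Sym) => (s || decide (a = .ruleEnd), .stay)) false
    i j).rel fun c => c = false).of_iff fun w v => ?_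
  have hs := foldl_counterStep_stay (fun s (a : Sym) => s || decide (a = .ruleEnd)) id
    (seg w (v i) (v j)) false 0
  simp only [id] at hs
  rw [hs]
  have : ∀ (l : List Sym) (s : Bool), (l.foldl (fun s t => s || decide (t = .ruleEnd)) s =
      false ↔ s = false ∧ .ruleEnd ∉ l) := by
    intro l
    induction l with
    | nil => simp
    | cons a l ih =>
      intro s
      rw [List.foldl_cons, ih]
      simp [and_assoc, eq_comm (a := a)]
  rw [this]
  simp

theorem lsp_sameRule (i j : ℕ) : LSP fun w v => SameRule w (v i) (v j) :=
  (lsp_notMem_seg i j).and (lsp_notMem_seg j i)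

theorem lsp_occ (c : Sym) (i : ℕ) : LSP fun w v => Occ w c (v i) :=
  LSP.ex ((lsp_symAt 0 _).and ((lsp_marker 0 _).and ((lsp_inBody 0).and
    ((lsp_sameRule (i + 1) 0).and (lsp_sameName (i + 1) 0)))))

theorem lsp_occLimit (i : ℕ) : LSP fun w v => OccLimit w (v i) := (lsp_occ _ i).or (lsp_occ _ i)

theorem lsp_factor (i j : ℕ) : LSP fun w v => Factor w (v i) (v j) :=
  (lsp_scan i j _).or (lsp_scan j i _)

/-- The first symbol of a suffix is obtained by a fold that retains the first symbol it meets. -/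
theorem lsp_intAt (P : Option Sym → Prop) (i : ℕ) : LSP fun w v => IntAt w P (v i) := by
  refine (lsp_symAt i .int).and (((LS.foldSuffix (fun (c : Option Sym) a => c.or (some a)) none
    i).rel P).of_iff fun w v => ?_)
  have h : ∀ (l : List Sym) (a : Sym),
      l.foldl (fun (c : Option Sym) a => c.or (some a)) (some a) = some a := by
    intro l a
    induction l with
    | nil => rfl
    | cons b l ih => simpa using ih
  cases w.drop (v i) with
  | nil => rfl
  | cons a l =>
    rw [List.foldl_cons, Option.none_or, h]
    rfl

theorem lsp_subtracted (i j : ℕ) : LSP fun w v => Subtracted w (v i) (v j) :=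
  (lsp_symAt j _).and ((LSP.lt j i).and (lsp_scan j i _))

theorem lsp_baseNeg (i : ℕ) : LSP fun w v => BaseNeg w (v i) :=
  (LSP.odd_countP (lsp_subtracted (i + 1) 0)).xor
    (LSP.odd_countP ((lsp_factor (i + 1) 0).and (lsp_intAt IsNegStart 0)))

theorem lsp_occurs_intAt (P : Option Sym → Prop) : LSP fun w _ => Occurs w (IntAt w P) :=
  LSP.ex (lsp_intAt P 0)

theorem lsp_occurs_symAt (a : Sym) : LSP fun w _ => Occurs w fun q => SymAt w q a :=
  LSP.ex (lsp_symAt 0 a)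

theorem lsp_attains (i : ℕ) (ε : Bool) : LSP fun w v => Attains w (v i) ε :=
  (LSP.ex ((lsp_factor (i + 1) 0).and (lsp_intAt IsZeroStart 0))).not.and
    (((LSP.ex ((lsp_factor (i + 1) 0).and (lsp_symAt 0 .numVar))).not.and
      ((lsp_baseNeg i).rel₂ (lsp_baseNeg i) fun a _ => a ↔ ε = true)).or
    (((lsp_occurs_intAt _).and ((lsp_baseNeg i).rel₂ (lsp_baseNeg i) fun a _ => a ↔ ε = true)).or
    (((lsp_occurs_intAt _).and ((lsp_baseNeg i).rel₂
      (LSP.odd_countP ((lsp_factor (i + 1) 0).and (lsp_symAt 0 .numVar)))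
      fun a b => Xor a b ↔ ε = true)).or
    ((lsp_occurs_intAt _).and ((lsp_occurs_intAt _).and
      (LSP.ex (((lsp_factor (i + 1) 0).and (lsp_symAt 0 .numVar)).and
        (LSP.odd_countP ((lsp_factor (i + 2) 0).and
          ((lsp_symAt 0 .numVar).and (lsp_sameName 1 0)))))))))))

theorem lsp_groundable (i : ℕ) : LSP fun w v => Groundable w (v i) :=
  (LSP.all ((lsp_symAt 0 .objVar).imp ((lsp_sameRule (i + 1) 0).imp (lsp_occurs_symAt .obj)))).and
    (LSP.all ((lsp_symAt 0 .numVar).imp ((lsp_sameRule (i + 1) 0).imp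
      ((lsp_occLimit 0).or (lsp_occurs_symAt .int)))))

theorem lsp_violates (i : ℕ) : LSP fun w v => Violates w (v i) :=
  (lsp_symAt i _).and ((lsp_occLimit i).and ((lsp_groundable i).and
    ((((lsp_marker i _).or ((lsp_marker i _).and (lsp_inBody i).not)).and
      (((lsp_attains i _).and (lsp_occ _ i).not).or ((lsp_attains i _).and (lsp_occ _ i).not))).or
    (((lsp_marker i _).or ((lsp_marker i _).or ((lsp_marker i _).and (lsp_inBody i).not))).and
      (((lsp_attains i _).and (lsp_occ _ i).not).or
        ((lsp_attains i _).and (lsp_occ _ i).not))))))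

/-- Words in which no variable violates type-consistency. -/
def consistentWords : Language Sym := {w | ¬ ∃ t < w.length, Violates w (t + 1)}

theorem consistentWords_mem_logSpace : consistentWords ∈ LogSpace Sym := by
  have h : LSP fun w (_ : ℕ → ℕ) => ¬ ∃ t < w.length, Violates w (t + 1) :=
    (LSP.ex (lsp_violates 0)).not
  have := LS.mem_logSpace h
  simp only [decide_eq_true_eq] at this
  exact this

end LimitDatalog

namespace LimitDatalog

open Space

/-! ### Leaves of numeric terms -/

inductive Leaf where
  | int (k : ℤ)
  | var (m : ℕ)

def Leaf.encode : Leaf → List Sym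
  | .int k => encodeInt k
  | .var m => .numVar :: encodeNat m

def NumTerm.leaves : NumTerm → List Leaf
  | .int k => [.int k]
  | .var m => [.var m]
  | .add s t => s.leaves ++ t.leaves
  | .sub s t => s.leaves ++ t.leaves
  | .mul s t => s.leaves ++ t.leaves

/-- `LeafAt t x l y n F G`: the encoding of `t` consists of `x`, the encoding of the leaf `l`, and
`y`. The leaf is in the right operands of `n` subtractions, and `F` and `G` are the leaves before and
after it whose lowest common ancestor with it is a product. -/
inductive LeafAt : NumTerm → List Sym → Leaf → List Sym → ℕ → List Leaf → List Leaf → Prop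
  | int (k : ℤ) : LeafAt (.int k) [] (.int k) [] 0 [] []
  | var (m : ℕ) : LeafAt (.var m) [] (.var m) [] 0 [] []
  | addLeft {s t x l y n F G} (h : LeafAt s x l y n F G) :
      LeafAt (.add s t) (.lpar :: x) l (y ++ .plus :: (t.encode ++ [.rpar])) n F G
  | addRight {s t x l y n F G} (h : LeafAt t x l y n F G) :
      LeafAt (.add s t) (.lpar :: (s.encode ++ .plus :: x)) l (y ++ [.rpar]) n F G
  | subLeft {s t x l y n F G} (h : LeafAt s x l y n F G) :
      LeafAt (.sub s t) (.lpar :: x) l (y ++ .minus :: (t.encode ++ [.rpar])) n F G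
  | subRight {s t x l y n F G} (h : LeafAt t x l y n F G) :
      LeafAt (.sub s t) (.lpar :: (s.encode ++ .minus :: x)) l (y ++ [.rpar]) (n + 1) F G
  | mulLeft {s t x l y n F G} (h : LeafAt s x l y n F G) :
      LeafAt (.mul s t) (.lpar :: x) l (y ++ .times :: (t.encode ++ [.rpar])) n F (G ++ t.leaves)
  | mulRight {s t x l y n F G} (h : LeafAt t x l y n F G) :
      LeafAt (.mul s t) (.lpar :: (s.encode ++ .times :: x)) l (y ++ [.rpar]) n (s.leaves ++ F) G

variable {t : NumTerm} {x y : List Sym} {l : Leaf} {n : ℕ} {F G : List Leaf}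

theorem LeafAt.encode_eq (h : LeafAt t x l y n F G) : t.encode = x ++ (l.encode ++ y) := by
  induction h with
  | int k => simp [NumTerm.encode, Leaf.encode]
  | var m => simp [NumTerm.encode, Leaf.encode]
  | _ => simp_all [NumTerm.encode]

theorem LeafAt.mem_vars {m : ℕ} (h : LeafAt t x (.var m) y n F G) : m ∈ t.vars := by
  generalize hl : Leaf.var m = l at h
  induction h with
  | int k => simp at hl
  | var m' => simp_all [NumTerm.vars]
  | _ => simp_all [NumTerm.vars]

theorem LeafAt.mem_ints {k : ℤ} (h : LeafAt t x (.int k) y n F G) : k ∈ t.ints := by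
  generalize hl : Leaf.int k = l at h
  induction h with
  | int k => simp_all [NumTerm.ints]
  | var m' => simp at hl
  | _ => simp_all [NumTerm.ints]

theorem exists_leafAt_of_mem_vars {m : ℕ} (h : m ∈ t.vars) :
    ∃ x y n F G, LeafAt t x (.var m) y n F G := by
  induction t with
  | int k => simp [NumTerm.vars] at h
  | var m' =>
    obtain rfl : m = m' := by simpa [NumTerm.vars] using h
    exact ⟨_, _, _, _, _, .var m⟩
  | add s t ihs iht =>
    rcases List.mem_append.1 h with h | h
    · obtain ⟨x, y, n, F, G, h⟩ := ihs h
      exact ⟨_, _, _, _, _, h.addLeft⟩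
    · obtain ⟨x, y, n, F, G, h⟩ := iht h
      exact ⟨_, _, _, _, _, h.addRight⟩
  | sub s t ihs iht =>
    rcases List.mem_append.1 h with h | h
    · obtain ⟨x, y, n, F, G, h⟩ := ihs h
      exact ⟨_, _, _, _, _, h.subLeft⟩
    · obtain ⟨x, y, n, F, G, h⟩ := iht h
      exact ⟨_, _, _, _, _, h.subRight⟩
  | mul s t ihs iht =>
    rcases List.mem_append.1 h with h | h
    · obtain ⟨x, y, n, F, G, h⟩ := ihs h
      exact ⟨_, _, _, _, _, h.mulLeft⟩
    · obtain ⟨x, y, n, F, G, h⟩ := iht h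
      exact ⟨_, _, _, _, _, h.mulRight⟩

theorem exists_leafAt_of_mem_ints {k : ℤ} (h : k ∈ t.ints) :
    ∃ x y n F G, LeafAt t x (.int k) y n F G := by
  induction t with
  | var k => simp [NumTerm.ints] at h
  | int m' =>
    obtain rfl : k = m' := by simpa [NumTerm.ints] using h
    exact ⟨_, _, _, _, _, .int k⟩
  | add s t ihs iht =>
    rcases List.mem_append.1 h with h | h
    · obtain ⟨x, y, n, F, G, h⟩ := ihs h
      exact ⟨_, _, _, _, _, h.addLeft⟩
    · obtain ⟨x, y, n, F, G, h⟩ := iht h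
      exact ⟨_, _, _, _, _, h.addRight⟩
  | sub s t ihs iht =>
    rcases List.mem_append.1 h with h | h
    · obtain ⟨x, y, n, F, G, h⟩ := ihs h
      exact ⟨_, _, _, _, _, h.subLeft⟩
    · obtain ⟨x, y, n, F, G, h⟩ := iht h
      exact ⟨_, _, _, _, _, h.subRight⟩
  | mul s t ihs iht =>
    rcases List.mem_append.1 h with h | h
    · obtain ⟨x, y, n, F, G, h⟩ := ihs h
      exact ⟨_, _, _, _, _, h.mulLeft⟩
    · obtain ⟨x, y, n, F, G, h⟩ := iht h
      exact ⟨_, _, _, _, _, h.mulRight⟩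

/-! ### Places in lists -/

/-- A place in a concatenation is in one of the two parts. -/
theorem append_eq_append_cons {α : Type} {a : α} {u v l₁ l₂ : List α}
    (h : l₁ ++ l₂ = u ++ a :: v) :
    (∃ v', l₁ = u ++ a :: v' ∧ v = v' ++ l₂) ∨ ∃ u', l₂ = u' ++ a :: v ∧ u = l₁ ++ u' := by
  rcases List.append_eq_append_iff.1 h with ⟨u', h₁, h₂⟩ | ⟨v', h₁, h₂⟩
  · exact .inr ⟨u', h₂, h₁⟩
  · rcases v' with _ | ⟨b, v'⟩
    · exact .inr ⟨[], by simpa using h₂.symm, by simpa using h₁.symm⟩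
    · simp only [List.cons_append, List.cons.injEq] at h₂
      obtain ⟨rfl, rfl⟩ := h₂
      exact .inl ⟨v', h₁, rfl⟩

/-- A place in a list with first element `b ≠ a`. -/
theorem cons_eq_append_cons {α : Type} {a b : α} {u v l : List α}
    (h : b :: l = u ++ a :: v) (hab : b ≠ a) : ∃ u', l = u' ++ a :: v ∧ u = b :: u' := by
  rcases u with _ | ⟨c, u'⟩
  · simp only [List.nil_append, List.cons.injEq] at h
    exact (hab h.1).elim
  · simp only [List.cons_append, List.cons.injEq] at h
    exact ⟨u', h.2, by rw [h.1]⟩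

/-- A place in a `flatMap` is in one of the parts. -/
theorem flatMap_eq_append_cons {α β : Type} {f : β → List α} {a : α} {u v : List α} {l : List β}
    (h : l.flatMap f = u ++ a :: v) :
    ∃ l₁ b l₂ u' v', l = l₁ ++ b :: l₂ ∧ f b = u' ++ a :: v' ∧ u = l₁.flatMap f ++ u' ∧
      v = v' ++ l₂.flatMap f := by
  induction l generalizing u with
  | nil => simp at h
  | cons b l ih =>
    rw [List.flatMap_cons] at h
    rcases append_eq_append_cons h with ⟨v', h₁, h₂⟩ | ⟨u', h₁, h₂⟩
    · exact ⟨[], b, l, u, v', rfl, h₁, rfl, h₂⟩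
    · obtain ⟨l₁, c, l₂, x, y, rfl, hc, rfl, hv⟩ := ih h₁
      exact ⟨b :: l₁, c, l₂, x, y, rfl, hc, by simp [h₂], hv⟩

theorem mem_encodeNat {m : ℕ} {a : Sym} (h : a ∈ encodeNat m) : ∃ b, a = .bit b := by
  obtain ⟨b, -, rfl⟩ := List.mem_map.1 h
  exact ⟨b, rfl⟩

/-- The symbols that mark leaves. -/
def IsLeafMark (a : Sym) : Prop := a = .int ∨ a = .numVar

/-- The part of the encoding of a leaf after the first symbol. -/
def Leaf.digits : Leaf → List Sym
  | .int k => (if k < 0 then [.neg] else []) ++ encodeNat k.natAbs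
  | .var m => encodeNat m

def Leaf.mark : Leaf → Sym
  | .int _ => .int
  | .var _ => .numVar

theorem Leaf.encode_eq (l : Leaf) : l.encode = l.mark :: l.digits := by
  cases l <;> rfl

theorem Leaf.mem_digits {l : Leaf} {a : Sym} (h : a ∈ l.digits) :
    a = .neg ∨ ∃ b, a = .bit b := by
  cases l with
  | int k =>
    rcases List.mem_append.1 h with h | h
    · split_ifs at h
      · exact .inl (by simpa using h)
      · simp at h
    · exact .inr (mem_encodeNat h)
  | var m => exact .inr (mem_encodeNat h)

theorem Leaf.encode_eq_append_cons {a : Sym} (ha : IsLeafMark a) {u v : List Sym}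
    (h : l.encode = u ++ a :: v) : u = [] ∧ a :: v = l.encode := by
  rw [Leaf.encode_eq] at h
  rcases u with _ | ⟨c, u⟩
  · exact ⟨rfl, by rw [Leaf.encode_eq, h]; rfl⟩
  · simp only [List.cons_append, List.cons.injEq] at h
    have : a ∈ l.digits := by rw [h.2]; simp
    rcases Leaf.mem_digits this with rfl | ⟨b, rfl⟩ <;> rcases ha with h | h <;> simp at h

/-- Parsing is unambiguous at leaf marks: brackets and function symbols are different from marks,
and inside a leaf a mark can only be its first symbol. -/
theorem exists_leafAt_of_mark {a : Sym} (ha : IsLeafMark a) {v : List Sym}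
    (h : t.encode = x ++ a :: v) :
    ∃ l y n F G, LeafAt t x l y n F G ∧ a :: v = l.encode ++ y := by
  have hne : a ≠ .lpar ∧ a ≠ .rpar ∧ a ≠ .plus ∧ a ≠ .minus ∧ a ≠ .times := by
    rcases ha with rfl | rfl <;> simp
  induction t generalizing x v with
  | int k =>
    obtain ⟨rfl, h'⟩ := Leaf.encode_eq_append_cons (l := .int k) ha h
    exact ⟨_, _, _, _, _, .int k, by simpa using h'⟩
  | var m =>
    obtain ⟨rfl, h'⟩ := Leaf.encode_eq_append_cons (l := .var m) ha h
    exact ⟨_, _, _, _, _, .var m, by simpa using h'⟩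
  | add s t ihs iht =>
    obtain ⟨x, h₁, rfl⟩ := cons_eq_append_cons h hne.1.symm
    rcases append_eq_append_cons h₁ with ⟨v', h₂, rfl⟩ | ⟨u', h₂, rfl⟩
    · obtain ⟨l, y, n, F, G, hl, hv⟩ := ihs h₂
      exact ⟨_, _, _, _, _, hl.addLeft, by rw [← List.cons_append, hv]; simp⟩
    · obtain ⟨u', h₃, rfl⟩ := cons_eq_append_cons h₂ hne.2.2.1.symm
      rcases append_eq_append_cons h₃ with ⟨v', h₄, rfl⟩ | ⟨u', h₄, rfl⟩
      · obtain ⟨l, y, n, F, G, hl, hv⟩ := iht h₄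
        exact ⟨_, _, _, _, _, hl.addRight, by rw [← List.cons_append, hv]; simp⟩
      · obtain ⟨_, h₅, -⟩ := cons_eq_append_cons h₄ hne.2.1.symm
        simp at h₅
  | sub s t ihs iht =>
    obtain ⟨x, h₁, rfl⟩ := cons_eq_append_cons h hne.1.symm
    rcases append_eq_append_cons h₁ with ⟨v', h₂, rfl⟩ | ⟨u', h₂, rfl⟩
    · obtain ⟨l, y, n, F, G, hl, hv⟩ := ihs h₂
      exact ⟨_, _, _, _, _, hl.subLeft, by rw [← List.cons_append, hv]; simp⟩
    · obtain ⟨u', h₃, rfl⟩ := cons_eq_append_cons h₂ hne.2.2.2.1.symm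
      rcases append_eq_append_cons h₃ with ⟨v', h₄, rfl⟩ | ⟨u', h₄, rfl⟩
      · obtain ⟨l, y, n, F, G, hl, hv⟩ := iht h₄
        exact ⟨_, _, _, _, _, hl.subRight, by rw [← List.cons_append, hv]; simp⟩
      · obtain ⟨_, h₅, -⟩ := cons_eq_append_cons h₄ hne.2.1.symm
        simp at h₅
  | mul s t ihs iht =>
    obtain ⟨x, h₁, rfl⟩ := cons_eq_append_cons h hne.1.symm
    rcases append_eq_append_cons h₁ with ⟨v', h₂, rfl⟩ | ⟨u', h₂, rfl⟩
    · obtain ⟨l, y, n, F, G, hl, hv⟩ := ihs h₂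
      exact ⟨_, _, _, _, _, hl.mulLeft, by rw [← List.cons_append, hv]; simp⟩
    · obtain ⟨u', h₃, rfl⟩ := cons_eq_append_cons h₂ hne.2.2.2.2.symm
      rcases append_eq_append_cons h₃ with ⟨v', h₄, rfl⟩ | ⟨u', h₄, rfl⟩
      · obtain ⟨l, y, n, F, G, hl, hv⟩ := iht h₄
        exact ⟨_, _, _, _, _, hl.mulRight, by rw [← List.cons_append, hv]; simp⟩
      · obtain ⟨_, h₅, -⟩ := cons_eq_append_cons h₄ hne.2.1.symm
        simp at h₅

/-! ### Scanning encodings of terms -/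

theorem scan_append (c : ScanState × ℕ) (l₁ l₂ : List Sym) :
    scan c (l₁ ++ l₂) = scan (scan c l₁) l₂ := List.foldl_append

theorem scan_cons (c : ScanState × ℕ) (a : Sym) (l : List Sym) :
    scan c (a :: l) = scan (counterStep scanTrans c a) l := rfl

theorem step_dead (k : ℕ) (a : Sym) : counterStep scanTrans (.dead, k) a = (.dead, k) := rfl

theorem scan_dead (k : ℕ) (l : List Sym) : scan (.dead, k) l = (.dead, k) := by
  induction l with
  | nil => rfl
  | cons a l ih => rw [scan_cons, step_dead, ih]

theorem step_leafSym (s : ScanState) (k : ℕ) {a : Sym} (ha : IsLeafSym a = true) :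
    counterStep scanTrans (s, k) a = (s, k) := by
  cases s <;> cases a <;> first | rfl | simp [IsLeafSym] at ha

theorem scan_leafSyms (s : ScanState) (k : ℕ) {l : List Sym} (hl : ∀ a ∈ l, IsLeafSym a = true) :
    scan (s, k) l = (s, k) := by
  induction l with
  | nil => rfl
  | cons a l ih =>
    rw [scan_cons, step_leafSym s k (hl a (by simp)), ih fun b hb => hl b (by simp [hb])]

theorem Leaf.isLeafSym_of_mem {l : Leaf} {a : Sym} (h : a ∈ l.digits) : IsLeafSym a = true := by
  rcases Leaf.mem_digits h with rfl | ⟨b, rfl⟩ <;> rfl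

theorem Leaf.scan_encode (l : Leaf) (s : ScanState) (k : ℕ) : scan (s, k) l.encode = (s, k) := by
  refine scan_leafSyms s k fun a ha => ?_
  rw [Leaf.encode_eq] at ha
  rcases List.mem_cons.1 ha with rfl | ha
  · cases l <;> rfl
  · exact Leaf.isLeafSym_of_mem ha

theorem step_lpar (s : ScanState) (hs : s ≠ .dead) (k : ℕ) :
    counterStep scanTrans (s, k) .lpar = (s, k + 1) := by
  cases s <;> first | exact absurd rfl hs | rfl

theorem step_rpar_succ (s : ScanState) (k : ℕ) (hs : s ≠ .dead) :
    counterStep scanTrans (s, k + 1) .rpar = (s, k) := by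
  cases s <;> first | exact absurd rfl hs | simp [counterStep, scanTrans, Move.apply]

/-- Closing a bracket opened before the scan leaves the operation seen so far. That operation can no
longer be the lowest common ancestor with what follows, so its symbol is forgotten. -/
theorem step_rpar_zero (s : ScanState) (hs : s ≠ .dead) :
    counterStep scanTrans (s, 0) .rpar = (.other, 0) := by
  cases s <;> first | exact absurd rfl hs | simp [counterStep, scanTrans, Move.apply]

/-- The symbols of the arithmetic functions. -/
def IsFun (a : Sym) : Prop := a = .plus ∨ a = .minus ∨ a = .times

theorem step_fun_succ (s : ScanState) (k : ℕ) {a : Sym} (ha : IsFun a) :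
    counterStep scanTrans (s, k + 1) a = (s, k + 1) := by
  rcases ha with rfl | rfl | rfl <;> cases s <;> simp [counterStep, scanTrans, Move.apply]

theorem step_times_zero (s : ScanState) (hs : s ≠ .dead) :
    counterStep scanTrans (s, 0) .times = (.times, 0) := by
  cases s <;> first | exact absurd rfl hs | simp [counterStep, scanTrans, Move.apply]

theorem step_plus_zero (s : ScanState) (hs : s ≠ .dead) :
    counterStep scanTrans (s, 0) .plus = (.other, 0) := by
  cases s <;> first | exact absurd rfl hs | simp [counterStep, scanTrans, Move.apply]

theorem step_minus_zero (s : ScanState) (hs : s ≠ .dead) :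
    counterStep scanTrans (s, 0) .minus = (.other, 0) := by
  cases s <;> first | exact absurd rfl hs | simp [counterStep, scanTrans, Move.apply]

/-- The brackets of a term are balanced and its function symbols are met while a bracket is open, so
a scan passes over a complete subterm unchanged. -/
theorem NumTerm.scan_encode (t : NumTerm) (s : ScanState) (k : ℕ) :
    scan (s, k) t.encode = (s, k) := by
  by_cases hs : s = .dead
  · rw [hs, scan_dead]
  · have hbin : ∀ (k : ℕ) (t₁ t₂ : NumTerm) (a : Sym), IsFun a → (∀ k, scan (s, k) t₁.encode = (s, k)) →
        (∀ k, scan (s, k) t₂.encode = (s, k)) →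
        scan (s, k) (.lpar :: (t₁.encode ++ a :: (t₂.encode ++ [.rpar]))) = (s, k) := by
      intro k t₁ t₂ a ha h₁ h₂
      rw [scan_cons, step_lpar s hs, scan_append, h₁, scan_cons, step_fun_succ s k ha, scan_append,
        h₂, scan_cons, step_rpar_succ s k hs]
      rfl
    induction t generalizing k with
    | int i => exact Leaf.scan_encode (.int i) s k
    | var m => exact Leaf.scan_encode (.var m) s k
    | add t₁ t₂ h₁ h₂ => exact hbin _ _ _ _ (.inl rfl) h₁ h₂
    | sub t₁ t₂ h₁ h₂ => exact hbin _ _ _ _ (.inr (.inl rfl)) h₁ h₂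
    | mul t₁ t₂ h₁ h₂ => exact hbin _ _ _ _ (.inr (.inr rfl)) h₁ h₂

/-- The scan up to a leaf of a term only opens brackets. -/
theorem LeafAt.scan_before (h : LeafAt t x l y n F G) :
    ∃ j, ∀ s, s ≠ ScanState.dead → ∀ k, scan (s, k) x = (s, k + j) := by
  have hL : ∀ x : List Sym, (∃ j, ∀ s, s ≠ ScanState.dead → ∀ k, scan (s, k) x = (s, k + j)) →
      ∃ j, ∀ s, s ≠ ScanState.dead → ∀ k, scan (s, k) (.lpar :: x) = (s, k + j) := by
    rintro x ⟨j, hj⟩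
    refine ⟨j + 1, fun s hs k => ?_⟩
    rw [scan_cons, step_lpar s hs, hj s hs, add_assoc, add_comm 1]
  have hR : ∀ (t' : NumTerm) (a : Sym) (x : List Sym), IsFun a →
      (∃ j, ∀ s, s ≠ ScanState.dead → ∀ k, scan (s, k) x = (s, k + j)) →
      ∃ j, ∀ s, s ≠ ScanState.dead → ∀ k,
        scan (s, k) (.lpar :: (t'.encode ++ a :: x)) = (s, k + j) := by
    rintro t' a x ha ⟨j, hj⟩
    refine ⟨j + 1, fun s hs k => ?_⟩
    rw [scan_cons, step_lpar s hs, scan_append, NumTerm.scan_encode, scan_cons,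
      step_fun_succ s k ha, hj s hs, add_assoc, add_comm 1]
  induction h with
  | int k => exact ⟨0, fun _ _ _ => rfl⟩
  | var k => exact ⟨0, fun _ _ _ => rfl⟩
  | addLeft _ ih => exact hL _ ih
  | addRight _ ih => exact hR _ _ _ (.inl rfl) ih
  | subLeft _ ih => exact hL _ ih
  | subRight _ ih => exact hR _ _ _ (.inr (.inl rfl)) ih
  | mulLeft _ ih => exact hL _ ih
  | mulRight _ ih => exact hR _ _ _ (.inr (.inr rfl)) ih

end LimitDatalog

namespace LimitDatalog

open Space

/-! ### Counting factors and subtractions -/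

section Counting

open scoped Classical

/-- The number of leaves in a list that satisfy `P`. -/
noncomputable def leafCount (P : Leaf → Prop) (F : List Leaf) : ℕ := F.countP fun l => decide (P l)

theorem leafCount_append (P : Leaf → Prop) (F G : List Leaf) :
    leafCount P (F ++ G) = leafCount P F + leafCount P G := List.countP_append

/-- The number of places in a word (followed by `rest`) that satisfy `ψ` and are such that the scan
from there to the end of the word results in `times`. -/
noncomputable def leftCount (ψ : List Sym → Prop) (rest : List Sym) : List Sym → ℕ
  | [] => 0
  | b :: g => (if (scan (.init, 0) g).1 = .times ∧ ψ (b :: (g ++ rest)) then 1 else 0) +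
      leftCount ψ rest g

/-- The number of places in a word that satisfy `ψ` and are such that the scan up to there results
in `times`. -/
noncomputable def rightCount (ψ : List Sym → Prop) : ScanState × ℕ → List Sym → ℕ
  | _, [] => 0
  | c, b :: z => (if c.1 = .times ∧ ψ (b :: z) then 1 else 0) +
      rightCount ψ (counterStep scanTrans c b) z

/-- The number of places with a subtraction such that the scan from there to the end of the word
results in `init`. -/
noncomputable def minusCount : List Sym → ℕ
  | [] => 0
  | b :: g => (if b = .minus ∧ (scan (.init, 0) g).1 = .init then 1 else 0) + minusCount g

/-- The predicate `ψ` on places in words depends on the leaf found there. -/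
structure Reads (ψ : List Sym → Prop) (P : Leaf → Prop) : Prop where
  mark : ∀ a z, ψ (a :: z) → IsLeafMark a
  iff : ∀ (l : Leaf) (a : Sym) (z : List Sym), IsLeafSym a = false →
    (ψ (l.encode ++ a :: z) ↔ P l)

variable {ψ : List Sym → Prop} {P : Leaf → Prop}

theorem leftCount_cons_skip (hψ : Reads ψ P) {a : Sym} (ha : ¬ IsLeafMark a) (rest l : List Sym) :
    leftCount ψ rest (a :: l) = leftCount ψ rest l := by
  rw [leftCount, if_neg fun h => ha (hψ.mark _ _ h.2), zero_add]

theorem leftCount_append_skip (hψ : Reads ψ P) {D : List Sym} (hD : ∀ a ∈ D, ¬ IsLeafMark a)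
    (rest l : List Sym) : leftCount ψ rest (D ++ l) = leftCount ψ rest l := by
  induction D with
  | nil => rfl
  | cons a D ih =>
    rw [List.cons_append, leftCount_cons_skip hψ (hD a (by simp)), ih fun b hb => hD b (by simp [hb])]

theorem rightCount_cons_skip (hψ : Reads ψ P) {a : Sym} (ha : ¬ IsLeafMark a) (c : ScanState × ℕ)
    (l : List Sym) : rightCount ψ c (a :: l) = rightCount ψ (counterStep scanTrans c a) l := by
  rw [rightCount, if_neg fun h => ha (hψ.mark _ _ h.2), zero_add]

theorem rightCount_dead (k : ℕ) (l : List Sym) : rightCount ψ (.dead, k) l = 0 := by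
  induction l with
  | nil => rfl
  | cons a l ih => simp [rightCount, step_dead, ih]

theorem Leaf.not_isLeafMark_of_mem {l : Leaf} {a : Sym} (h : a ∈ l.digits) : ¬ IsLeafMark a := by
  rcases Leaf.mem_digits h with rfl | ⟨b, rfl⟩ <;> simp [IsLeafMark]

theorem rightCount_digits_append (hψ : Reads ψ P) (l : Leaf) (s : ScanState) (k : ℕ)
    (C : List Sym) : rightCount ψ (s, k) (l.digits ++ C) = rightCount ψ (s, k) C := by
  have : ∀ D : List Sym, (∀ a ∈ D, a ∈ l.digits) →
      rightCount ψ (s, k) (D ++ C) = rightCount ψ (s, k) C := by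
    intro D hD
    induction D with
    | nil => rfl
    | cons a D ih =>
      rw [List.cons_append, rightCount_cons_skip hψ (Leaf.not_isLeafMark_of_mem (hD a (by simp))),
        step_leafSym s k (Leaf.isLeafSym_of_mem (hD a (by simp))), ih fun b hb => hD b (by simp [hb])]
  exact this _ fun _ h => h

theorem not_isLeafMark_lpar : ¬ IsLeafMark .lpar := by simp [IsLeafMark]

theorem not_isLeafMark_rpar : ¬ IsLeafMark .rpar := by simp [IsLeafMark]

theorem IsFun.not_isLeafMark {a : Sym} (ha : IsFun a) : ¬ IsLeafMark a := by
  rcases ha with rfl | rfl | rfl <;> simp [IsLeafMark]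

theorem IsFun.isLeafSym {a : Sym} (ha : IsFun a) : IsLeafSym a = false := by
  rcases ha with rfl | rfl | rfl <;> rfl

theorem IsFun.step_zero {a : Sym} (ha : IsFun a) {s : ScanState} (hs : s ≠ .dead) :
    ∃ s', s' ≠ .dead ∧ s' ≠ .init ∧ counterStep scanTrans (s, 0) a = (s', 0) := by
  rcases ha with rfl | rfl | rfl
  · exact ⟨.other, by simp, by simp, step_plus_zero s hs⟩
  · exact ⟨.other, by simp, by simp, step_minus_zero s hs⟩
  · exact ⟨.times, by simp, by simp, step_times_zero s hs⟩

theorem leftCount_leaf (hψ : Reads ψ P) (l : Leaf) (rest : List Sym) {a : Sym} {C : List Sym}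
    (ha : IsLeafSym a = false) :
    leftCount ψ rest (l.encode ++ a :: C) =
      (if (scan (.init, 0) (a :: C)).1 = .times then leafCount P [l] else 0) +
        leftCount ψ rest (a :: C) := by
  have h := hψ.iff l a (C ++ rest) ha
  rw [Leaf.encode_eq, List.cons_append] at h ⊢
  rw [leftCount, leftCount_append_skip hψ fun b hb => Leaf.not_isLeafMark_of_mem hb, scan_append,
    scan_leafSyms _ _ fun b hb => Leaf.isLeafSym_of_mem hb]
  congr 1
  simp only [List.append_assoc, List.cons_append, h, leafCount, List.countP_singleton,
    decide_eq_true_eq]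
  split_ifs <;> simp_all

/-- All leaves of a term that is followed by `C`, or none, are counted. -/
theorem leftCount_term (hψ : Reads ψ P) (t : NumTerm) (rest : List Sym) {a : Sym} {C : List Sym}
    {T : Prop} (ha : IsLeafSym a = false)
    (hC : ∀ s, s ≠ ScanState.dead → ((scan (s, 0) (a :: C)).1 = .times ↔ T)) :
    leftCount ψ rest (t.encode ++ a :: C) =
      (if T then leafCount P t.leaves else 0) + leftCount ψ rest (a :: C) := by
  -- The step common to the three operations. The hypothesis on `C` concerns all live states because
  -- scans from different leaves of the term arrive at `C` in different states.
  have hbin : ∀ (t₁ t₂ : NumTerm) (f a : Sym) (C : List Sym), IsFun f → IsLeafSym a = false →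
      (∀ s, s ≠ ScanState.dead → ((scan (s, 0) (a :: C)).1 = .times ↔ T)) →
      (∀ (a : Sym) (C : List Sym), IsLeafSym a = false →
        (∀ s, s ≠ ScanState.dead → ((scan (s, 0) (a :: C)).1 = .times ↔ T)) →
        leftCount ψ rest (t₁.encode ++ a :: C) =
          (if T then leafCount P t₁.leaves else 0) + leftCount ψ rest (a :: C)) →
      (∀ (a : Sym) (C : List Sym), IsLeafSym a = false →
        (∀ s, s ≠ ScanState.dead → ((scan (s, 0) (a :: C)).1 = .times ↔ T)) →
        leftCount ψ rest (t₂.encode ++ a :: C) =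
          (if T then leafCount P t₂.leaves else 0) + leftCount ψ rest (a :: C)) →
      leftCount ψ rest (.lpar :: (t₁.encode ++ f :: (t₂.encode ++ [.rpar])) ++ a :: C) =
        (if T then leafCount P (t₁.leaves ++ t₂.leaves) else 0) + leftCount ψ rest (a :: C) := by
    intro t₁ t₂ f a C hf ha hC h₁ h₂
    have hr : ∀ s, s ≠ ScanState.dead →
        ((scan (s, 0) (.rpar :: a :: C)).1 = .times ↔ T) := by
      intro s hs
      rw [scan_cons, step_rpar_zero s hs, hC _ (by simp)]
    simp only [List.cons_append, List.append_assoc, List.nil_append]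
    rw [leftCount_cons_skip hψ not_isLeafMark_lpar, h₁ _ _ hf.isLeafSym,
      leftCount_cons_skip hψ hf.not_isLeafMark, h₂ _ _ rfl hr,
      leftCount_cons_skip hψ not_isLeafMark_rpar, leafCount_append]
    · split_ifs <;> omega
    · intro s hs
      obtain ⟨s', hs', -, h⟩ := hf.step_zero hs
      rw [scan_cons, h, scan_append, NumTerm.scan_encode, hr _ hs']
  induction t generalizing a C with
  | int k =>
    have := leftCount_leaf hψ (.int k) rest ha (C := C)
    simp only [hC .init (by simp)] at this
    exact this
  | var m =>
    have := leftCount_leaf hψ (.var m) rest ha (C := C)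
    simp only [hC .init (by simp)] at this
    exact this
  | add t₁ t₂ h₁ h₂ =>
    exact hbin _ _ _ _ _ (.inl rfl) ha hC (fun _ _ h h' => h₁ h h') fun _ _ h h' => h₂ h h'
  | sub t₁ t₂ h₁ h₂ =>
    exact hbin _ _ _ _ _ (.inr (.inl rfl)) ha hC (fun _ _ h h' => h₁ h h') fun _ _ h h' => h₂ h h'
  | mul t₁ t₂ h₁ h₂ =>
    exact hbin _ _ _ _ _ (.inr (.inr rfl)) ha hC (fun _ _ h h' => h₁ h h') fun _ _ h h' => h₂ h h'

theorem rightCount_leaf (hψ : Reads ψ P) (l : Leaf) {a : Sym} {C : List Sym} (s : ScanState) (k : ℕ)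
    (ha : IsLeafSym a = false) :
    rightCount ψ (s, k) (l.encode ++ a :: C) =
      (if s = .times then leafCount P [l] else 0) + rightCount ψ (s, k) (a :: C) := by
  have h := hψ.iff l a C ha
  rw [Leaf.encode_eq, List.cons_append] at h ⊢
  rw [rightCount, step_leafSym s k (by cases l <;> rfl), rightCount_digits_append hψ]
  congr 1
  simp only [h, leafCount, List.countP_singleton, decide_eq_true_eq]
  split_ifs <;> simp_all

/-- Throughout the term the scan has the state with which it arrived, so either all leaves are
counted or none. -/
theorem rightCount_term (hψ : Reads ψ P) (t : NumTerm) {a : Sym} {C : List Sym} (s : ScanState)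
    (k : ℕ) (ha : IsLeafSym a = false) :
    rightCount ψ (s, k) (t.encode ++ a :: C) =
      (if s = .times then leafCount P t.leaves else 0) + rightCount ψ (s, k) (a :: C) := by
  by_cases hs : s = .dead
  · subst hs
    simp [rightCount_dead]
  have hbin : ∀ (k : ℕ) (t₁ t₂ : NumTerm) (f a : Sym) (C : List Sym), IsFun f →
      (∀ (k : ℕ) (a : Sym) (C : List Sym), IsLeafSym a = false →
        rightCount ψ (s, k) (t₁.encode ++ a :: C) =
          (if s = .times then leafCount P t₁.leaves else 0) + rightCount ψ (s, k) (a :: C)) →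
      (∀ (k : ℕ) (a : Sym) (C : List Sym), IsLeafSym a = false →
        rightCount ψ (s, k) (t₂.encode ++ a :: C) =
          (if s = .times then leafCount P t₂.leaves else 0) + rightCount ψ (s, k) (a :: C)) →
      rightCount ψ (s, k) (.lpar :: (t₁.encode ++ f :: (t₂.encode ++ [.rpar])) ++ a :: C) =
        (if s = .times then leafCount P (t₁.leaves ++ t₂.leaves) else 0) +
          rightCount ψ (s, k) (a :: C) := by
    intro k t₁ t₂ f a C hf h₁ h₂
    simp only [List.cons_append, List.append_assoc, List.nil_append]
    rw [rightCount_cons_skip hψ not_isLeafMark_lpar, step_lpar s hs, h₁ _ _ _ hf.isLeafSym,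
      rightCount_cons_skip hψ hf.not_isLeafMark, step_fun_succ s k hf, h₂ _ _ _ rfl,
      rightCount_cons_skip hψ not_isLeafMark_rpar, step_rpar_succ s k hs, leafCount_append]
    split_ifs <;> omega
  induction t generalizing a C k with
  | int i => exact rightCount_leaf hψ (.int i) s k ha
  | var m => exact rightCount_leaf hψ (.var m) s k ha
  | add t₁ t₂ h₁ h₂ =>
    exact hbin _ _ _ _ _ _ (.inl rfl) (fun _ _ _ h => h₁ _ h) fun _ _ _ h => h₂ _ h
  | sub t₁ t₂ h₁ h₂ =>
    exact hbin _ _ _ _ _ _ (.inr (.inl rfl)) (fun _ _ _ h => h₁ _ h) fun _ _ _ h => h₂ _ h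
  | mul t₁ t₂ h₁ h₂ =>
    exact hbin _ _ _ _ _ _ (.inr (.inr rfl)) (fun _ _ _ h => h₁ _ h) fun _ _ _ h => h₂ _ h

/-- No subtraction in a term that is followed by `C` is counted. -/
theorem minusCount_term (t : NumTerm) {C : List Sym}
    (hC : ∀ s, s ≠ ScanState.dead → s ≠ .init → (scan (s, 0) C).1 ≠ .init) :
    minusCount (t.encode ++ C) = minusCount C := by
  have hleaf : ∀ (l : Leaf) (C : List Sym), minusCount (l.encode ++ C) = minusCount C := by
    intro l C
    have : ∀ D : List Sym, (∀ a ∈ D, a ∈ l.encode) → minusCount (D ++ C) = minusCount C := by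
      intro D hD
      induction D with
      | nil => rfl
      | cons a D ih =>
        rw [List.cons_append, minusCount, ih fun b hb => hD b (by simp [hb]), if_neg, zero_add]
        rintro ⟨rfl, -⟩
        have := hD _ List.mem_cons_self
        rw [Leaf.encode_eq, List.mem_cons] at this
        rcases this with h | h
        · cases l <;> simp [Leaf.mark] at h
        · rcases Leaf.mem_digits h with h | ⟨b, h⟩ <;> simp at h
    exact this _ fun _ h => h
  have hbin : ∀ (t₁ t₂ : NumTerm) (f : Sym) (C : List Sym), IsFun f →
      (∀ s, s ≠ ScanState.dead → s ≠ .init → (scan (s, 0) C).1 ≠ .init) →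
      (∀ (C : List Sym), (∀ s, s ≠ ScanState.dead → s ≠ .init → (scan (s, 0) C).1 ≠ .init) →
        minusCount (t₁.encode ++ C) = minusCount C) →
      (∀ (C : List Sym), (∀ s, s ≠ ScanState.dead → s ≠ .init → (scan (s, 0) C).1 ≠ .init) →
        minusCount (t₂.encode ++ C) = minusCount C) →
      minusCount (.lpar :: (t₁.encode ++ f :: (t₂.encode ++ [.rpar])) ++ C) = minusCount C := by
    intro t₁ t₂ f C hf hC h₁ h₂
    have hr : ∀ s, s ≠ ScanState.dead → (scan (s, 0) (.rpar :: C)).1 ≠ .init := by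
      intro s hs
      rw [scan_cons, step_rpar_zero s hs]
      exact hC _ (by simp) (by simp)
    simp only [List.cons_append, List.append_assoc, List.nil_append]
    rw [minusCount, if_neg (by simp), zero_add, h₁, minusCount, if_neg, zero_add,
      h₂ _ fun s hs _ => hr s hs, minusCount, if_neg (by simp), zero_add]
    · rw [scan_append, NumTerm.scan_encode]
      exact fun h => hr _ (by simp) h.2
    · intro s hs _
      obtain ⟨s', hs', -, h⟩ := hf.step_zero hs
      rw [scan_cons, h, scan_append, NumTerm.scan_encode]
      exact hr _ hs'
  induction t generalizing C with
  | int k => exact hleaf (.int k) C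
  | var m => exact hleaf (.var m) C
  | add t₁ t₂ h₁ h₂ => exact hbin _ _ _ _ (.inl rfl) hC (fun _ h => h₁ h) fun _ h => h₂ h
  | sub t₁ t₂ h₁ h₂ => exact hbin _ _ _ _ (.inr (.inl rfl)) hC (fun _ h => h₁ h) fun _ h => h₂ h
  | mul t₁ t₂ h₁ h₂ => exact hbin _ _ _ _ (.inr (.inr rfl)) hC (fun _ h => h₁ h) fun _ h => h₂ h

variable {t : NumTerm} {x y : List Sym} {l : Leaf} {n : ℕ} {F G : List Leaf}

/-- A scan from a leaf of a left sibling meets the function symbol of the common ancestor outside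
the brackets it has opened. After that, by `LeafAt.scan_before`, nothing changes the state, so the
result is `times` exactly below a product. -/
theorem LeafAt.leftCount_eq (hψ : Reads ψ P) (h : LeafAt t x l y n F G) (rest : List Sym) :
    leftCount ψ rest x = leafCount P F := by
  have hR : ∀ {t : NumTerm} {x : List Sym} {l y n F G} (s : NumTerm) (f : Sym), IsFun f →
      LeafAt t x l y n F G → leftCount ψ rest x = leafCount P F →
      leftCount ψ rest (.lpar :: (s.encode ++ f :: x)) =
        (if f = .times then leafCount P s.leaves else 0) + leafCount P F := by
    intro t x l y n F G s f hf h ih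
    obtain ⟨j, hj⟩ := h.scan_before
    rw [leftCount_cons_skip hψ not_isLeafMark_lpar, leftCount_term hψ s rest (T := f = .times)
      hf.isLeafSym, leftCount_cons_skip hψ hf.not_isLeafMark, ih]
    intro s' hs'
    rw [scan_cons]
    rcases hf with rfl | rfl | rfl
    · rw [step_plus_zero s' hs', hj _ (by simp)]
      simp
    · rw [step_minus_zero s' hs', hj _ (by simp)]
      simp
    · rw [step_times_zero s' hs', hj _ (by simp)]
      simp
  induction h with
  | int k => rfl
  | var m => rfl
  | addLeft _ ih => rw [leftCount_cons_skip hψ not_isLeafMark_lpar, ih]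
  | subLeft _ ih => rw [leftCount_cons_skip hψ not_isLeafMark_lpar, ih]
  | mulLeft _ ih => rw [leftCount_cons_skip hψ not_isLeafMark_lpar, ih]
  | addRight h ih => rw [hR _ _ (.inl rfl) h ih]; simp
  | subRight h ih => rw [hR _ _ (.inr (.inl rfl)) h ih]; simp
  | mulRight h ih => rw [hR _ _ (.inr (.inr rfl)) h ih, leafCount_append]; simp

/-- The scan climbs from the leaf: at each ancestor with the leaf on its left, the function symbol
sets the state for the whole right operand, and the closing bracket resets it. Only the fact that
the final state `s'` is live is needed for the symbols `V` that follow. -/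
theorem LeafAt.rightCount_eq (hψ : Reads ψ P) (h : LeafAt t x l y n F G) (V : List Sym)
    {s : ScanState} (hs : s ≠ .dead) :
    ∃ s', s' ≠ ScanState.dead ∧
      rightCount ψ (s, 0) (y ++ V) = leafCount P G + rightCount ψ (s', 0) V := by
  have hR : ∀ {y : List Sym} {G : List Leaf} {V : List Sym},
      (∃ s', s' ≠ ScanState.dead ∧ rightCount ψ (s, 0) (y ++ .rpar :: V) =
        leafCount P G + rightCount ψ (s', 0) (.rpar :: V)) →
      ∃ s', s' ≠ ScanState.dead ∧ rightCount ψ (s, 0) ((y ++ [.rpar]) ++ V) =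
        leafCount P G + rightCount ψ (s', 0) V := by
    rintro y G V ⟨s', hs', h⟩
    refine ⟨.other, by simp, ?_⟩
    rw [List.append_assoc, List.singleton_append, h,
      rightCount_cons_skip hψ not_isLeafMark_rpar, step_rpar_zero s' hs']
  have hL : ∀ {y : List Sym} {G : List Leaf} {V : List Sym} (f : Sym) (t : NumTerm), IsFun f →
      (∃ s', s' ≠ ScanState.dead ∧ rightCount ψ (s, 0) (y ++ f :: (t.encode ++ .rpar :: V)) =
        leafCount P G + rightCount ψ (s', 0) (f :: (t.encode ++ .rpar :: V))) →
      ∃ s', s' ≠ ScanState.dead ∧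
        rightCount ψ (s, 0) ((y ++ f :: (t.encode ++ [.rpar])) ++ V) =
          leafCount P G + (if f = .times then leafCount P t.leaves else 0) +
            rightCount ψ (s', 0) V := by
    rintro y G V f t hf ⟨s', hs', h⟩
    refine ⟨.other, by simp, ?_⟩
    simp only [List.append_assoc, List.cons_append, List.nil_append]
    rw [h, rightCount_cons_skip hψ hf.not_isLeafMark]
    rcases hf with rfl | rfl | rfl
    · rw [step_plus_zero s' hs', rightCount_term hψ t _ _ rfl,
        rightCount_cons_skip hψ not_isLeafMark_rpar, step_rpar_zero _ (by simp)]
      simp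
    · rw [step_minus_zero s' hs', rightCount_term hψ t _ _ rfl,
        rightCount_cons_skip hψ not_isLeafMark_rpar, step_rpar_zero _ (by simp)]
      simp
    · rw [step_times_zero s' hs', rightCount_term hψ t _ _ rfl,
        rightCount_cons_skip hψ not_isLeafMark_rpar, step_rpar_zero _ (by simp)]
      simp [add_assoc]
  induction h generalizing V with
  | int k => exact ⟨s, hs, by simp [leafCount]⟩
  | var m => exact ⟨s, hs, by simp [leafCount]⟩
  | addRight _ ih => exact hR (ih _)
  | subRight _ ih => exact hR (ih _)
  | mulRight _ ih => exact hR (ih _)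
  | addLeft _ ih => simpa using hL .plus _ (.inl rfl) (ih _)
  | subLeft _ ih => simpa using hL .minus _ (.inr (.inl rfl)) (ih _)
  | mulLeft _ ih => simpa [leafCount_append] using hL .times _ (.inr (.inr rfl)) (ih _)

/-- From a minus sign, the scan up to the leaf stays in `init` precisely if the leaf is in the right
operand. If not, a closing bracket or another function symbol is met outside the opened brackets. -/
theorem LeafAt.minusCount_eq (h : LeafAt t x l y n F G) : minusCount x = n := by
  have hR : ∀ {t : NumTerm} {x : List Sym} {l y n F G} (s : NumTerm) (f : Sym), IsFun f →
      LeafAt t x l y n F G → minusCount x = n →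
      minusCount (.lpar :: (s.encode ++ f :: x)) = n + if f = .minus then 1 else 0 := by
    intro t x l y n F G s f hf h ih
    obtain ⟨j, hj⟩ := h.scan_before
    rw [minusCount, if_neg (by simp), zero_add, minusCount_term, minusCount, ih,
      hj _ (by simp), add_comm]
    · simp
    · intro s' hs' _
      obtain ⟨s'', h₁, h₂, h₃⟩ := hf.step_zero hs'
      rw [scan_cons, h₃, hj _ h₁]
      exact h₂
  have hL : ∀ x : List Sym, minusCount (.lpar :: x) = minusCount x := by
    intro x
    rw [minusCount, if_neg (by simp), zero_add]
  induction h with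
  | int k => rfl
  | var m => rfl
  | addLeft _ ih => rw [hL, ih]
  | subLeft _ ih => rw [hL, ih]
  | mulLeft _ ih => rw [hL, ih]
  | addRight h ih => rw [hR _ _ (.inl rfl) h ih]; simp
  | subRight h ih => rw [hR _ _ (.inr (.inl rfl)) h ih]; simp
  | mulRight h ih => rw [hR _ _ (.inr (.inr rfl)) h ih]; simp

/-! ### From positions to lists -/

theorem leftCount_eq_countP (rest u : List Sym) :
    leftCount ψ rest u = (List.range u.length).countP fun t =>
      decide ((scan (.init, 0) (u.drop (t + 1))).1 = .times ∧ ψ (u.drop t ++ rest)) := by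
  induction u with
  | nil => rfl
  | cons b g ih =>
    rw [leftCount, ih, List.length_cons, List.range_succ_eq_map, List.countP_cons, List.countP_map,
      add_comm]
    congr 1
    simp

theorem rightCount_eq_countP (c : ScanState × ℕ) (v : List Sym) :
    rightCount ψ c v = (List.range v.length).countP fun t =>
      decide ((scan c (v.take t)).1 = .times ∧ ψ (v.drop t)) := by
  induction v generalizing c with
  | nil => rfl
  | cons b g ih =>
    rw [rightCount, ih, List.length_cons, List.range_succ_eq_map, List.countP_cons, List.countP_map,
      add_comm]
    congr 1
    simp [scan]

theorem minusCount_eq_countP (u : List Sym) :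
    minusCount u = (List.range u.length).countP fun t =>
      decide ((u.drop t).head? = some .minus ∧ (scan (.init, 0) (u.drop (t + 1))).1 = .init) := by
  induction u with
  | nil => rfl
  | cons b g ih =>
    rw [minusCount, ih, List.length_cons, List.range_succ_eq_map, List.countP_cons, List.countP_map,
      add_comm]
    congr 1
    simp

theorem symAt_append_cons (u v : List Sym) (a b : Sym) :
    SymAt (u ++ a :: v) (u.length + 1) b ↔ a = b := by
  simp [SymAt, readInput]

theorem symAt_iff (w : List Sym) (t : ℕ) (a : Sym) :
    SymAt w (t + 1) a ↔ ∃ u v, w = u ++ a :: v ∧ u.length = t := by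
  constructor
  · intro h
    have ht : t < w.length := by
      by_contra hc
      simp [SymAt, readInput, List.getElem?_eq_none (not_lt.1 hc)] at h
    refine ⟨w.take t, w.drop (t + 1), ?_, by simp; omega⟩
    simp only [SymAt, Frag.readInput_succ_of_lt ht, InCell.sym.injEq] at h
    rw [← h]
    simp
  · rintro ⟨u, v, rfl, rfl⟩
    exact (symAt_append_cons u v a a).2 rfl

theorem range_length_append_cons (u v : List Sym) (a : Sym) :
    List.range (u ++ a :: v).length =
      List.range u.length ++ u.length :: (List.range v.length).map (u.length + 1 + ·) := by
  rw [List.length_append, List.length_cons, add_comm v.length, ← add_assoc, List.range_add,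
    List.range_succ]
  simp

/-- Positions before and after the leaf are counted separately. For each of them one disjunct of
`Factor` concerns an empty segment, on which the scan stays in `init`. The same happens at the leaf
itself, which is thus not its own factor. -/
theorem count_factor {u v : List Sym} {a : Sym} {R : ℕ → Prop}
    (hR : ∀ u' b v', u ++ a :: v = u' ++ b :: v' → (R (u'.length + 1) ↔ ψ (b :: v'))) :
    count (u ++ a :: v) (fun q => Factor (u ++ a :: v) (u.length + 1) q ∧ R q) =
      leftCount ψ (a :: v) u + rightCount ψ (.init, 0) v := by
  have hR' : ∀ t < (u ++ a :: v).length, (R (t + 1) ↔ ψ ((u ++ a :: v).drop t)) := by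
    intro t ht
    have h := hR ((u ++ a :: v).take t) (u ++ a :: v)[t] ((u ++ a :: v).drop (t + 1)) (by simp)
    have hlen : ((u ++ a :: v).take t).length = t := by simp at ht ⊢; omega
    rw [hlen] at h
    rw [h, List.drop_eq_getElem_cons ht]
  rw [count, range_length_append_cons, List.countP_append, List.countP_cons, List.countP_map,
    leftCount_eq_countP, rightCount_eq_countP]
  have hmid : ¬ Factor (u ++ a :: v) (u.length + 1) (u.length + 1) := by
    have : seg (u ++ a :: v) (u.length + 1) (u.length + 1) = [] := by simp [seg]
    simp [Factor, this, scan]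
  simp only [hmid, false_and, decide_false, Bool.false_eq_true, if_false, add_zero]
  congr 1
  · refine List.countP_congr fun t ht => ?_
    have ht : t < u.length := List.mem_range.1 ht
    have h₁ : seg (u ++ a :: v) (u.length + 1) (t + 1) = [] := by simp [seg]; omega
    have h₂ : seg (u ++ a :: v) (t + 1) (u.length + 1) = u.drop (t + 1) := by simp [seg]
    simp only [decide_eq_true_eq]
    rw [Factor, h₁, h₂, hR' t (by simp; omega),
      List.drop_append_of_le_length ht.le]
    simp [scan]
  · refine List.countP_congr fun t ht => ?_
    have ht : t < v.length := List.mem_range.1 ht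
    have h₁ : seg (u ++ a :: v) (u.length + 1 + t + 1) (u.length + 1) = [] := by
      simp [seg]; omega
    have h₂ : seg (u ++ a :: v) (u.length + 1) (u.length + 1 + t + 1) = v.take t := by
      have : u ++ a :: v = (u ++ [a]) ++ v := by simp
      have hlen : u.length + 1 = (u ++ [a]).length := by simp
      rw [seg, this, hlen, Nat.add_sub_cancel, List.take_length_add_append, List.drop_left]
    have h₃ : (u ++ a :: v).drop (u.length + 1 + t) = v.drop t := by
      have : u ++ a :: v = (u ++ [a]) ++ v := by simp
      have hlen : u.length + 1 = (u ++ [a]).length := by simp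
      rw [this, hlen, List.drop_length_add_append]
    simp only [Function.comp_apply, decide_eq_true_eq]
    rw [Factor, h₁, h₂, hR' _ (by simp; omega), h₃]
    simp [scan]

theorem count_subtracted (u v : List Sym) (a : Sym) :
    count (u ++ a :: v) (fun q => Subtracted (u ++ a :: v) (u.length + 1) q) = minusCount u := by
  rw [count, range_length_append_cons, List.countP_append, List.countP_cons, List.countP_map,
    minusCount_eq_countP]
  have hge : ∀ q, u.length + 1 ≤ q → ¬ Subtracted (u ++ a :: v) (u.length + 1) q :=
    fun q hq h => absurd h.2.1 (by omega)
  have hz : (List.range v.length).countP ((fun t => decide (Subtracted (u ++ a :: v) (u.length + 1)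
      (t + 1))) ∘ fun x => u.length + 1 + x) = 0 := by
    refine List.countP_eq_zero.2 fun t _ => ?_
    simp only [Function.comp_apply, decide_eq_true_eq]
    exact hge _ (by omega)
  rw [hz, if_neg (by simpa using hge _ le_rfl)]
  simp only [add_zero]
  refine List.countP_congr fun t ht => ?_
  have ht : t < u.length := List.mem_range.1 ht
  have h₂ : seg (u ++ a :: v) (t + 1) (u.length + 1) = u.drop (t + 1) := by simp [seg]
  have h₃ : SymAt (u ++ a :: v) (t + 1) .minus ↔ (u.drop t).head? = some .minus := by
    rw [SymAt, Frag.readInput_succ_of_lt (by simp; omega), List.head?_drop,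
      List.getElem?_eq_getElem ht, List.getElem_append_left ht]
    simp
  simp only [decide_eq_true_eq]
  rw [Subtracted, h₂, h₃]
  simp [ht]

end Counting

end LimitDatalog

namespace LimitDatalog

open Space

/-! ### Coefficients of limit variables -/

/-- The value of a leaf when the variables have values `v`. -/
def Leaf.val (v : ℕ → ℤ) : Leaf → ℤ
  | .int k => k
  | .var x => v x

/-- The product of the values of a list of leaves. -/
def leafProd (v : ℕ → ℤ) (F : List Leaf) : ℤ := (F.map (Leaf.val v)).prod

theorem leafProd_append (v : ℕ → ℤ) (F G : List Leaf) :
    leafProd v (F ++ G) = leafProd v F * leafProd v G := by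
  simp [leafProd]

variable {V : ℕ → Prop} {τ : ℕ → NumTerm} {v : ℕ → ℤ}

theorem exists_simplify_of_ground {t : NumTerm} (h : ∀ x ∈ t.vars, τ x = .int (v x)) :
    ∃ k, (t.subst τ).simplify = some ⟨k, 0⟩ := by
  induction t with
  | int k => exact ⟨k, rfl⟩
  | var m => exact ⟨v m, by simp [NumTerm.subst, h m (by simp [NumTerm.vars]), NumTerm.simplify]⟩
  | add s t hs ht =>
    obtain ⟨k, hk⟩ := hs fun x hx => h x (by simp [NumTerm.vars, hx])
    obtain ⟨j, hj⟩ := ht fun x hx => h x (by simp [NumTerm.vars, hx])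
    exact ⟨k + j, by simp [NumTerm.subst, NumTerm.simplify, hk, hj]⟩
  | sub s t hs ht =>
    obtain ⟨k, hk⟩ := hs fun x hx => h x (by simp [NumTerm.vars, hx])
    obtain ⟨j, hj⟩ := ht fun x hx => h x (by simp [NumTerm.vars, hx])
    exact ⟨k - j, by simp [NumTerm.subst, NumTerm.simplify, hk, hj]⟩
  | mul s t hs ht =>
    obtain ⟨k, hk⟩ := hs fun x hx => h x (by simp [NumTerm.vars, hx])
    obtain ⟨j, hj⟩ := ht fun x hx => h x (by simp [NumTerm.vars, hx])
    exact ⟨k * j, by simp [NumTerm.subst, NumTerm.simplify, hk, hj]⟩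

theorem CoeffTerm.not_of_mem_vars {t : NumTerm} (ht : CoeffTerm V t) {x : ℕ} (hx : x ∈ t.vars) :
    ¬ V x := by
  induction ht with
  | int k => simp [NumTerm.vars] at hx
  | var h =>
    obtain rfl : x = _ := by simpa [NumTerm.vars] using hx
    exact h
  | mul _ _ h₁ h₂ => exact (List.mem_append.1 hx).elim h₁ h₂

theorem CoeffTerm.simplify_subst {t : NumTerm} (ht : CoeffTerm V t)
    (h : ∀ x ∈ t.vars, ¬ V x → τ x = .int (v x)) :
    (t.subst τ).simplify = some ⟨leafProd v t.leaves, 0⟩ := by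
  induction ht with
  | int k => simp [NumTerm.subst, NumTerm.simplify, NumTerm.leaves, leafProd, Leaf.val]
  | var hx =>
    simp [NumTerm.subst, NumTerm.simplify, NumTerm.leaves, leafProd, Leaf.val,
      h _ (by simp [NumTerm.vars]) hx]
  | mul _ _ h₁ h₂ =>
    have e₁ := h₁ fun x hx => h x (by simp [NumTerm.vars, hx])
    have e₂ := h₂ fun x hx => h x (by simp [NumTerm.vars, hx])
    simp [NumTerm.subst, NumTerm.simplify, NumTerm.leaves, leafProd_append, e₁, e₂]

theorem Summand.mem_vars {m : ℕ} {t : NumTerm} (ht : Summand V m t) : m ∈ t.vars ∧ V m := by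
  induction ht with
  | var hm => simp [NumTerm.vars, hm]
  | mulLeft _ _ ih => simp [NumTerm.vars, ih]
  | mulRight _ _ ih => simp [NumTerm.vars, ih]

theorem Summand.eq_of_mem_vars {m : ℕ} {t : NumTerm} (ht : Summand V m t) {x : ℕ} (hx : x ∈ t.vars)
    (hV : V x) : x = m := by
  induction ht with
  | var hm => simpa [NumTerm.vars] using hx
  | mulLeft hs _ ih => exact (List.mem_append.1 hx).elim (fun h => (hs.not_of_mem_vars h hV).elim) ih
  | mulRight _ hs ih =>
    exact (List.mem_append.1 hx).elim ih fun h => (hs.not_of_mem_vars h hV).elim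

/-- In a summand every leaf other than the limit variable is a factor of it. There is no
subtraction, so `n` is `0` here; the power of `-1` prepares for `LinearForm.simplify_subst`. -/
theorem Summand.simplify_subst {m : ℕ} {t : NumTerm} (ht : Summand V m t)
    (hV : ∀ x ∈ t.vars, V x → τ x = .var x) (h : ∀ x ∈ t.vars, ¬ V x → τ x = .int (v x)) :
    ∃ c, (t.subst τ).simplify = some ⟨0, Finsupp.single m c⟩ ∧
      ∀ x y n F G, LeafAt t x (.var m) y n F G → c = (-1) ^ n * leafProd v (F ++ G) := by
  induction ht with
  | var hm =>
    refine ⟨1, by simp [NumTerm.subst, NumTerm.simplify, hV _ (by simp [NumTerm.vars]) hm], ?_⟩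
    intro x y n F G hl
    cases hl
    simp [leafProd]
  | @mulLeft s t' hs ht ih =>
    obtain ⟨c, hc, hl⟩ := ih (fun x hx => hV x (by simp [NumTerm.vars, hx]))
      fun x hx => h x (by simp [NumTerm.vars, hx])
    have e := hs.simplify_subst (τ := τ) (v := v) fun x hx => h x (by simp [NumTerm.vars, hx])
    refine ⟨leafProd v s.leaves * c, by simp [NumTerm.subst, NumTerm.simplify, hc, e], ?_⟩
    intro x y n F G hl'
    cases hl' with
    | mulLeft h' => exact (hs.not_of_mem_vars h'.mem_vars ht.mem_vars.2).elim
    | mulRight h' =>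
      rw [hl _ _ _ _ _ h', List.append_assoc, leafProd_append v _ (_ ++ _)]
      ring
  | @mulRight s t' hs ht ih =>
    obtain ⟨c, hc, hl⟩ := ih (fun x hx => hV x (by simp [NumTerm.vars, hx]))
      fun x hx => h x (by simp [NumTerm.vars, hx])
    have e := ht.simplify_subst (τ := τ) (v := v) fun x hx => h x (by simp [NumTerm.vars, hx])
    refine ⟨c * leafProd v t'.leaves, ?_, ?_⟩
    rotate_left
    · intro x y n F G hl'
      cases hl' with
      | mulLeft h' =>
        rw [hl _ _ _ _ _ h', ← List.append_assoc, leafProd_append v (_ ++ _), mul_assoc]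
      | mulRight h' => exact (ht.not_of_mem_vars h'.mem_vars hs.mem_vars.2).elim
    -- `NumTerm.simplify` tests the left factor first, so a vanishing coefficient there leads to a
    -- different branch.
    · by_cases hc0 : c = 0
      · simp [NumTerm.subst, NumTerm.simplify, hc, e, hc0]
      · simp [NumTerm.subst, NumTerm.simplify, hc, e, hc0, mul_comm]

theorem LinearForm.mem_of_mem_vars {t : NumTerm} {ms : List ℕ} (ht : LinearForm V t ms) {x : ℕ}
    (hx : x ∈ t.vars) (hV : V x) : x ∈ ms := by
  induction ht with
  | free h => exact (h x hx hV).elim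
  | summand h => simp [h.eq_of_mem_vars hx hV]
  | add _ _ h₁ h₂ =>
    exact List.mem_append.2 ((List.mem_append.1 hx).imp h₁ h₂)
  | sub _ _ h₁ h₂ =>
    exact List.mem_append.2 ((List.mem_append.1 hx).imp h₁ h₂)

theorem LinearForm.vars_of_mem {t : NumTerm} {ms : List ℕ} (ht : LinearForm V t ms) {x : ℕ}
    (hx : x ∈ ms) : x ∈ t.vars ∧ V x := by
  induction ht with
  | free h => simp at hx
  | summand h =>
    obtain rfl : x = _ := by simpa using hx
    exact h.mem_vars
  | add _ _ h₁ h₂ =>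
    rcases List.mem_append.1 hx with h | h
    · simp [NumTerm.vars, h₁ h]
    · simp [NumTerm.vars, h₂ h]
  | sub _ _ h₁ h₂ =>
    rcases List.mem_append.1 hx with h | h
    · simp [NumTerm.vars, h₁ h]
    · simp [NumTerm.vars, h₂ h]

/-- Simplification of an instance of a limit-linear term: only limit variables of the term have
nonzero coefficients, and these are the products of the factors, with signs. -/
theorem LinearForm.simplify_subst {t : NumTerm} {ms : List ℕ} (ht : LinearForm V t ms)
    (hms : ms.Nodup) (hV : ∀ x ∈ t.vars, V x → τ x = .var x)
    (h : ∀ x ∈ t.vars, ¬ V x → τ x = .int (v x)) :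
    ∃ f, (t.subst τ).simplify = some f ∧ (∀ m ∉ ms, f.coeff m = 0) ∧
      ∀ m x y n F G, V m → LeafAt t x (.var m) y n F G →
        f.coeff m = (-1) ^ n * leafProd v (F ++ G) := by
  induction ht with
  | free hf =>
    obtain ⟨k, hk⟩ := exists_simplify_of_ground (τ := τ) (v := v) fun x hx => h x hx (hf x hx)
    exact ⟨_, hk, by simp, fun m x y n F G hm hl => (hf m hl.mem_vars hm).elim⟩
  | summand hs =>
    obtain ⟨c, hc, hl⟩ := hs.simplify_subst hV h
    refine ⟨_, hc, fun m hm => ?_, fun m x y n F G hm hl' => ?_⟩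
    · simp only [List.mem_singleton] at hm
      simp [Ne.symm hm]
    · obtain rfl := hs.eq_of_mem_vars hl'.mem_vars hm
      simpa using hl _ _ _ _ _ hl'
  | add hs ht h₁ h₂ =>
    -- Distinctness of the listed variables means that a limit variable occurs in one operand only,
    -- so the other contributes coefficient zero.
    obtain ⟨nd₁, nd₂, hdisj⟩ := List.nodup_append'.1 hms
    obtain ⟨f, hf, hf0, hfl⟩ := h₁ nd₁ (fun x hx => hV x (by simp [NumTerm.vars, hx]))
      fun x hx => h x (by simp [NumTerm.vars, hx])
    obtain ⟨g, hg, hg0, hgl⟩ := h₂ nd₂ (fun x hx => hV x (by simp [NumTerm.vars, hx]))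
      fun x hx => h x (by simp [NumTerm.vars, hx])
    refine ⟨⟨f.const + g.const, f.coeff + g.coeff⟩,
      by simp [NumTerm.subst, NumTerm.simplify, hf, hg], fun m hm => ?_,
      fun m x y n F G hm hl => ?_⟩
    · simp only [List.mem_append, not_or] at hm
      simp [hf0 m hm.1, hg0 m hm.2]
    · cases hl with
      | addLeft hl =>
        rw [Finsupp.add_apply, hfl _ _ _ _ _ _ hm hl,
          hg0 m (hdisj (hs.mem_of_mem_vars hl.mem_vars hm)), add_zero]
      | addRight hl =>
        rw [Finsupp.add_apply, hgl _ _ _ _ _ _ hm hl,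
          hf0 m fun hc => hdisj hc (ht.mem_of_mem_vars hl.mem_vars hm), zero_add]
  | sub hs ht h₁ h₂ =>
    obtain ⟨nd₁, nd₂, hdisj⟩ := List.nodup_append'.1 hms
    obtain ⟨f, hf, hf0, hfl⟩ := h₁ nd₁ (fun x hx => hV x (by simp [NumTerm.vars, hx]))
      fun x hx => h x (by simp [NumTerm.vars, hx])
    obtain ⟨g, hg, hg0, hgl⟩ := h₂ nd₂ (fun x hx => hV x (by simp [NumTerm.vars, hx]))
      fun x hx => h x (by simp [NumTerm.vars, hx])
    refine ⟨⟨f.const - g.const, f.coeff - g.coeff⟩,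
      by simp [NumTerm.subst, NumTerm.simplify, hf, hg], fun m hm => ?_,
      fun m x y n F G hm hl => ?_⟩
    · simp only [List.mem_append, not_or] at hm
      simp [hf0 m hm.1, hg0 m hm.2]
    · cases hl with
      | subLeft hl =>
        rw [Finsupp.sub_apply, hfl _ _ _ _ _ _ hm hl,
          hg0 m (hdisj (hs.mem_of_mem_vars hl.mem_vars hm)), sub_zero]
      | subRight hl =>
        rw [Finsupp.sub_apply, hgl _ _ _ _ _ _ hm hl,
          hf0 m fun hc => hdisj hc (ht.mem_of_mem_vars hl.mem_vars hm)]
        ring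

/-- The factors of a limit variable in a limit-linear term contain no limit variable. -/
theorem LinearForm.not_of_mem_factors {t : NumTerm} {ms : List ℕ} (ht : LinearForm V t ms)
    {m : ℕ} (hm : V m) {x y : List Sym} {n : ℕ} {F G : List Leaf}
    (hl : LeafAt t x (.var m) y n F G) {z : ℕ} (hz : .var z ∈ F ++ G) : z ∈ t.vars ∧ ¬ V z := by
  have hleaf : ∀ t : NumTerm, .var z ∈ t.leaves → z ∈ t.vars := by
    intro t
    induction t with
    | int k => simp [NumTerm.leaves]
    | var k => simp [NumTerm.leaves, NumTerm.vars]
    | add s t hs ht => simpa [NumTerm.leaves, NumTerm.vars] using Or.imp hs ht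
    | sub s t hs ht => simpa [NumTerm.leaves, NumTerm.vars] using Or.imp hs ht
    | mul s t hs ht => simpa [NumTerm.leaves, NumTerm.vars] using Or.imp hs ht
  have hsum : ∀ {t : NumTerm}, Summand V m t → ∀ {x y n F G}, LeafAt t x (.var m) y n F G →
      .var z ∈ F ++ G → z ∈ t.vars ∧ ¬ V z := by
    intro t ht
    induction ht with
    | var _ =>
      intro x y n F G hl hz
      cases hl
      simp at hz
    | mulLeft hs ht ih =>
      intro x y n F G hl hz
      cases hl with
      | mulLeft h' => exact (hs.not_of_mem_vars h'.mem_vars hm).elim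
      | mulRight h' =>
        rw [List.append_assoc, List.mem_append] at hz
        rcases hz with hz | hz
        · exact ⟨by simp [NumTerm.vars, hleaf _ hz], hs.not_of_mem_vars (hleaf _ hz)⟩
        · have := ih h' hz
          exact ⟨by simp [NumTerm.vars, this.1], this.2⟩
    | mulRight hs ht ih =>
      intro x y n F G hl hz
      cases hl with
      | mulRight h' => exact (ht.not_of_mem_vars h'.mem_vars hm).elim
      | mulLeft h' =>
        rw [← List.append_assoc, List.mem_append] at hz
        rcases hz with hz | hz
        · have := ih h' hz
          exact ⟨by simp [NumTerm.vars, this.1], this.2⟩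
        · exact ⟨by simp [NumTerm.vars, hleaf _ hz], ht.not_of_mem_vars (hleaf _ hz)⟩
  induction ht generalizing x y n F G with
  | free hf => exact (hf m hl.mem_vars hm).elim
  | summand hs =>
    obtain rfl := hs.eq_of_mem_vars hl.mem_vars hm
    exact hsum hs hl hz
  | add _ _ h₁ h₂ =>
    cases hl with
    | addLeft hl => have := h₁ hl hz; exact ⟨by simp [NumTerm.vars, this.1], this.2⟩
    | addRight hl => have := h₂ hl hz; exact ⟨by simp [NumTerm.vars, this.1], this.2⟩
  | sub _ _ h₁ h₂ =>
    cases hl with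
    | subLeft hl => have := h₁ hl hz; exact ⟨by simp [NumTerm.vars, this.1], this.2⟩
    | subRight hl => have := h₂ hl hz; exact ⟨by simp [NumTerm.vars, this.1], this.2⟩

/-! ### Attainable signs -/

section Signs

open scoped Classical

def Leaf.IsVar (l : Leaf) : Prop := ∃ x, l = .var x

def Leaf.IsNeg (l : Leaf) : Prop := ∃ k < 0, l = .int k

def Leaf.IsZero (l : Leaf) : Prop := l = .int 0

/-- Combinatorial characterization of the signs of a product of leaves `F`, negated `n` times, where
the variables have values in `Z`. -/
def SignAttained (Z : List ℤ) (n : ℕ) (F : List Leaf) (ε : Bool) : Prop :=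
  leafCount Leaf.IsZero F = 0 ∧
    ((leafCount Leaf.IsVar F = 0 ∧ (Odd (n + leafCount Leaf.IsNeg F) ↔ ε = true)) ∨
    ((∃ k ∈ Z, 0 < k) ∧ (Odd (n + leafCount Leaf.IsNeg F) ↔ ε = true)) ∨
    ((∃ k ∈ Z, k < 0) ∧
      (Odd (n + leafCount Leaf.IsNeg F + leafCount Leaf.IsVar F) ↔ ε = true)) ∨
    ((∃ k ∈ Z, 0 < k) ∧ (∃ k ∈ Z, k < 0) ∧
      ∃ x, Odd (leafCount (fun l => l = .var x) F)))

theorem leafCount_eq_zero {P : Leaf → Prop} {F : List Leaf} :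
    leafCount P F = 0 ↔ ∀ l ∈ F, ¬ P l := by
  simp [leafCount, List.countP_eq_zero]

theorem leafProd_sign (v : ℕ → ℤ) {F : List Leaf} (h : ∀ l ∈ F, l.val v ≠ 0) :
    leafProd v F ≠ 0 ∧ (leafProd v F < 0 ↔ Odd (leafCount (fun l => l.val v < 0) F)) := by
  induction F with
  | nil => simp [leafProd, leafCount]
  | cons l F ih =>
    obtain ⟨h₁, h₂⟩ := ih fun l hl => h l (by simp [hl])
    have h₀ := h l (by simp)
    have hp : leafProd v (l :: F) = l.val v * leafProd v F := by simp [leafProd]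
    have hc : leafCount (fun l => l.val v < 0) (l :: F) =
        leafCount (fun l => l.val v < 0) F + if l.val v < 0 then 1 else 0 := by
      simp [leafCount, List.countP_cons]
    refine ⟨by rw [hp]; exact mul_ne_zero h₀ h₁, ?_⟩
    rw [hp, hc]
    rcases lt_or_gt_of_ne h₀ with hl | hl
    · rw [if_pos hl, Nat.odd_add_one, ← h₂, not_lt, mul_neg_iff]
      constructor
      · rintro (⟨h, -⟩ | ⟨-, h⟩)
        · omega
        · exact h.le
      · exact fun h => .inr ⟨hl, lt_of_le_of_ne h h₁.symm⟩
    · rw [if_neg (by omega), add_zero, ← h₂, mul_neg_iff]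
      constructor
      · rintro (⟨-, h⟩ | ⟨h, -⟩)
        · exact h
        · omega
      · exact fun h => .inl ⟨hl, h⟩

/-- For nonzero factors the sign is a parity: each subtraction and each negative factor changes it
once. -/
theorem neg_one_pow_mul_sign (v : ℕ → ℤ) (n : ℕ) {F : List Leaf} (h : ∀ l ∈ F, l.val v ≠ 0)
    (ε : Bool) :
    (if ε then (-1) ^ n * leafProd v F < 0 else 0 < (-1) ^ n * leafProd v F) ↔
      (Odd (n + leafCount (fun l => l.val v < 0) F) ↔ ε = true) := by
  obtain ⟨h₁, h₂⟩ := leafProd_sign v h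
  rcases Nat.even_or_odd n with hn | hn
  · rw [hn.neg_one_pow, one_mul, Nat.odd_add', iff_true_right hn, ← h₂]
    cases ε
    · simp; omega
    · simp
  · rw [hn.neg_one_pow, Nat.odd_add, iff_true_left hn, ← Nat.not_odd_iff_even, ← h₂]
    cases ε
    · simp
    · simp; omega

theorem leafCount_val_neg (v : ℕ → ℤ) (F : List Leaf) :
    leafCount (fun l => l.val v < 0) F =
      leafCount Leaf.IsNeg F + leafCount (fun l => ∃ x, l = .var x ∧ v x < 0) F := by
  induction F with
  | nil => rfl
  | cons l F ih =>
    simp only [leafCount, List.countP_cons] at ih ⊢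
    rw [ih]
    cases l with
    | int k =>
      by_cases h : k < 0
      · simp [Leaf.val, Leaf.IsNeg, h]; omega
      · simp [Leaf.val, Leaf.IsNeg, h]
    | var x =>
      by_cases h : v x < 0
      · simp [Leaf.val, Leaf.IsNeg, h]; omega
      · simp [Leaf.val, Leaf.IsNeg, h]

/-- The count is grouped by distinct elements. It is applied to variables with negative values: if
each occurs an even number of times, their signs cancel. -/
theorem even_countP_of_even_count {α : Type} (l : List α) (p : α → Bool)
    (h : ∀ x, p x = true → Even (l.count x)) : Even (l.countP p) := by
  rw [List.countP_eq_length_filter]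
  have : (l.filter p).length = ∑ x ∈ (l.filter p).toFinset, (l.filter p).count x :=
    (List.sum_toFinset_count_eq_length _).symm
  rw [this]
  refine Finset.even_sum _ fun x hx => ?_
  have hp := (List.mem_filter.1 (List.mem_toFinset.1 hx)).2
  rw [List.count_filter hp]
  exact h x hp

/-- Constant assignments give the parities with all variables positive or all negative. With
integers of both signs, changing the sign of one variable that occurs an odd number of times changes
the sign of the product. Conversely, for an assignment with mixed signs, either some variable occurs
an odd number of times or the sign agrees with that of an all-positive assignment. -/
theorem signAttained_iff (Z : List ℤ) (n : ℕ) (F : List Leaf) (ε : Bool) :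
    SignAttained Z n F ε ↔ ∃ v : ℕ → ℤ, (∀ x, .var x ∈ F → v x ∈ Z) ∧
      if ε then (-1) ^ n * leafProd v F < 0 else 0 < (-1) ^ n * leafProd v F := by
  have hval : leafCount Leaf.IsZero F = 0 → ∀ v : ℕ → ℤ, (∀ x, .var x ∈ F → v x ≠ 0) →
      ∀ l ∈ F, l.val v ≠ 0 := by
    intro h v hv l hl
    cases l with
    | int k =>
      rintro rfl
      exact leafCount_eq_zero.1 h _ hl rfl
    | var x => exact hv x hl
  have hcongr : ∀ {P Q : Leaf → Prop}, (∀ l ∈ F, P l ↔ Q l) → leafCount P F = leafCount Q F :=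
    fun h => List.countP_congr fun l hl => by simpa using h l hl
  constructor
  · rintro ⟨h0, h⟩
    -- constant assignments
    have hpos : ∀ k ∈ Z, 0 < k → (Odd (n + leafCount Leaf.IsNeg F) ↔ ε = true) →
        ∃ v : ℕ → ℤ, (∀ x, .var x ∈ F → v x ∈ Z) ∧
        if ε then (-1) ^ n * leafProd v F < 0 else 0 < (-1) ^ n * leafProd v F := by
      intro k hk hk0 h
      refine ⟨fun _ => k, fun _ _ => hk, ?_⟩
      rw [neg_one_pow_mul_sign _ _ (hval h0 _ fun _ _ => hk0.ne'), leafCount_val_neg]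
      have : leafCount (fun l => ∃ x, l = .var x ∧ k < 0) F = 0 :=
        leafCount_eq_zero.2 fun l _ ⟨_, _, h⟩ => by omega
      rwa [this, add_zero]
    rcases h with ⟨hv, h⟩ | ⟨⟨k, hk, hk0⟩, h⟩ | ⟨⟨k, hk, hk0⟩, h⟩ | ⟨⟨k, hk, hk0⟩, ⟨j, hj, hj0⟩, x, hx⟩
    · have hv' := leafCount_eq_zero.1 hv
      -- There are no variable factors; `1` is an arbitrary positive value.
      refine ⟨fun _ => 1, fun x hx => (hv' _ hx ⟨x, rfl⟩).elim, ?_⟩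
      rw [neg_one_pow_mul_sign _ _ (hval h0 _ fun _ _ => one_ne_zero), leafCount_val_neg]
      have : leafCount (fun l => ∃ x, l = .var x ∧ (1 : ℤ) < 0) F = 0 :=
        leafCount_eq_zero.2 fun l _ ⟨_, _, h⟩ => by omega
      rwa [this, add_zero]
    · exact hpos k hk hk0 h
    · refine ⟨fun _ => k, fun _ _ => hk, ?_⟩
      rw [neg_one_pow_mul_sign _ _ (hval h0 _ fun _ _ => hk0.ne), leafCount_val_neg]
      have : leafCount (fun l => ∃ x, l = .var x ∧ k < 0) F = leafCount Leaf.IsVar F :=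
        hcongr fun l _ => by simp [Leaf.IsVar, hk0]
      rwa [this, ← add_assoc]
    · by_cases h : Odd (n + leafCount Leaf.IsNeg F) ↔ ε = true
      · exact hpos k hk hk0 h
      -- The all-positive assignment has the wrong sign, so the variable `x` of odd multiplicity is
      -- made negative.
      · refine ⟨fun y => if y = x then j else k, fun y _ => ?_, ?_⟩
        · simp only
          split_ifs
          · exact hj
          · exact hk
        · rw [neg_one_pow_mul_sign _ _ (hval h0 _ fun y _ => ?_), leafCount_val_neg]
          · have : leafCount (fun l => ∃ y, l = .var y ∧ (if y = x then j else k) < 0) F =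
                leafCount (fun l => l = .var x) F := by
              refine hcongr fun l _ => ⟨?_, ?_⟩
              · rintro ⟨y, rfl, hy⟩
                split_ifs at hy with h'
                · rw [h']
                · omega
              · rintro rfl
                exact ⟨x, rfl, by simpa using hj0⟩
            rw [this, ← add_assoc, Nat.odd_add, ← Nat.not_odd_iff_even]
            tauto
          · split_ifs <;> omega
  · rintro ⟨v, hv, hs⟩
    have hprod : leafProd v F ≠ 0 := by
      intro h
      rw [h] at hs
      cases ε <;> simp at hs
    have hne : ∀ l ∈ F, l.val v ≠ 0 := by
      intro l hl h
      exact hprod (List.prod_eq_zero (List.mem_map.2 ⟨l, hl, h⟩))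
    rw [neg_one_pow_mul_sign v n hne, leafCount_val_neg] at hs
    refine ⟨leafCount_eq_zero.2 fun l hl h => hne l hl (by rw [h]; rfl), ?_⟩
    by_cases hvar : leafCount Leaf.IsVar F = 0
    · left
      refine ⟨hvar, ?_⟩
      have hv0 := leafCount_eq_zero.1 hvar
      have : leafCount (fun l => ∃ x, l = .var x ∧ v x < 0) F = 0 :=
        leafCount_eq_zero.2 fun l hl ⟨x, h, _⟩ => hv0 l hl ⟨x, h⟩
      rwa [this, add_zero] at hs
    · right
      have hex : ∃ x, .var x ∈ F := by
        by_contra hc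
        push Not at hc
        exact hvar (leafCount_eq_zero.2 fun l hl ⟨x, h⟩ => hc x (h ▸ hl))
      by_cases hallpos : ∀ x, .var x ∈ F → 0 < v x
      · left
        obtain ⟨x, hx⟩ := hex
        refine ⟨⟨v x, hv x hx, hallpos x hx⟩, ?_⟩
        have : leafCount (fun l => ∃ x, l = .var x ∧ v x < 0) F = 0 :=
          leafCount_eq_zero.2 fun l hl ⟨x, h, h'⟩ => by
            have := hallpos x (h ▸ hl)
            omega
        rwa [this, add_zero] at hs
      · push Not at hallpos
        obtain ⟨x, hx, hx0⟩ := hallpos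
        have hx0 : v x < 0 := lt_of_le_of_ne hx0 (hne _ hx)
        by_cases hallneg : ∀ x, .var x ∈ F → v x < 0
        · right
          left
          refine ⟨⟨v x, hv x hx, hx0⟩, ?_⟩
          have : leafCount (fun l => ∃ x, l = .var x ∧ v x < 0) F = leafCount Leaf.IsVar F := by
            refine hcongr fun l hl => ⟨fun ⟨x, h, _⟩ => ⟨x, h⟩, fun ⟨x, h⟩ => ⟨x, h, ?_⟩⟩
            exact hallneg x (h ▸ hl)
          rwa [this, ← add_assoc] at hs
        · push Not at hallneg
          obtain ⟨y, hy, hy0⟩ := hallneg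
          have hy0 : 0 < v y := lt_of_le_of_ne hy0 (hne _ hy).symm
          by_cases hodd : ∃ x, Odd (leafCount (fun l => l = .var x) F)
          · exact .inr (.inr ⟨⟨_, hv y hy, hy0⟩, ⟨_, hv x hx, hx0⟩, hodd⟩)
          · left
            refine ⟨⟨_, hv y hy, hy0⟩, ?_⟩
            -- No variable has odd multiplicity, so the negative values contribute an even number of
            -- sign changes.
            have heven : Even (leafCount (fun l => ∃ x, l = .var x ∧ v x < 0) F) := by
              refine even_countP_of_even_count _ _ fun l hl => ?_
              obtain ⟨z, rfl, -⟩ := of_decide_eq_true hl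
              rw [← Nat.not_odd_iff_even]
              exact fun h => hodd ⟨z, by simpa [leafCount, List.count, beq_eq_decide] using h⟩
            rwa [← add_assoc, Nat.odd_add, iff_true_right heven] at hs

end Signs

end LimitDatalog

namespace LimitDatalog

open Space

/-! ### Names -/

/-- The binary digits at the beginning of a word. -/
def digitPrefix : List Sym → List Bool
  | .bit b :: z => b :: digitPrefix z
  | _ => []

theorem digit_readInput_one_eq_none (v : List Sym) :
    digit (readInput v 1) = none ↔ digitPrefix v = [] := by
  rcases v with _ | ⟨a, v⟩
  · simp [readInput, digit, digitPrefix]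
  · cases a <;> simp [readInput, digit, digitPrefix]

theorem eq_bit_of_digit {a : Sym} {b : Bool} (h : digit (.sym a) = some b) : a = .bit b := by
  cases a <;> simp_all [digit]

theorem readInput_cons (c : Sym) (z : List Sym) (s : ℕ) :
    readInput (c :: z) (s + 1 + 1) = readInput z (s + 1) := by
  simp [readInput]

theorem exists_of_digitPrefix {v : List Sym} {b : Bool} {l : List Bool}
    (h : digitPrefix v = b :: l) : ∃ z, v = .bit b :: z ∧ digitPrefix z = l := by
  rcases v with _ | ⟨a, v⟩
  · simp [digitPrefix] at h
  · cases a <;> simp_all [digitPrefix]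

/-- The comparison includes the first place of `v` without a digit, so a name is told apart from its
proper extensions. Since `N` exceeds the length of `v`, that place is within the range of the
quantifier. -/
theorem digitPrefix_eq_iff (v v' : List Sym) (N : ℕ) (hN : v.length < N) :
    (∀ t < N, (∀ s < N, s + 1 < t + 1 → digit (readInput v (s + 1)) ≠ none) →
      digit (readInput v (t + 1)) = digit (readInput v' (t + 1))) ↔
      digitPrefix v = digitPrefix v' := by
  induction h : digitPrefix v generalizing v v' N with
  | nil =>
    have hv := (digit_readInput_one_eq_none v).2 h
    rw [eq_comm (a := []), ← digit_readInput_one_eq_none v']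
    constructor
    · intro h
      rw [← h 0 (by omega) (by simp), hv]
    · intro h t ht hs
      rcases t with _ | t
      · rw [hv, h]
      · exact (hs 0 (by omega) (by omega) hv).elim
  | cons b l ih =>
    obtain ⟨z, rfl, hz⟩ := exists_of_digitPrefix h
    obtain ⟨N, rfl⟩ : ∃ M, N = M + 1 := ⟨N - 1, by omega⟩
    constructor
    · intro h
      have h0 := h 0 (by omega) (by simp)
      rcases v' with _ | ⟨a', v'⟩
      · simp [readInput, digit] at h0
      · obtain rfl : a' = .bit b := eq_bit_of_digit (by simpa [readInput, digit] using h0.symm)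
        simp only [digitPrefix, List.cons.injEq, true_and]
        rw [← ih z v' N (by simpa using hN) hz]
        intro t ht hs
        have := h (t + 1) (by omega) fun s hs₁ hs₂ => by
          rcases s with _ | s
          · simp [readInput, digit]
          · rw [readInput_cons]
            exact hs s (by omega) (by omega)
        rwa [readInput_cons, readInput_cons] at this
    · intro h t ht hs
      obtain ⟨z', rfl, hz'⟩ := exists_of_digitPrefix h.symm
      rcases t with _ | t
      · simp [readInput]
      · rw [readInput_cons, readInput_cons]
        refine (ih z z' N (by simpa using hN) hz).2 hz'.symm t (by omega) fun s hs₁ hs₂ => ?_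
        have := hs (s + 1) (by omega) (by omega)
        rwa [readInput_cons] at this

theorem readInput_append_cons {u v : List Sym} {a : Sym} (t : ℕ) :
    readInput (u ++ a :: v) (u.length + 1 + (t + 1)) = readInput v (t + 1) := by
  have : (u ++ a :: v)[u.length + 1 + t]? = v[t]? := by
    rw [List.getElem?_append_right (by omega), show u.length + 1 + t - u.length = t + 1 by omega]
    simp
  rw [← add_assoc, readInput, readInput, this]

theorem sameName_iff {w u v u' v' : List Sym} {a a' : Sym} (h : w = u ++ a :: v)
    (h' : w = u' ++ a' :: v') :
    SameName w (u.length + 1) (u'.length + 1) ↔ digitPrefix v = digitPrefix v' := by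
  rw [← digitPrefix_eq_iff v v' w.length (by rw [h]; simp; omega), SameName]
  have e : ∀ t, readInput w (u.length + 1 + (t + 1)) = readInput v (t + 1) := fun t => by
    rw [h, readInput_append_cons]
  have e' : ∀ t, readInput w (u'.length + 1 + (t + 1)) = readInput v' (t + 1) := fun t => by
    rw [h', readInput_append_cons]
  simp only [e, e']

theorem digitPrefix_encodeNat (m : ℕ) {a : Sym} {z : List Sym} (ha : IsLeafSym a = false) :
    digitPrefix (encodeNat m ++ a :: z) = m.bits := by
  rw [encodeNat]
  generalize m.bits = l
  induction l with
  | nil => cases a <;> first | rfl | simp [IsLeafSym] at ha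
  | cons b l ih => simp [digitPrefix, ih]

/-- Rebuilding the number from its digits is a left inverse. -/
theorem bits_injective : Function.Injective Nat.bits := by
  refine Function.LeftInverse.injective (g := List.foldr Nat.bit 0) fun m => ?_
  induction m using Nat.binaryRec' with
  | zero => simp
  | bit b m hm ih => rw [Nat.bits_append_bit _ _ hm, List.foldr_cons, ih]

theorem bits_eq_nil {m : ℕ} : m.bits = [] ↔ m = 0 := by
  rw [← Nat.zero_bits, bits_injective.eq_iff]

end LimitDatalog

namespace LimitDatalog

open Space

/-! ### Terms in rules -/

/-- Symbols of numeric terms. -/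
def IsTermSym (a : Sym) : Prop :=
  IsLeafSym a = true ∨ a = .lpar ∨ a = .rpar ∨ IsFun a

/-- Symbols of lists of object terms. -/
def IsObjSym (a : Sym) : Prop := (∃ b, a = .bit b) ∨ a = .obj ∨ a = .objVar

/-- Symbols that separate numeric terms. -/
def IsSep (a : Sym) : Prop :=
  IsLeafSym a = false ∧ (∀ s k, counterStep scanTrans (s, k) a = (.dead, k)) ∧ a ≠ .minus

/-- The symbol between the sides of a comparison. -/
def Comparison.sym : Comparison → Sym
  | .lt _ _ => .lt
  | .le _ _ => .le

theorem Comparison.encode_eq (c : Comparison) :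
    c.encode = .cmp :: (c.lhs.encode ++ c.sym :: c.rhs.encode) := by
  cases c <;> rfl

/-- `TermIn r U t V c b`: the encoding of `r` consists of `U`, the encoding of the numeric term `t`
and `V`, where the last predicate or comparison symbol before `t` is `c`, and `t` is in the body
if `b = true` and in the head if `b = false`. -/
inductive TermIn : Rule → List Sym → NumTerm → List Sym → Sym → Bool → Prop
  | body (A₁ κ name args s A₂ C h) : TermIn ⟨A₁ ++ .numeric κ name args s :: A₂, C, h⟩
      (A₁.flatMap Atom.encode ++ κ.encode :: (encodeNat name ++ args.flatMap ObjTerm.encode)) s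
      (A₂.flatMap Atom.encode ++ C.flatMap Comparison.encode ++
        .arrow :: (h.encode ++ [.ruleEnd])) κ.encode true
  | left (A C₁ c C₂ h) : TermIn ⟨A, C₁ ++ c :: C₂, h⟩
      ((A.flatMap Atom.encode ++ C₁.flatMap Comparison.encode) ++ [.cmp]) c.lhs
      (c.sym :: (c.rhs.encode ++ C₂.flatMap Comparison.encode) ++
        .arrow :: (h.encode ++ [.ruleEnd])) .cmp true
  | right (A C₁ c C₂ h) : TermIn ⟨A, C₁ ++ c :: C₂, h⟩
      ((A.flatMap Atom.encode ++ C₁.flatMap Comparison.encode ++ .cmp :: c.lhs.encode) ++ [c.sym])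
      c.rhs (C₂.flatMap Comparison.encode ++ .arrow :: (h.encode ++ [.ruleEnd])) c.sym true
  | head (A C κ name args s) : TermIn ⟨A, C, .numeric κ name args s⟩
      ((A.flatMap Atom.encode ++ C.flatMap Comparison.encode ++ [.arrow]) ++
        κ.encode :: (encodeNat name ++ args.flatMap ObjTerm.encode)) s [.ruleEnd] κ.encode false

variable {r : Rule} {U V : List Sym} {t : NumTerm} {c : Sym} {b : Bool}

theorem TermIn.encode_eq (h : TermIn r U t V c b) : r.encode = U ++ (t.encode ++ V) := by
  cases h <;> simp [Rule.encode, Atom.encode, Comparison.encode_eq]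

theorem isObjSym_of_mem_encode {o : ObjTerm} {a : Sym} (h : a ∈ o.encode) : IsObjSym a := by
  cases o <;> rcases List.mem_cons.1 h with rfl | h
  · exact .inr (.inl rfl)
  · exact .inl (mem_encodeNat h)
  · exact .inr (.inr rfl)
  · exact .inl (mem_encodeNat h)

theorem isObjSym_of_mem_args {name : ℕ} {args : List ObjTerm} {a : Sym}
    (h : a ∈ encodeNat name ++ args.flatMap ObjTerm.encode) : IsObjSym a := by
  rcases List.mem_append.1 h with h | h
  · exact .inl (mem_encodeNat h)
  · obtain ⟨o, -, h⟩ := List.mem_flatMap.1 h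
    exact isObjSym_of_mem_encode h

theorem isTermSym_of_mem_encode {a : Sym} (h : a ∈ t.encode) : IsTermSym a := by
  have hbin : ∀ (s t : List Sym) (f : Sym), IsFun f → (a ∈ s → IsTermSym a) →
      (a ∈ t → IsTermSym a) → a ∈ .lpar :: (s ++ f :: (t ++ [.rpar])) → IsTermSym a := by
    intro s t f hf hs ht h
    simp only [List.mem_cons, List.mem_append, List.not_mem_nil, or_false] at h
    rcases h with rfl | h | rfl | h | rfl
    · exact .inr (.inl rfl)
    · exact hs h
    · exact .inr (.inr (.inr hf))
    · exact ht h
    · exact .inr (.inr (.inl rfl))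
  induction t with
  | int k =>
    rcases List.mem_cons.1 h with rfl | h
    · exact .inl rfl
    · exact .inl (Leaf.isLeafSym_of_mem (l := .int k) h)
  | var m =>
    rcases List.mem_cons.1 h with rfl | h
    · exact .inl rfl
    · exact .inl (Leaf.isLeafSym_of_mem (l := .var m) h)
  | add s t hs ht => exact hbin _ _ _ (.inl rfl) hs ht h
  | sub s t hs ht => exact hbin _ _ _ (.inr (.inl rfl)) hs ht h
  | mul s t hs ht => exact hbin _ _ _ (.inr (.inr rfl)) hs ht h

/-- Symbols inside the body or the head of a rule. -/
def IsInner (a : Sym) : Prop := a ≠ .arrow ∧ a ≠ .ruleEnd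

theorem IsTermSym.cases {a : Sym} (h : IsTermSym a) (p : Sym → Prop)
    (h₁ : ∀ b, p (.bit b)) (h₂ : p .neg) (h₃ : p .int) (h₄ : p .numVar) (h₅ : p .lpar)
    (h₆ : p .rpar) (h₇ : p .plus) (h₈ : p .minus) (h₉ : p .times) : p a := by
  rcases h with h | rfl | rfl | rfl | rfl | rfl <;> try assumption
  cases a <;> first | assumption | exact h₁ _ | simp [IsLeafSym] at h

theorem IsTermSym.isInner {a : Sym} (h : IsTermSym a) : IsInner a := by
  apply h.cases <;> simp [IsInner]

theorem IsObjSym.isInner {a : Sym} (h : IsObjSym a) : IsInner a := by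
  rcases h with ⟨b, rfl⟩ | rfl | rfl <;> simp [IsInner]

theorem IsTermSym.markerStep_eq {a : Sym} (h : IsTermSym a) (s : Option Sym) :
    markerStep s a = s := by
  apply h.cases <;> intros <;> rfl

theorem IsObjSym.markerStep_eq {a : Sym} (h : IsObjSym a) (s : Option Sym) :
    markerStep s a = s := by
  rcases h with ⟨b, rfl⟩ | rfl | rfl <;> rfl

theorem IsInner.endStep_eq {a : Sym} (h : IsInner a) : endStep none a = none := by
  cases a <;> first | rfl | exact absurd rfl h.1 | exact absurd rfl h.2

theorem isInner_of_mem_atom {α : Atom} {a : Sym} (h : a ∈ α.encode) : IsInner a := by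
  cases α with
  | object name args =>
    rcases List.mem_cons.1 h with rfl | h
    · simp [IsInner]
    · exact (isObjSym_of_mem_args h).isInner
  | numeric κ name args s =>
    rcases List.mem_cons.1 h with rfl | h
    · cases κ <;> simp [IsInner, NumKind.encode]
    · rcases List.mem_append.1 h with h | h
      · exact (isObjSym_of_mem_args h).isInner
      · exact (isTermSym_of_mem_encode h).isInner

theorem Comparison.isInner_sym (c : Comparison) : IsInner c.sym := by
  cases c <;> simp [IsInner, Comparison.sym]

theorem isInner_of_mem_comparison {c : Comparison} {a : Sym} (h : a ∈ c.encode) : IsInner a := by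
  rw [Comparison.encode_eq, List.mem_cons, List.mem_append, List.mem_cons] at h
  rcases h with rfl | h | rfl | h
  · simp [IsInner]
  · exact (isTermSym_of_mem_encode h).isInner
  · exact c.isInner_sym
  · exact (isTermSym_of_mem_encode h).isInner

theorem isInner_of_mem_atoms {A : List Atom} {a : Sym} (h : a ∈ A.flatMap Atom.encode) :
    IsInner a := by
  obtain ⟨α, -, h⟩ := List.mem_flatMap.1 h
  exact isInner_of_mem_atom h

theorem isInner_of_mem_comparisons {C : List Comparison} {a : Sym}
    (h : a ∈ C.flatMap Comparison.encode) : IsInner a := by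
  obtain ⟨α, -, h⟩ := List.mem_flatMap.1 h
  exact isInner_of_mem_comparison h

theorem NumKind.isSep (κ : NumKind) : IsSep κ.encode := by
  cases κ <;> refine ⟨rfl, fun s k => ?_, by simp [NumKind.encode]⟩ <;> cases s <;> rfl

theorem isSep_cmp : IsSep .cmp := ⟨rfl, fun s k => by cases s <;> rfl, by simp⟩

theorem isSep_arrow : IsSep .arrow := ⟨rfl, fun s k => by cases s <;> rfl, by simp⟩

theorem isSep_ruleEnd : IsSep .ruleEnd := ⟨rfl, fun s k => by cases s <;> rfl, by simp⟩

theorem isSep_objectPred : IsSep .objectPred := ⟨rfl, fun s k => by cases s <;> rfl, by simp⟩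

theorem Comparison.isSep_sym (c : Comparison) : IsSep c.sym := by
  cases c <;> refine ⟨rfl, fun s k => ?_, by simp [Comparison.sym]⟩ <;> cases s <;> rfl

theorem NumKind.markerStep_eq (κ : NumKind) (s : Option Sym) :
    markerStep s κ.encode = some κ.encode := by
  cases κ <;> rfl

theorem Comparison.markerStep_eq (c : Comparison) (s : Option Sym) :
    markerStep s c.sym = some c.sym := by
  cases c <;> rfl

/-- What precedes a term. -/
theorem TermIn.before (h : TermIn r U t V c b) : ∃ U₁ D, U = U₁ ++ c :: D ∧ IsSep c ∧
    (∀ s, markerStep s c = some c) ∧ ∀ a ∈ D, IsObjSym a := by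
  cases h with
  | body A₁ κ name args _ A₂ C h =>
    exact ⟨_, _, rfl, κ.isSep, κ.markerStep_eq, fun a ha => isObjSym_of_mem_args ha⟩
  | left A C₁ c C₂ h => exact ⟨_, [], rfl, isSep_cmp, fun _ => rfl, by simp⟩
  | right A C₁ c C₂ h => exact ⟨_, [], rfl, c.isSep_sym, c.markerStep_eq, by simp⟩
  | head A C κ name args s =>
    exact ⟨_, _, rfl, κ.isSep, κ.markerStep_eq, fun a ha => isObjSym_of_mem_args ha⟩

theorem foldl_endStep_inner {X : List Sym} (hX : ∀ a ∈ X, IsInner a) (Y : List Sym) :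
    (X ++ Y).foldl endStep none = Y.foldl endStep none := by
  induction X with
  | nil => rfl
  | cons a X ih =>
    rw [List.cons_append, List.foldl_cons, (hX a (by simp)).endStep_eq,
      ih fun a ha => hX a (by simp [ha])]

theorem foldl_endStep_some (d : Bool) (Y : List Sym) : Y.foldl endStep (some d) = some d := by
  induction Y with
  | nil => rfl
  | cons a Y ih => exact ih

theorem exists_isSep_atoms (A : List Atom) {W : List Sym} (hW : ∃ a z, W = a :: z ∧ IsSep a) :
    ∃ a z, A.flatMap Atom.encode ++ W = a :: z ∧ IsSep a := by
  rcases A with _ | ⟨α, A⟩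
  · exact hW
  · cases α with
    | object name args => exact ⟨_, _, rfl, isSep_objectPred⟩
    | numeric κ name args s => exact ⟨_, _, rfl, κ.isSep⟩

theorem exists_isSep_comparisons (C : List Comparison) {W : List Sym}
    (hW : ∃ a z, W = a :: z ∧ IsSep a) :
    ∃ a z, C.flatMap Comparison.encode ++ W = a :: z ∧ IsSep a := by
  rcases C with _ | ⟨c, C⟩
  · exact hW
  · rw [List.flatMap_cons, Comparison.encode_eq]
    exact ⟨_, _, rfl, isSep_cmp⟩

/-- What follows a term. -/
theorem TermIn.after (h : TermIn r U t V c b) :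
    (∃ a z, V = a :: z ∧ IsSep a) ∧ V.foldl endStep none = some b := by
  cases h with
  | body A₁ κ name args _ A₂ C h =>
    refine ⟨?_, ?_⟩
    · rw [List.append_assoc]
      exact exists_isSep_atoms _ (exists_isSep_comparisons _ ⟨_, _, rfl, isSep_arrow⟩)
    · rw [foldl_endStep_inner, List.foldl_cons]
      · exact foldl_endStep_some _ _
      · intro a ha
        rcases List.mem_append.1 ha with ha | ha
        · exact isInner_of_mem_atoms ha
        · exact isInner_of_mem_comparisons ha
  | left A C₁ c C₂ h =>
    refine ⟨⟨_, _, rfl, c.isSep_sym⟩, ?_⟩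
    rw [foldl_endStep_inner, List.foldl_cons]
    · exact foldl_endStep_some _ _
    · intro a ha
      rw [List.mem_cons, List.mem_append] at ha
      rcases ha with rfl | ha | ha
      · exact c.isInner_sym
      · exact (isTermSym_of_mem_encode ha).isInner
      · exact isInner_of_mem_comparisons ha
  | right A C₁ c C₂ h =>
    refine ⟨exists_isSep_comparisons _ ⟨_, _, rfl, isSep_arrow⟩, ?_⟩
    rw [foldl_endStep_inner fun a ha => isInner_of_mem_comparisons ha, List.foldl_cons]
    exact foldl_endStep_some _ _
  | head A C κ name args s => exact ⟨⟨_, _, rfl, isSep_ruleEnd⟩, rfl⟩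

theorem TermIn.mem_terms (h : TermIn r U t V c b) : t ∈ r.terms := by
  cases h <;> simp [Rule.terms, Rule.atoms, Atom.terms]

theorem exists_termIn_of_mem_sbody {κ : NumKind} {name : ℕ} {args : List ObjTerm}
    (h : Atom.numeric κ name args t ∈ r.sbody) : ∃ U V, TermIn r U t V κ.encode true := by
  obtain ⟨A, C, hd⟩ := r
  obtain ⟨A₁, A₂, rfl⟩ := List.append_of_mem h
  exact ⟨_, _, .body ..⟩

theorem exists_termIn_of_head {κ : NumKind} {name : ℕ} {args : List ObjTerm}
    (h : r.head = Atom.numeric κ name args t) : ∃ U V, TermIn r U t V κ.encode false := by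
  obtain ⟨A, C, hd⟩ := r
  obtain rfl : hd = _ := h
  exact ⟨_, _, .head ..⟩

theorem exists_termIn_of_mem_cbody {d : Comparison} (h : d ∈ r.cbody) :
    (∃ U V, TermIn r U d.lhs V .cmp true) ∧ ∃ U V, TermIn r U d.rhs V d.sym true := by
  obtain ⟨A, C, hd⟩ := r
  obtain ⟨C₁, C₂, rfl⟩ := List.append_of_mem h
  exact ⟨⟨_, _, .left ..⟩, ⟨_, _, .right ..⟩⟩

theorem exists_termIn_of_mem_terms (h : t ∈ r.terms) : ∃ U V c b, TermIn r U t V c b := by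
  rcases List.mem_append.1 h with h | h
  · obtain ⟨α, hα, h⟩ := List.mem_flatMap.1 h
    cases α with
    | object name args => simp [Atom.terms] at h
    | numeric κ name args s =>
      obtain rfl : t = s := by simpa [Atom.terms] using h
      rcases List.mem_cons.1 hα with hα | hα
      · obtain ⟨U, V, h⟩ := exists_termIn_of_head hα.symm
        exact ⟨_, _, _, _, h⟩
      · obtain ⟨U, V, h⟩ := exists_termIn_of_mem_sbody hα
        exact ⟨_, _, _, _, h⟩
  · obtain ⟨d, hd, h⟩ := List.mem_flatMap.1 h
    obtain ⟨⟨U, V, h₁⟩, ⟨U', V', h₂⟩⟩ := exists_termIn_of_mem_cbody hd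
    simp only [List.mem_cons, List.not_mem_nil, or_false] at h
    rcases h with rfl | rfl
    · exact ⟨_, _, _, _, h₁⟩
    · exact ⟨_, _, _, _, h₂⟩

theorem TermIn.exists_mem_sbody {κ : NumKind} (h : TermIn r U t V κ.encode true) :
    ∃ name args, Atom.numeric κ name args t ∈ r.sbody := by
  generalize hc : κ.encode = c at h
  generalize hb : true = b at h
  cases h with
  | body A₁ κ' name args _ A₂ C h =>
    obtain rfl : κ = κ' := by cases κ <;> cases κ' <;> simp_all [NumKind.encode]
    exact ⟨name, args, by simp⟩
  | left A C₁ c C₂ h => cases κ <;> simp [NumKind.encode] at hc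
  | right A C₁ c C₂ h => cases κ <;> cases c <;> simp [NumKind.encode, Comparison.sym] at hc
  | head => simp at hb

theorem TermIn.head_eq {κ : NumKind} (h : TermIn r U t V κ.encode false) :
    ∃ name args, r.head = Atom.numeric κ name args t := by
  generalize hc : κ.encode = c at h
  generalize hb : false = b at h
  cases h with
  | head A C κ' name args s =>
    obtain rfl : κ = κ' := by cases κ <;> cases κ' <;> simp_all [NumKind.encode]
    exact ⟨name, args, rfl⟩
  | _ => simp at hb

theorem TermIn.exists_lhs (h : TermIn r U t V .cmp b) : ∃ d ∈ r.cbody, t = d.lhs := by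
  generalize hc : Sym.cmp = c at h
  cases h with
  | body A₁ κ name args _ A₂ C h => cases κ <;> simp [NumKind.encode] at hc
  | left A C₁ c C₂ h => exact ⟨c, by simp, rfl⟩
  | right A C₁ c C₂ h => cases c <;> simp [Comparison.sym] at hc
  | head A C κ name args s => cases κ <;> simp [NumKind.encode] at hc

theorem TermIn.exists_rhs (h : TermIn r U t V c b) (hc : c = .lt ∨ c = .le) :
    ∃ d ∈ r.cbody, t = d.rhs := by
  cases h with
  | body A₁ κ name args _ A₂ C h => cases κ <;> simp [NumKind.encode] at hc
  | left A C₁ c C₂ h => simp at hc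
  | right A C₁ c C₂ h => exact ⟨c, by simp, rfl⟩
  | head A C κ name args s => cases κ <;> simp [NumKind.encode] at hc

/-- A symbol that only occurs in the encodings of numeric terms is in one of the terms. -/
theorem exists_termIn_of_mark {a : Sym} (ha : IsLeafMark a) {u v : List Sym}
    (h : r.encode = u ++ a :: v) : ∃ U t V c b x y, TermIn r U t V c b ∧
      t.encode = x ++ a :: y ∧ u = U ++ x ∧ v = y ++ V := by
  have hobj : ¬ IsObjSym a := by
    rcases ha with rfl | rfl <;> simp [IsObjSym]
  have hsep : ∀ c, IsSep c → c ≠ a := by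
    rintro c hc rfl
    rcases ha with rfl | rfl <;> simp [IsSep, IsLeafSym] at hc
  have hatom : ∀ (α : Atom) (u v : List Sym), α.encode = u ++ a :: v → ∃ κ name args s x,
      α = .numeric κ name args s ∧ s.encode = x ++ a :: v ∧
        u = κ.encode :: (encodeNat name ++ args.flatMap ObjTerm.encode) ++ x := by
    intro α u v h
    cases α with
    | object name args =>
      obtain ⟨u', h₁, rfl⟩ := cons_eq_append_cons h (hsep _ isSep_objectPred)
      exact (hobj (isObjSym_of_mem_args (a := a) (name := name) (args := args)
        (by rw [h₁]; simp))).elim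
    | numeric κ name args s =>
      obtain ⟨u', h₁, rfl⟩ := cons_eq_append_cons h (hsep _ κ.isSep)
      rcases append_eq_append_cons h₁ with ⟨v', h₂, -⟩ | ⟨x, h₂, rfl⟩
      · exact (hobj (isObjSym_of_mem_args (a := a) (name := name) (args := args)
          (by rw [h₂]; simp))).elim
      · exact ⟨κ, name, args, s, x, rfl, h₂, by simp⟩
  obtain ⟨A, C, hd⟩ := r
  rcases append_eq_append_cons h with ⟨v', h₁, rfl⟩ | ⟨u', h₁, rfl⟩
  · rcases append_eq_append_cons h₁ with ⟨v', h₂, rfl⟩ | ⟨u', h₂, rfl⟩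
    · obtain ⟨A₁, α, A₂, u', v', hA, hα, rfl, rfl⟩ := flatMap_eq_append_cons h₂
      obtain ⟨κ, name, args, s, x, rfl, hs, rfl⟩ := hatom _ _ _ hα
      obtain rfl : A = _ := hA
      exact ⟨_, _, _, _, _, x, v', .body .., hs, by simp, by simp⟩
    · obtain ⟨C₁, d, C₂, u', v', hC, hd, rfl, rfl⟩ := flatMap_eq_append_cons h₂
      obtain rfl : C = _ := hC
      rw [Comparison.encode_eq] at hd
      obtain ⟨u', h₃, rfl⟩ := cons_eq_append_cons hd (hsep _ isSep_cmp)
      rcases append_eq_append_cons h₃ with ⟨v', h₄, rfl⟩ | ⟨x, h₄, rfl⟩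
      · exact ⟨_, _, _, _, _, u', v', .left .., h₄, by simp, by simp⟩
      · obtain ⟨x, h₅, rfl⟩ := cons_eq_append_cons h₄ (hsep _ d.isSep_sym)
        exact ⟨_, _, _, _, _, x, v', .right .., h₅, by simp, by simp⟩
  · obtain ⟨u', h₂, rfl⟩ := cons_eq_append_cons h₁ (hsep _ isSep_arrow)
    rcases append_eq_append_cons h₂ with ⟨v', h₃, rfl⟩ | ⟨x, h₃, rfl⟩
    · obtain ⟨κ, name, args, s, x, hh, hs, rfl⟩ := hatom _ _ _ h₃
      obtain rfl : hd = _ := hh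
      exact ⟨_, _, _, _, _, x, v', .head .., hs, by simp, rfl⟩
    · obtain ⟨_, h₄, -⟩ := cons_eq_append_cons h₃ (hsep _ isSep_ruleEnd)
      simp at h₄

end LimitDatalog

namespace LimitDatalog

open Space

/-! ### Places in the encoding of a program -/

theorem Program.encode_append (P Q : Program) :
    Program.encode (P ++ Q) = Program.encode P ++ Program.encode Q := List.flatMap_append

theorem Program.encode_cons (r : Rule) (Q : Program) :
    Program.encode (r :: Q) = r.encode ++ Program.encode Q := rfl

theorem Rule.exists_encode_eq (r : Rule) :
    ∃ B, r.encode = B ++ [.ruleEnd] ∧ .ruleEnd ∉ B := by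
  refine ⟨r.sbody.flatMap Atom.encode ++ r.cbody.flatMap Comparison.encode ++
    .arrow :: r.head.encode, by simp [Rule.encode], fun h => ?_⟩
  rw [List.mem_append, List.mem_append, List.mem_cons] at h
  rcases h with (h | h) | h | h
  · exact (isInner_of_mem_atoms h).2 rfl
  · exact (isInner_of_mem_comparisons h).2 rfl
  · simp at h
  · exact (isInner_of_mem_atom h).2 rfl

/-- The symbol `ruleEnd` is the last one of a rule and occurs nowhere else in it, so it delimits
rules in the encoding of a program. -/
theorem Rule.ruleEnd_of_encode_eq {r : Rule} {u v : List Sym} {a : Sym}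
    (h : r.encode = u ++ a :: v) (ha : a ≠ .ruleEnd) : .ruleEnd ∉ u ∧ .ruleEnd ∈ v := by
  obtain ⟨B, hB, hB'⟩ := r.exists_encode_eq
  rw [hB] at h
  rcases append_eq_append_cons h with ⟨v', rfl, rfl⟩ | ⟨u', h', rfl⟩
  · exact ⟨fun h => hB' (by simp [h]), by simp⟩
  · obtain ⟨_, h', -⟩ := cons_eq_append_cons h' ha.symm
    simp at h'

theorem seg_of_le {w : List Sym} {p q : ℕ} (h : q ≤ p + 1) : seg w p q = [] := by
  simp [seg]
  omega

theorem seg_append_cons {u z v : List Sym} {a : Sym} {q : ℕ} (hq : q = (u ++ a :: z).length + 1) :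
    seg (u ++ a :: z ++ v) (u.length + 1) q = z := by
  have : u ++ a :: z = (u ++ [a]) ++ z := by simp
  have hlen : u.length + 1 = (u ++ [a]).length := by simp
  rw [seg, hq, Nat.add_sub_cancel, List.take_left, this, hlen, List.drop_left]

/-- Two positions in the encoding of a program are in the same rule. -/
theorem sameRule_iff {P P₁ P₂ P₁' P₂' : Program} {r r' : Rule} {u v u' v' : List Sym} {a a' : Sym}
    (hP : P = P₁ ++ r :: P₂) (hP' : P = P₁' ++ r' :: P₂') (h : r.encode = u ++ a :: v)
    (h' : r'.encode = u' ++ a' :: v') (ha : a ≠ .ruleEnd) (ha' : a' ≠ .ruleEnd) :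
    SameRule P.encode ((Program.encode P₁ ++ u).length + 1)
      ((Program.encode P₁' ++ u').length + 1) ↔ P₁ = P₁' := by
  -- Within one rule, the segment lies before the final `ruleEnd`.
  have same : ∀ {r : Rule} {P₂ : Program} {u v u' v' : List Sym} {a a' : Sym},
      r.encode = u ++ a :: v → r.encode = u' ++ a' :: v' → a' ≠ .ruleEnd →
      .ruleEnd ∉ seg (Program.encode (P₁ ++ r :: P₂)) ((Program.encode P₁ ++ u).length + 1)
        ((Program.encode P₁ ++ u').length + 1) := by
    intro r P₂ u v u' v' a a' h h' ha'
    by_cases hle : u'.length ≤ u.length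
    · rw [seg_of_le (by simp; omega)]
      simp
    · have hu : u ++ a :: v = u' ++ (a' :: v') := by rw [← h, h']
      obtain ⟨z, rfl⟩ : ∃ z, u' = u ++ a :: z := by
        rcases append_eq_append_cons hu.symm with ⟨z, rfl, -⟩ | ⟨z, -, rfl⟩
        · exact ⟨z, rfl⟩
        · simp at hle
      have e : Program.encode (P₁ ++ r :: P₂) =
          ((Program.encode P₁ ++ u) ++ a :: z) ++ (a' :: v' ++ Program.encode P₂) := by
        rw [Program.encode_append, Program.encode_cons, h']
        simp
      rw [e, seg_append_cons (by simp)]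
      intro hz
      exact (Rule.ruleEnd_of_encode_eq h' ha').1 (by simp [hz])
  -- For different rules, the segment contains the `ruleEnd` of the earlier one.
  have diff : ∀ {P₁ Q P₂ : Program} {r r' : Rule} {u v u' v' : List Sym} {a a' : Sym},
      r.encode = u ++ a :: v → r'.encode = u' ++ a' :: v' → a ≠ .ruleEnd →
      .ruleEnd ∈ seg (Program.encode (P₁ ++ r :: (Q ++ r' :: P₂)))
        ((Program.encode P₁ ++ u).length + 1)
        ((Program.encode (P₁ ++ r :: Q) ++ u').length + 1) := by
    intro P₁ Q P₂ r r' u v u' v' a a' h h' ha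
    have e : Program.encode (P₁ ++ r :: (Q ++ r' :: P₂)) =
        ((Program.encode P₁ ++ u) ++ a :: (v ++ (Program.encode Q ++ u'))) ++
          (a' :: v' ++ Program.encode P₂) := by
      rw [Program.encode_append, Program.encode_cons, Program.encode_append, Program.encode_cons,
        h, h']
      simp
    rw [e, seg_append_cons]
    · simp [(Rule.ruleEnd_of_encode_eq h ha).2]
    · rw [Program.encode_append, Program.encode_cons, h]
      simp
  subst hP
  -- Occurrences of rules are compared by the part `P₁` of the program before them, since the same
  -- rule may be listed twice.
  rcases append_eq_append_cons hP' with ⟨Q, rfl, rfl⟩ | ⟨Q, hQ, rfl⟩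
  · refine iff_of_false (fun hs => ?_) (by simp)
    refine hs.2 ?_
    have := diff (P₁ := P₁') (Q := Q) (P₂ := P₂) h' h ha'
    simpa using this
  · rcases Q with _ | ⟨r₁, Q⟩
    · simp only [List.nil_append, List.cons.injEq] at hQ
      obtain ⟨rfl, rfl⟩ := hQ
      refine iff_of_true ?_ (by simp)
      rw [List.append_nil]
      exact ⟨same h h' ha', same h' h ha⟩
    · simp only [List.cons_append, List.cons.injEq] at hQ
      obtain ⟨rfl, rfl⟩ := hQ
      exact iff_of_false (fun hs => hs.1 (diff h h' ha)) (by simp)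

/-! ### Dictionary between positions of leaf marks and leaves of terms -/

/-- A leaf of a numeric term of a rule of `P`. -/
structure LeafPlace (P : Program) where
  (P₁ P₂ : Program) (r : Rule) (U V : List Sym) (t : NumTerm) (c : Sym) (b : Bool)
  (x y : List Sym) (l : Leaf) (n : ℕ) (F G : List Leaf)
  eq : P = P₁ ++ r :: P₂
  term : TermIn r U t V c b
  leaf : LeafAt t x l y n F G

namespace LeafPlace

variable {P : Program} (L : LeafPlace P)

def before : List Sym := Program.encode L.P₁ ++ (L.U ++ L.x)

def after : List Sym := L.l.digits ++ (L.y ++ (L.V ++ Program.encode L.P₂))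

def pos : ℕ := L.before.length + 1

theorem mem : L.r ∈ P := (congrArg (L.r ∈ ·) L.eq).mpr (by simp)

theorem rule_encode_eq : L.r.encode = (L.U ++ L.x) ++ L.l.mark :: (L.l.digits ++ (L.y ++ L.V)) := by
  rw [L.term.encode_eq, L.leaf.encode_eq, Leaf.encode_eq]
  simp

theorem encode_eq : P.encode = L.before ++ L.l.mark :: L.after := by
  conv_lhs => rw [L.eq]
  rw [Program.encode_append, Program.encode_cons, L.rule_encode_eq]
  simp [before, after]

theorem symAt (a : Sym) : SymAt P.encode L.pos a ↔ L.l.mark = a := by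
  rw [L.encode_eq, pos, symAt_append_cons]

theorem take_eq : P.encode.take (L.pos - 1) = L.before := by
  rw [L.encode_eq, pos, Nat.add_sub_cancel, List.take_left]

theorem drop_eq : P.encode.drop L.pos = L.after := by
  have : L.before ++ L.l.mark :: L.after = (L.before ++ [L.l.mark]) ++ L.after := by simp
  have hlen : L.before.length + 1 = (L.before ++ [L.l.mark]).length := by simp
  rw [L.encode_eq, pos, this, hlen, List.drop_left]

theorem pos_le : L.before.length < P.encode.length := by
  rw [L.encode_eq]
  simp

theorem isTermSym_of_mem_x {a : Sym} (h : a ∈ L.x) : IsTermSym a :=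
  isTermSym_of_mem_encode (t := L.t) (by rw [L.leaf.encode_eq]; simp [h])

theorem isTermSym_of_mem_y {a : Sym} (h : a ∈ L.y) : IsTermSym a :=
  isTermSym_of_mem_encode (t := L.t) (by rw [L.leaf.encode_eq]; simp [h])

/-- Between the symbol `L.c` and the leaf there are only symbols of object terms and of the numeric
term, which do not affect the marker. -/
theorem marker_eq : marker (P.encode.take (L.pos - 1)) = some L.c := by
  obtain ⟨U₁, D, hU, -, hc, hD⟩ := L.term.before
  have skip : ∀ (X : List Sym) (s : Option Sym), (∀ a ∈ X, IsObjSym a ∨ IsTermSym a) →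
      X.foldl markerStep s = s := by
    intro X s hX
    induction X with
    | nil => rfl
    | cons a X ih =>
      have : markerStep s a = s := (hX a (by simp)).elim (·.markerStep_eq s) (·.markerStep_eq s)
      rw [List.foldl_cons, this, ih fun a ha => hX a (by simp [ha])]
  rw [L.take_eq, marker, before, hU, List.foldl_append, List.foldl_append, List.foldl_append,
    List.foldl_cons, hc, skip D _ fun a ha => .inl (hD a ha),
    skip L.x _ fun a ha => .inr (L.isTermSym_of_mem_x ha)]

theorem inBody_iff : InBody (P.encode.drop L.pos) ↔ L.b = true := by
  rw [L.drop_eq, InBody, after, foldl_endStep_inner, foldl_endStep_inner, List.foldl_append,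
    L.term.after.2, foldl_endStep_some]
  · simp
  · exact fun a ha => (L.isTermSym_of_mem_y ha).isInner
  · intro a ha
    rcases Leaf.mem_digits ha with rfl | ⟨b, rfl⟩ <;> simp [IsInner]

/-- The digits of the leaf are followed by a symbol that cannot belong to a leaf, so they can be
read off without ambiguity. -/
theorem after_eq : ∃ a z, L.after = L.l.digits ++ a :: z ∧ IsLeafSym a = false := by
  obtain ⟨⟨a, z, hV, ha⟩, -⟩ := L.term.after
  have : ∀ {t : NumTerm} {x y : List Sym} {l : Leaf} {n : ℕ} {F G : List Leaf},
      LeafAt t x l y n F G → y = [] ∨ ∃ a z, y = a :: z ∧ IsLeafSym a = false := by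
    intro t x y l n F G h
    induction h with
    | int k => exact .inl rfl
    | var m => exact .inl rfl
    | _ =>
      rename_i ih
      rcases ih with rfl | ⟨a, z, rfl, ha⟩
      · exact .inr ⟨_, _, rfl, rfl⟩
      · exact .inr ⟨_, _, rfl, ha⟩
  rcases this L.leaf with hy | ⟨a, z, hy, ha⟩
  · exact ⟨a, z ++ Program.encode L.P₂, by rw [after, hy, hV]; simp, ha.1⟩
  · exact ⟨a, z ++ (L.V ++ Program.encode L.P₂), by rw [after, hy]; simp, ha⟩

theorem reads_iff {ψ : List Sym → Prop} {R : Leaf → Prop} (hψ : Reads ψ R) :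
    ψ (L.l.mark :: L.after) ↔ R L.l := by
  obtain ⟨a, z, h, ha⟩ := L.after_eq
  rw [h, ← hψ.iff L.l a z ha, Leaf.encode_eq, List.cons_append]

theorem digitPrefix_after {m : ℕ} (h : L.l = .var m) : digitPrefix L.after = m.bits := by
  obtain ⟨a, z, hz, ha⟩ := L.after_eq
  rw [hz, h]
  exact digitPrefix_encodeNat m ha

/-- A separator sends the scan to `dead`, so positions in other terms are never factors, and only
the leaves of the term at hand remain to be counted. -/
theorem count_factor {ψ : List Sym → Prop} {Q : Leaf → Prop} (hψ : Reads ψ Q) {R : ℕ → Prop}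
    (hR : ∀ u b v, P.encode = u ++ b :: v → (R (u.length + 1) ↔ ψ (b :: v))) :
    count P.encode (fun q => Factor P.encode L.pos q ∧ R q) = leafCount Q (L.F ++ L.G) := by
  have e := L.encode_eq
  rw [e] at hR ⊢
  rw [pos, LimitDatalog.count_factor (ψ := ψ) hR, leafCount_append]
  congr 1
  · obtain ⟨U₁, D, hU, hc, -, hD⟩ := L.term.before
    have hsep : ∀ (X : List Sym), leftCount ψ (L.l.mark :: L.after) (X ++ L.c :: (D ++ L.x)) =
        leftCount ψ (L.l.mark :: L.after) (D ++ L.x) := by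
      intro X
      induction X with
      | nil =>
        refine leftCount_cons_skip hψ ?_ _ _
        rintro (h | h) <;> simp [h, IsSep, IsLeafSym] at hc
      | cons a X ih =>
        rw [List.cons_append, leftCount, ih, if_neg, zero_add]
        rintro ⟨h, -⟩
        rw [scan_append, scan_cons] at h
        generalize scan (.init, 0) X = s at h
        rw [show s = (s.1, s.2) from rfl, hc.2.1, scan_dead] at h
        simp at h
    have : L.before = (Program.encode L.P₁ ++ U₁) ++ L.c :: (D ++ L.x) := by
      rw [before, hU]
      simp
    rw [this, hsep, leftCount_append_skip hψ, L.leaf.leftCount_eq hψ]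
    intro a ha
    rcases hD a ha with ⟨b, rfl⟩ | rfl | rfl <;> simp [IsLeafMark]
  · rw [after, rightCount_digits_append hψ]
    obtain ⟨s', hs', h⟩ := L.leaf.rightCount_eq hψ (L.V ++ Program.encode L.P₂)
      (s := .init) (by simp)
    obtain ⟨⟨a, z, hV, ha⟩, -⟩ := L.term.after
    rw [h, hV, List.cons_append, rightCount_cons_skip hψ, ha.2.1, rightCount_dead, add_zero]
    rintro (h | h) <;> simp [h, IsSep, IsLeafSym] at ha

theorem count_subtracted : count P.encode (fun q => Subtracted P.encode L.pos q) = L.n := by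
  rw [L.encode_eq, pos, LimitDatalog.count_subtracted]
  obtain ⟨U₁, D, hU, hc, -, hD⟩ := L.term.before
  have hsep : ∀ (X : List Sym), minusCount (X ++ L.c :: (D ++ L.x)) = minusCount (D ++ L.x) := by
    intro X
    induction X with
    | nil => rw [List.nil_append, minusCount, if_neg fun h => hc.2.2 h.1, zero_add]
    | cons a X ih =>
      rw [List.cons_append, minusCount, ih, if_neg, zero_add]
      rintro ⟨-, h⟩
      rw [scan_append, scan_cons] at h
      generalize scan (.init, 0) X = s at h
      rw [show s = (s.1, s.2) from rfl, hc.2.1, scan_dead] at h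
      simp at h
  have hskip : ∀ (D : List Sym), (∀ a ∈ D, IsObjSym a) → minusCount (D ++ L.x) = minusCount L.x := by
    intro D hD
    induction D with
    | nil => rfl
    | cons a D ih =>
      rw [List.cons_append, minusCount, ih fun a ha => hD a (by simp [ha]), if_neg, zero_add]
      rintro ⟨rfl, -⟩
      simpa [IsObjSym] using hD _ List.mem_cons_self
  have : L.before = (Program.encode L.P₁ ++ U₁) ++ L.c :: (D ++ L.x) := by
    rw [before, hU]
    simp
  rw [this, hsep, hskip D hD, L.leaf.minusCount_eq]

end LeafPlace

/-- With this, quantifiers over positions of integers and numeric variables become quantifiers over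
leaves. -/
theorem exists_leafPlace {P : Program} {u v : List Sym} {a : Sym} (ha : IsLeafMark a)
    (h : P.encode = u ++ a :: v) :
    ∃ L : LeafPlace P, L.before = u ∧ L.l.mark = a ∧ L.after = v := by
  obtain ⟨P₁, r, P₂, u', v', rfl, hr, rfl, rfl⟩ := flatMap_eq_append_cons h
  obtain ⟨U, t, V, c, b, x, y, hT, ht, rfl, rfl⟩ := exists_termIn_of_mark ha hr
  obtain ⟨l, y', n, F, G, hl, e⟩ := exists_leafAt_of_mark ha ht
  rw [Leaf.encode_eq, List.cons_append, List.cons.injEq] at e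
  obtain ⟨rfl, rfl⟩ := e
  exact ⟨⟨P₁, P₂, r, U, V, t, c, b, x, y', l, n, F, G, rfl, hT, hl⟩, rfl, rfl,
    by simp [LeafPlace.after, Program.encode]⟩

theorem exists_leafPlace_of_symAt {P : Program} {p : ℕ} {a : Sym} (ha : IsLeafMark a)
    (h : SymAt P.encode (p + 1) a) : ∃ L : LeafPlace P, L.pos = p + 1 ∧ L.l.mark = a := by
  obtain ⟨u, v, hw, rfl⟩ := (symAt_iff _ _ _).1 h
  obtain ⟨L, rfl, h, -⟩ := exists_leafPlace ha hw
  exact ⟨L, rfl, h⟩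

theorem Leaf.eq_var_of_mark {l : Leaf} (h : l.mark = .numVar) : ∃ m, l = .var m := by
  cases l
  · simp [Leaf.mark] at h
  · exact ⟨_, rfl⟩

theorem Leaf.eq_int_of_mark {l : Leaf} (h : l.mark = .int) : ∃ k, l = .int k := by
  cases l
  · exact ⟨_, rfl⟩
  · simp [Leaf.mark] at h

end LimitDatalog

namespace LimitDatalog

open Space

/-! ### Reading leaves -/

def Leaf.IsPos (l : Leaf) : Prop := ∃ k > 0, l = .int k

/-- An integer with sign given by `Q` is at the beginning of a word. -/
def IntFirst (Q : Option Sym → Prop) (z : List Sym) : Prop := ∃ v, z = .int :: v ∧ Q v.head?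

theorem intAt_iff {w u v : List Sym} {b : Sym} (Q : Option Sym → Prop) (h : w = u ++ b :: v) :
    IntAt w Q (u.length + 1) ↔ IntFirst Q (b :: v) := by
  have hd : w.drop (u.length + 1) = v := by
    have : u ++ b :: v = (u ++ [b]) ++ v := by simp
    have hlen : u.length + 1 = (u ++ [b]).length := by simp
    rw [h, this, hlen, List.drop_left]
  rw [IntAt, hd, h, symAt_append_cons]
  constructor
  · rintro ⟨rfl, hQ⟩
    exact ⟨v, rfl, hQ⟩
  · rintro ⟨v', h, h'⟩
    simp only [List.cons.injEq] at h
    obtain ⟨rfl, rfl⟩ := h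
    exact ⟨rfl, h'⟩

theorem IntFirst.isLeafMark {Q : Option Sym → Prop} {a : Sym} {z : List Sym}
    (h : IntFirst Q (a :: z)) : IsLeafMark a := by
  obtain ⟨v, h, -⟩ := h
  simp only [List.cons.injEq] at h
  exact .inl h.1

theorem intFirst_encode_iff (Q : Option Sym → Prop) (l : Leaf) (z : List Sym) :
    IntFirst Q (l.encode ++ z) ↔ (∃ k, l = .int k) ∧ Q (l.digits ++ z).head? := by
  rw [Leaf.encode_eq, List.cons_append]
  constructor
  · rintro ⟨v, h, hv⟩
    simp only [List.cons.injEq] at h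
    rw [h.2]
    refine ⟨?_, hv⟩
    cases l with
    | int k => exact ⟨k, rfl⟩
    | var m => simp [Leaf.mark] at h
  · rintro ⟨⟨k, rfl⟩, h⟩
    exact ⟨_, rfl, h⟩

theorem Leaf.head?_digits_of_neg {k : ℤ} (hk : k < 0) (z : List Sym) :
    ((Leaf.int k).digits ++ z).head? = some .neg := by
  simp [Leaf.digits, hk]

theorem Leaf.head?_digits_of_pos {k : ℤ} (hk : 0 < k) (z : List Sym) :
    ∃ b, ((Leaf.int k).digits ++ z).head? = some (.bit b) := by
  rw [Leaf.digits, if_neg (by omega), List.nil_append, encodeNat]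
  rcases h : k.natAbs.bits with _ | ⟨b, l⟩
  · rw [bits_eq_nil] at h
    omega
  · exact ⟨b, rfl⟩

theorem Leaf.head?_digits_of_zero (a : Sym) (z : List Sym) :
    ((Leaf.int 0).digits ++ a :: z).head? = some a := by
  simp [Leaf.digits, encodeNat]

theorem reads_isNeg : Reads (IntFirst IsNegStart) Leaf.IsNeg := by
  refine ⟨fun a z h => h.isLeafMark, fun l a z ha => ?_⟩
  rw [intFirst_encode_iff, Leaf.IsNeg]
  constructor
  · rintro ⟨⟨k, rfl⟩, h⟩
    refine ⟨k, ?_, rfl⟩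
    rcases lt_trichotomy k 0 with hk | rfl | hk
    · exact hk
    · rw [IsNegStart, Leaf.head?_digits_of_zero, Option.some.injEq] at h
      simp [h, IsLeafSym] at ha
    · obtain ⟨b, hb⟩ := Leaf.head?_digits_of_pos hk (a :: z)
      simp [IsNegStart, hb] at h
  · rintro ⟨k, hk, rfl⟩
    exact ⟨⟨k, rfl⟩, Leaf.head?_digits_of_neg hk _⟩

theorem reads_isPos : Reads (IntFirst IsPosStart) Leaf.IsPos := by
  refine ⟨fun a z h => h.isLeafMark, fun l a z ha => ?_⟩
  rw [intFirst_encode_iff, Leaf.IsPos]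
  constructor
  · rintro ⟨⟨k, rfl⟩, b, h⟩
    refine ⟨k, ?_, rfl⟩
    rcases lt_trichotomy k 0 with hk | rfl | hk
    · simp [Leaf.head?_digits_of_neg hk] at h
    · rw [Leaf.head?_digits_of_zero, Option.some.injEq] at h
      simp [h, IsLeafSym] at ha
    · exact hk
  · rintro ⟨k, hk, rfl⟩
    exact ⟨⟨k, rfl⟩, Leaf.head?_digits_of_pos hk _⟩

theorem reads_isZero : Reads (IntFirst IsZeroStart) Leaf.IsZero := by
  refine ⟨fun a z h => h.isLeafMark, fun l a z ha => ?_⟩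
  have hn := reads_isNeg.iff l a z ha
  have hp := reads_isPos.iff l a z ha
  rw [intFirst_encode_iff] at hn hp ⊢
  constructor
  · rintro ⟨⟨k, rfl⟩, h⟩
    rcases lt_trichotomy k 0 with hk | rfl | hk
    · exact (h.1 (hn.2 ⟨k, hk, rfl⟩).2).elim
    · rfl
    · exact (h.2 (hp.2 ⟨k, hk, rfl⟩).2).elim
  · rintro rfl
    refine ⟨⟨0, rfl⟩, fun h => ?_, fun h => ?_⟩
    · obtain ⟨k, hk, e⟩ := hn.1 ⟨⟨0, rfl⟩, h⟩
      simp at e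
      omega
    · obtain ⟨k, hk, e⟩ := hp.1 ⟨⟨0, rfl⟩, h⟩
      simp at e
      omega

theorem reads_isVar : Reads (fun z => z.head? = some .numVar) Leaf.IsVar := by
  refine ⟨fun a z h => .inr (by simpa using h), fun l a z ha => ?_⟩
  cases l <;> simp [Leaf.encode_eq, Leaf.mark, Leaf.IsVar]

/-- The variable `x` is at position `q`. -/
def VarAt (w : List Sym) (x q : ℕ) : Prop :=
  ∃ u v, w = u ++ .numVar :: v ∧ q = u.length + 1 ∧ digitPrefix v = x.bits

theorem reads_var (x : ℕ) :
    Reads (fun z => ∃ v, z = .numVar :: v ∧ digitPrefix v = x.bits) (fun l => l = .var x) := by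
  refine ⟨?_, fun l a z ha => ?_⟩
  · rintro a z ⟨v, h, -⟩
    simp only [List.cons.injEq] at h
    exact .inr h.1
  · cases l with
    | int k => simp [Leaf.encode_eq, Leaf.mark]
    | var m =>
      have : digitPrefix ((Leaf.var m).digits ++ a :: z) = m.bits := digitPrefix_encodeNat m ha
      simp [Leaf.encode_eq, Leaf.mark, this, bits_injective.eq_iff]

theorem append_cons_inj {u u' v v' : List Sym} {a a' : Sym} (h : u ++ a :: v = u' ++ a' :: v')
    (hl : u.length = u'.length) : u = u' ∧ a = a' ∧ v = v' := by
  have := List.append_inj h hl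
  simpa using this

theorem varAt_iff {w u v : List Sym} {b : Sym} (x : ℕ) (h : w = u ++ b :: v) :
    VarAt w x (u.length + 1) ↔ ∃ v', b :: v = .numVar :: v' ∧ digitPrefix v' = x.bits := by
  constructor
  · rintro ⟨u', v', h', hl, hv⟩
    obtain ⟨rfl, rfl, rfl⟩ := append_cons_inj (h.symm.trans h') (by omega)
    exact ⟨v, rfl, hv⟩
  · rintro ⟨v', e, hv⟩
    simp only [List.cons.injEq] at e
    obtain ⟨rfl, rfl⟩ := e
    exact ⟨u, v, h, rfl, hv⟩

/-- Replaces the reference position `q` by the variable found there, so that counting positions with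
the same name becomes counting leaves equal to a given one. -/
theorem VarAt.sameName_iff {w : List Sym} {x q q' : ℕ} (h : VarAt w x q) (hq' : q' ≠ 0) :
    SymAt w q' .numVar ∧ SameName w q q' ↔ VarAt w x q' := by
  obtain ⟨u, v, hw, rfl, hv⟩ := h
  obtain ⟨p, rfl⟩ : ∃ p, q' = p + 1 := ⟨q' - 1, by omega⟩
  rw [symAt_iff]
  constructor
  · rintro ⟨⟨u', v', hw', rfl⟩, h⟩
    rw [LimitDatalog.sameName_iff hw hw', hv] at h
    exact ⟨u', v', hw', rfl, h.symm⟩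
  · rintro ⟨u', v', hw', hl, hv'⟩
    rw [hl, LimitDatalog.sameName_iff hw hw', hv, hv']
    exact ⟨⟨u', v', hw', by omega⟩, rfl⟩

theorem count_eq_zero {w : List Sym} {R : ℕ → Prop} : count w R = 0 ↔ ¬ Occurs w R := by
  simp [count, Occurs, List.countP_eq_zero]

theorem count_congr {w : List Sym} {R R' : ℕ → Prop} (h : ∀ q, q ≠ 0 → (R q ↔ R' q)) :
    count w R = count w R' := by
  refine List.countP_congr fun t _ => ?_
  simp [h (t + 1) (by omega)]

theorem xor_odd_iff (m n : ℕ) : Xor (Odd m) (Odd n) ↔ Odd (m + n) := by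
  rw [xor_iff_not_iff, Nat.odd_add, ← Nat.not_odd_iff_even, not_iff]
  by_cases Odd m <;> simp [*]

namespace LeafPlace

variable {P : Program} (L : LeafPlace P)

theorem sameRule_iff (L' : LeafPlace P) :
    SameRule P.encode L.pos L'.pos ↔ L.P₁ = L'.P₁ := by
  refine LimitDatalog.sameRule_iff L.eq L'.eq L.rule_encode_eq L'.rule_encode_eq ?_ ?_
  · cases L.l <;> simp [Leaf.mark]
  · cases L'.l <;> simp [Leaf.mark]

theorem rule_eq {L L' : LeafPlace P} (h : L.P₁ = L'.P₁) : L.r = L'.r := by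
  have := L.eq.symm.trans L'.eq
  rw [h] at this
  have := List.append_cancel_left this
  simp only [List.cons.injEq] at this
  exact this.1

theorem sameName_iff {L L' : LeafPlace P} {m m' : ℕ} (h : L.l = .var m) (h' : L'.l = .var m') :
    SameName P.encode L.pos L'.pos ↔ m = m' := by
  rw [pos, pos, LimitDatalog.sameName_iff L.encode_eq L'.encode_eq, L.digitPrefix_after h,
    L'.digitPrefix_after h', bits_injective.eq_iff]

theorem varAt {m : ℕ} (h : L.l = .var m) : VarAt P.encode m L.pos := by
  refine ⟨_, _, ?_, rfl, L.digitPrefix_after h⟩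
  rw [L.encode_eq, h]
  rfl

/-- The marker and `InBody` identify the enclosing atom as a standard body atom of kind `κ`, while
`SameRule` and `SameName` identify the rule and the variable. -/
theorem occ_iff {m : ℕ} (h : L.l = .var m) (κ : NumKind) :
    Occ P.encode κ.encode L.pos ↔ L.r.OccursIn κ m := by
  constructor
  · rintro ⟨t, -, hs, hm, hb, hr, hn⟩
    obtain ⟨L', hp, hl⟩ := exists_leafPlace_of_symAt (.inr rfl) hs
    obtain ⟨m', hm'⟩ := Leaf.eq_var_of_mark hl
    rw [← hp] at hm hb hr hn
    rw [L'.marker_eq, Option.some.injEq] at hm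
    rw [L'.inBody_iff] at hb
    rw [L.sameRule_iff L'] at hr
    rw [sameName_iff h hm'] at hn
    subst hn
    have hT := L'.term
    have hL := L'.leaf
    rw [hm, hb] at hT
    rw [hm'] at hL
    obtain ⟨name, args, hmem⟩ := hT.exists_mem_sbody
    rw [rule_eq hr]
    exact ⟨name, args, _, hmem, hL.mem_vars⟩
  · rintro ⟨name, args, s, hmem, hv⟩
    obtain ⟨U, V, hT⟩ := exists_termIn_of_mem_sbody hmem
    obtain ⟨x, y, n, F, G, hL⟩ := exists_leafAt_of_mem_vars hv
    let L' : LeafPlace P := ⟨L.P₁, L.P₂, L.r, U, V, s, _, _, x, y, _, n, F, G, L.eq, hT, hL⟩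
    refine ⟨L'.before.length, L'.pos_le, (L'.symAt _).2 rfl, L'.marker_eq, L'.inBody_iff.2 rfl,
      (L.sameRule_iff L').2 rfl, (sameName_iff (L := L) (L' := L') h rfl).2 rfl⟩

theorem occLimit_iff {m : ℕ} (h : L.l = .var m) :
    OccLimit P.encode L.pos ↔ L.r.IsLimitVar m :=
  or_congr (L.occ_iff h .min) (L.occ_iff h .max)

theorem mem_ints {k : ℤ} (h : L.l = .int k) : k ∈ P.ints := by
  have hL := L.leaf
  rw [h] at hL
  exact List.mem_flatMap.2 ⟨L.r, L.mem, List.mem_flatMap.2 ⟨L.t, L.term.mem_terms, hL.mem_ints⟩⟩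

theorem _root_.LimitDatalog.exists_leafPlace_of_mem_ints {k : ℤ} (h : k ∈ P.ints) :
    ∃ L : LeafPlace P, L.l = .int k := by
  obtain ⟨r, hr, h⟩ := List.mem_flatMap.1 h
  obtain ⟨t, ht, h⟩ := List.mem_flatMap.1 h
  obtain ⟨U, V, c, b, hT⟩ := exists_termIn_of_mem_terms ht
  obtain ⟨x, y, n, F, G, hL⟩ := exists_leafAt_of_mem_ints h
  obtain ⟨P₁, P₂, e⟩ := List.append_of_mem hr
  exact ⟨⟨P₁, P₂, r, U, V, t, c, b, x, y, _, n, F, G, e, hT, hL⟩, rfl⟩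

theorem occurs_intAt_iff {Q : Option Sym → Prop} {R : Leaf → Prop} (hR : Reads (IntFirst Q) R) :
    Occurs P.encode (IntAt P.encode Q) ↔ ∃ k ∈ P.ints, R (.int k) := by
  constructor
  · rintro ⟨t, -, h⟩
    obtain ⟨L, hp, hl⟩ := exists_leafPlace_of_symAt (.inl rfl) h.1
    obtain ⟨k, hk⟩ := Leaf.eq_int_of_mark hl
    rw [← hp, pos, intAt_iff Q L.encode_eq, L.reads_iff hR, hk] at h
    exact ⟨k, L.mem_ints hk, h⟩
  · rintro ⟨k, hk, h⟩
    obtain ⟨L, hL⟩ := exists_leafPlace_of_mem_ints hk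
    rw [← hL, ← L.reads_iff hR, ← intAt_iff Q L.encode_eq] at h
    exact ⟨_, L.pos_le, h⟩

theorem baseNeg_iff :
    BaseNeg P.encode L.pos ↔ Odd (L.n + leafCount Leaf.IsNeg (L.F ++ L.G)) := by
  rw [BaseNeg, L.count_subtracted,
    L.count_factor reads_isNeg fun u b v h => intAt_iff IsNegStart h, xor_odd_iff]

theorem count_factor_symAt_numVar :
    count P.encode (fun q => Factor P.encode L.pos q ∧ SymAt P.encode q .numVar) =
      leafCount Leaf.IsVar (L.F ++ L.G) :=
  L.count_factor (R := fun q => SymAt P.encode q .numVar) reads_isVar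
    fun u b v h => by rw [h, symAt_append_cons]; simp

theorem occurs_odd_iff :
    (Occurs P.encode fun q => (Factor P.encode L.pos q ∧ SymAt P.encode q .numVar) ∧
      Odd (count P.encode fun q' =>
        Factor P.encode L.pos q' ∧ SymAt P.encode q' .numVar ∧ SameName P.encode q q')) ↔
      ∃ x, Odd (leafCount (fun l => l = .var x) (L.F ++ L.G)) := by
  have hname : ∀ x, count P.encode
      (fun q => Factor P.encode L.pos q ∧ VarAt P.encode x q) =
        leafCount (fun l => l = .var x) (L.F ++ L.G) :=
    fun x => L.count_factor (reads_var x) fun u b v h => varAt_iff x h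
  constructor
  · rintro ⟨t, -, ⟨-, hs⟩, ho⟩
    obtain ⟨L', hp, hl⟩ := exists_leafPlace_of_symAt (.inr rfl) hs
    obtain ⟨x, hx⟩ := Leaf.eq_var_of_mark hl
    refine ⟨x, ?_⟩
    rw [← hname, ← count_congr fun q hq => and_congr_right fun _ =>
      (L'.varAt hx).sameName_iff hq, hp]
    exact ho
  · rintro ⟨x, ho⟩
    rw [← hname] at ho
    -- An odd count is not zero, so there is a position to serve as the reference.
    obtain ⟨t, ht, hF, hV⟩ : Occurs P.encode
        fun q => Factor P.encode L.pos q ∧ VarAt P.encode x q := by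
      by_contra hc
      rw [count_eq_zero.2 hc] at ho
      simp at ho
    refine ⟨t, ht, ⟨hF, ((hV.sameName_iff (by omega)).2 hV).1⟩, ?_⟩
    rwa [count_congr fun q hq => and_congr_right fun _ => hV.sameName_iff hq]

theorem attains_iff (ε : Bool) :
    Attains P.encode L.pos ε ↔ SignAttained P.ints L.n (L.F ++ L.G) ε := by
  have hzero := L.count_factor reads_isZero fun u b v h => intAt_iff IsZeroStart h
  have hpos : Occurs P.encode (IntAt P.encode IsPosStart) ↔ ∃ k ∈ P.ints, 0 < k := by
    rw [occurs_intAt_iff reads_isPos]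
    simp [Leaf.IsPos]
  have hneg : Occurs P.encode (IntAt P.encode IsNegStart) ↔ ∃ k ∈ P.ints, k < 0 := by
    rw [occurs_intAt_iff reads_isNeg]
    simp [Leaf.IsNeg]
  rw [Attains, SignAttained, ← count_eq_zero, ← count_eq_zero, hzero, L.count_factor_symAt_numVar,
    hpos, hneg, L.baseNeg_iff, xor_odd_iff, L.occurs_odd_iff]

end LeafPlace

end LimitDatalog

namespace LimitDatalog

open Space

/-! ### Semi-grounding -/

/-- The substitutions that give the instances of `r` in the semi-grounding of `P`. -/
structure IsGrounding (P : Program) (r : Rule) (σ : ℕ → ObjTerm) (τ : ℕ → NumTerm) : Prop where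
  obj : ∀ x ∈ r.objVars, ∃ a ∈ P.objs, σ x = .obj a
  limit : ∀ m ∈ r.numVars, r.IsLimitVar m → τ m = .var m
  num : ∀ m ∈ r.numVars, ¬ r.IsLimitVar m → ∃ k ∈ P.ints, τ m = .int k

/-- The rule `r` has instances in the semi-grounding of `P`. -/
def Rule.HasInstance (P : Program) (r : Rule) : Prop :=
  (r.objVars ≠ [] → P.objs ≠ []) ∧ ∀ m ∈ r.numVars, r.IsLimitVar m ∨ P.ints ≠ []

theorem IsGrounding.hasInstance {P : Program} {r : Rule} {σ : ℕ → ObjTerm} {τ : ℕ → NumTerm}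
    (h : IsGrounding P r σ τ) : r.HasInstance P := by
  refine ⟨fun hx => ?_, fun m hm => ?_⟩
  · obtain ⟨x, hx⟩ := List.exists_mem_of_ne_nil _ hx
    obtain ⟨a, ha, -⟩ := h.obj x hx
    exact List.ne_nil_of_mem ha
  · by_cases hl : r.IsLimitVar m
    · exact .inl hl
    · obtain ⟨k, hk, -⟩ := h.num m hm hl
      exact .inr (List.ne_nil_of_mem hk)

theorem mem_numVars_of_mem_sbody {r : Rule} {κ : NumKind} {name : ℕ} {args : List ObjTerm}
    {s : NumTerm} (h : Atom.numeric κ name args s ∈ r.sbody) {m : ℕ} (hm : m ∈ s.vars) :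
    m ∈ r.numVars := by
  refine List.mem_flatMap.2 ⟨s, List.mem_append.2 (.inl (List.mem_flatMap.2 ⟨_,
    List.mem_cons_of_mem _ h, ?_⟩)), hm⟩
  simp [Atom.terms]

/-- Occurrences of variables in limit body atoms are not changed by semi-grounding. -/
theorem IsGrounding.occursIn_iff {P : Program} {r : Rule} {σ : ℕ → ObjTerm} {τ : ℕ → NumTerm}
    (h : IsGrounding P r σ τ) (hr : r.IsLimitLinear) {κ : NumKind} (hκ : κ = .min ∨ κ = .max)
    (m : ℕ) : (r.subst σ τ).OccursIn κ m ↔ r.OccursIn κ m := by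
  have hτ : ∀ {name args x}, Atom.numeric κ name args (.var x) ∈ r.sbody → τ x = .var x := by
    intro name args x hx
    refine h.limit x (mem_numVars_of_mem_sbody hx (by simp [NumTerm.vars])) ?_
    have : r.OccursIn κ x := ⟨name, args, _, hx, by simp [NumTerm.vars]⟩
    rcases hκ with rfl | rfl
    · exact .inl this
    · exact .inr this
  constructor
  · rintro ⟨name, args', s', hmem, hm⟩
    obtain ⟨α, hα, e⟩ := List.mem_map.1 hmem
    cases α with
    | object => simp [Atom.subst] at e
    | numeric κ' name' args s =>
      simp only [Atom.subst, Atom.numeric.injEq] at e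
      obtain ⟨rfl, rfl, rfl, rfl⟩ := e
      -- By function-freeness the argument is an integer or a single variable. In a limit atom that
      -- variable is a limit variable, which the substitution fixes.
      have hf := hr.functionFree _ hα s (by simp [Atom.terms])
      refine ⟨name', args, s, hα, ?_⟩
      cases s with
      | int k => simp [NumTerm.subst, NumTerm.vars] at hm
      | var x => rwa [NumTerm.subst, hτ hα] at hm
      | _ => simp [NumTerm.FunctionFree] at hf
  · rintro ⟨name, args, s, hmem, hm⟩
    have hf := hr.functionFree _ hmem s (by simp [Atom.terms])
    refine ⟨name, _, _, List.mem_map.2 ⟨_, hmem, rfl⟩, ?_⟩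
    cases s with
    | int k => simp [NumTerm.vars] at hm
    | var x => rwa [NumTerm.subst, hτ hmem]
    | _ => simp [NumTerm.FunctionFree] at hf

theorem IsGrounding.exists_val {P : Program} {r : Rule} {σ : ℕ → ObjTerm} {τ : ℕ → NumTerm}
    (h : IsGrounding P r σ τ) :
    ∃ v : ℕ → ℤ, ∀ m ∈ r.numVars, ¬ r.IsLimitVar m → v m ∈ P.ints ∧ τ m = .int (v m) := by
  refine ⟨fun m => match τ m with | .int k => k | _ => 0, fun m hm hl => ?_⟩
  obtain ⟨k, hk, e⟩ := h.num m hm hl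
  simp [e, hk]

theorem mem_numVars {r : Rule} {t : NumTerm} (ht : t ∈ r.terms) {m : ℕ} (hm : m ∈ t.vars) :
    m ∈ r.numVars := List.mem_flatMap.2 ⟨t, ht, hm⟩

/-- The signs that the coefficients of a variable in the term `t` of `r` have in the semi-grounding
of `P` agree with its type: `κ` for positive coefficients, `κ'` for negative ones. -/
def Rule.SignsAllowed (P : Program) (r : Rule) (t : NumTerm) (κ κ' : NumKind) : Prop :=
  ∀ x m y n F G, LeafAt t x (.var m) y n F G → r.IsLimitVar m →
    (SignAttained P.ints n (F ++ G) false → r.OccursIn κ m) ∧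
    (SignAttained P.ints n (F ++ G) true → r.OccursIn κ' m)

/-- The values chosen by a grounding are an assignment as in `signAttained_iff`, so every sign found
in an instance is attained. -/
theorem Rule.SignsAllowed.signsMatch {P : Program} {r : Rule} {t : NumTerm} {κ κ' : NumKind}
    (h : r.SignsAllowed P t κ κ') (hr : r.IsLimitLinear) (ht : t ∈ r.terms)
    (hκ : κ = .min ∨ κ = .max) (hκ' : κ' = .min ∨ κ' = .max) {σ : ℕ → ObjTerm}
    {τ : ℕ → NumTerm} (hg : IsGrounding P r σ τ) :
    (r.subst σ τ).SignsMatch (t.subst τ) κ κ' := by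
  intro f hf m
  rw [hg.occursIn_iff hr hκ, hg.occursIn_iff hr hκ']
  obtain ⟨v, hv⟩ := hg.exists_val
  obtain ⟨ms, hms, hlin⟩ := hr.linear t ht
  obtain ⟨f', hf', h₀, hc⟩ := hlin.simplify_subst hms
    (fun x hx => hg.limit x (mem_numVars ht hx)) (fun x hx hl => (hv x (mem_numVars ht hx) hl).2)
  obtain rfl : f = f' := by simpa [hf] using hf'
  by_cases hm : m ∈ ms
  · obtain ⟨hmv, hml⟩ := hlin.vars_of_mem hm
    obtain ⟨x, y, n, F, G, hleaf⟩ := exists_leafAt_of_mem_vars hmv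
    have hF : ∀ z, .var z ∈ F ++ G → v z ∈ P.ints := fun z hz =>
      have hz := hlin.not_of_mem_factors hml hleaf hz
      (hv z (mem_numVars ht hz.1) hz.2).1
    obtain ⟨h₁, h₂⟩ := h x m y n F G hleaf hml
    rw [hc m x y n F G hml hleaf]
    exact ⟨fun hp => h₁ ((signAttained_iff _ _ _ _).2 ⟨v, hF, by simpa using hp⟩),
      fun hp => h₂ ((signAttained_iff _ _ _ _).2 ⟨v, hF, by simpa using hp⟩)⟩
  · simp [h₀ m hm]

theorem leafProd_congr {v v' : ℕ → ℤ} {F : List Leaf} (h : ∀ x, .var x ∈ F → v x = v' x) :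
    leafProd v F = leafProd v' F := by
  unfold leafProd
  congr 1
  refine List.map_congr_left fun l hl => ?_
  cases l with
  | int k => rfl
  | var x => exact h x hl

/-- The values of some variables can be chosen in a semi-grounding. -/
theorem Rule.HasInstance.exists_isGrounding {P : Program} {r : Rule} (h : r.HasInstance P)
    {X : ℕ → Prop} {v : ℕ → ℤ} (hv : ∀ x, X x → v x ∈ P.ints) :
    ∃ σ τ, IsGrounding P r σ τ ∧ ∃ v' : ℕ → ℤ, (∀ x, X x → v x = v' x) ∧
      ∀ x, ¬ r.IsLimitVar x → τ x = .int (v' x) := by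
  classical
  -- Variables outside `X` receive the first integer of the program. The defaults `0` here and for
  -- objects are never used where a condition must hold, by `HasInstance`.
  let v' : ℕ → ℤ := fun x => if X x then v x else P.ints.headD 0
  refine ⟨fun _ => .obj (P.objs.headD 0), fun x => if r.IsLimitVar x then .var x else .int (v' x),
    ⟨fun x hx => ⟨_, ?_, rfl⟩, fun m _ hl => if_pos hl, fun m hm hl => ⟨_, ?_, if_neg hl⟩⟩,
    v', fun x hx => (if_pos hx).symm, fun x hl => if_neg hl⟩
  · have := h.1 (List.ne_nil_of_mem hx)
    cases e : P.objs with
    | nil => exact absurd e this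
    | cons a l => simp
  · by_cases hx : X m
    · simpa [v', hx] using hv m hx
    · have := (h.2 m hm).resolve_left hl
      simp only [v', hx, if_false]
      cases e : P.ints with
      | nil => exact absurd e this
      | cons a l => simp

/-- An assignment to the factors that attains a sign extends to a grounding of the whole rule, and
the coefficient depends only on the factors. The existence of an instance is needed for the
remaining variables. -/
theorem Rule.signsAllowed_of_signsMatch {P : Program} {r : Rule} {t : NumTerm} {κ κ' : NumKind}
    (hr : r.IsLimitLinear) (ht : t ∈ r.terms)
    (hκ : κ = .min ∨ κ = .max) (hκ' : κ' = .min ∨ κ' = .max) (hi : r.HasInstance P)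
    (h : ∀ σ τ, IsGrounding P r σ τ → (r.subst σ τ).SignsMatch (t.subst τ) κ κ') :
    r.SignsAllowed P t κ κ' := by
  intro x m y n F G hleaf hml
  obtain ⟨ms, hms, hlin⟩ := hr.linear t ht
  have key : ∀ v : ℕ → ℤ, (∀ x, .var x ∈ F ++ G → v x ∈ P.ints) →
      (0 < (-1) ^ n * leafProd v (F ++ G) → r.OccursIn κ m) ∧
      ((-1) ^ n * leafProd v (F ++ G) < 0 → r.OccursIn κ' m) := by
    intro v hv
    obtain ⟨σ, τ, hg, v', hvv', hτ⟩ := hi.exists_isGrounding hv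
    obtain ⟨f, hf, -, hc⟩ := hlin.simplify_subst hms
      (fun x hx => hg.limit x (mem_numVars ht hx)) (fun x _ hl => hτ x hl)
    have := h σ τ hg f hf m
    rwa [hc m x y n F G hml hleaf, hg.occursIn_iff hr hκ, hg.occursIn_iff hr hκ',
      ← leafProd_congr hvv'] at this
  refine ⟨fun hs => ?_, fun hs => ?_⟩
  · obtain ⟨v, hv, hp⟩ := (signAttained_iff _ _ _ _).1 hs
    exact (key v hv).1 (by simpa using hp)
  · obtain ⟨v, hv, hp⟩ := (signAttained_iff _ _ _ _).1 hs
    exact (key v hv).2 (by simpa using hp)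

theorem Rule.exists_subst_of_mem_terms {r : Rule} {σ : ℕ → ObjTerm} {τ : ℕ → NumTerm} {t : NumTerm}
    (h : t ∈ (r.subst σ τ).terms) : ∃ s ∈ r.terms, t = s.subst τ := by
  have hatom : ∀ α : Atom, (α.subst σ τ).terms = α.terms.map (NumTerm.subst τ) := by
    intro α
    cases α <;> rfl
  have hcmp : ∀ c : Comparison, [(c.subst τ).lhs, (c.subst τ).rhs] =
      [c.lhs, c.rhs].map (NumTerm.subst τ) := by
    intro c
    cases c <;> rfl
  have : (r.subst σ τ).terms = r.terms.map (NumTerm.subst τ) := by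
    simp only [Rule.terms, Rule.atoms, Rule.subst, ← List.map_cons, List.flatMap_map,
      List.map_append, List.map_flatMap, hatom, hcmp]
  rw [this] at h
  obtain ⟨s, hs, rfl⟩ := List.mem_map.1 h
  exact ⟨s, hs, rfl⟩

/-! ### Type-consistency of rules as a condition on their leaves -/

/-- In a term after the symbol `c`, variables with positive coefficients must have type `min`. -/
def IsMinTarget (c : Sym) (b : Bool) : Prop := c = .cmp ∨ c = .minPred ∧ ¬ b = true

/-- In a term after the symbol `c`, variables with positive coefficients must have type `max`. -/
def IsMaxTarget (c : Sym) (b : Bool) : Prop := c = .lt ∨ c = .le ∨ c = .maxPred ∧ ¬ b = true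

/-- Type-consistency of all instances of `r`. -/
def Rule.AllSignsAllowed (P : Program) (r : Rule) : Prop :=
  ∀ U t V c b, TermIn r U t V c b →
    (IsMinTarget c b → r.SignsAllowed P t .min .max) ∧
    (IsMaxTarget c b → r.SignsAllowed P t .max .min)

theorem Comparison.isMaxTarget_sym (c : Comparison) (b : Bool) : IsMaxTarget c.sym b := by
  cases c <;> simp [IsMaxTarget, Comparison.sym]

theorem Rule.AllSignsAllowed.typeConsistent {P : Program} {r : Rule} (h : r.AllSignsAllowed P)
    (hr : r.IsLimitLinear) {σ : ℕ → ObjTerm} {τ : ℕ → NumTerm} (hg : IsGrounding P r σ τ) :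
    (r.subst σ τ).TypeConsistent := by
  refine ⟨fun t ht => ?_, ?_, fun c hc => ?_⟩
  · obtain ⟨s, hs, rfl⟩ := Rule.exists_subst_of_mem_terms ht
    obtain ⟨v, hv⟩ := hg.exists_val
    obtain ⟨ms, hms, hlin⟩ := hr.linear s hs
    obtain ⟨f, hf, -⟩ := hlin.simplify_subst hms
      (fun x hx => hg.limit x (mem_numVars hs hx)) (fun x hx hl => (hv x (mem_numVars hs hx) hl).2)
    exact ⟨f, hf⟩
  · have key : ∀ κ name args s, r.head = .numeric κ name args s →
        (κ = .min → (r.subst σ τ).SignsMatch (s.subst τ) .min .max) ∧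
        (κ = .max → (r.subst σ τ).SignsMatch (s.subst τ) .max .min) := by
      intro κ name args s hh
      obtain ⟨U, V, hT⟩ := exists_termIn_of_head hh
      obtain ⟨h₁, h₂⟩ := h _ _ _ _ _ hT
      refine ⟨?_, ?_⟩
      · rintro rfl
        exact (h₁ (.inr ⟨rfl, by simp⟩)).signsMatch hr hT.mem_terms (by simp) (by simp) hg
      · rintro rfl
        exact (h₂ (.inr (.inr ⟨rfl, by simp⟩))).signsMatch hr hT.mem_terms (by simp) (by simp) hg
    cases hh : r.head with
    | object name args =>
      have : (r.subst σ τ).head = .object name (args.map (ObjTerm.subst σ)) := by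
        rw [Rule.subst, hh]; rfl
      rw [Rule.HeadConsistent, this]
      trivial
    | numeric κ name args s =>
      have : (r.subst σ τ).head = .numeric κ name (args.map (ObjTerm.subst σ)) (s.subst τ) := by
        rw [Rule.subst, hh]; rfl
      rw [Rule.HeadConsistent, this]
      obtain ⟨h₁, h₂⟩ := key κ name args s hh
      cases κ with
      | ordinary => trivial
      | min => exact h₁ rfl
      | max => exact h₂ rfl
  · obtain ⟨d, hd, rfl⟩ := List.mem_map.1 hc
    obtain ⟨⟨U, V, hT⟩, ⟨U', V', hT'⟩⟩ := exists_termIn_of_mem_cbody hd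
    have e₁ : (d.subst τ).lhs = d.lhs.subst τ := by cases d <;> rfl
    have e₂ : (d.subst τ).rhs = d.rhs.subst τ := by cases d <;> rfl
    rw [e₁, e₂]
    exact ⟨((h _ _ _ _ _ hT).1 (.inl rfl)).signsMatch hr hT.mem_terms (by simp) (by simp) hg,
      ((h _ _ _ _ _ hT').2 (d.isMaxTarget_sym _)).signsMatch hr hT'.mem_terms (by simp) (by simp)
        hg⟩

theorem Rule.allSignsAllowed_of_typeConsistent {P : Program} {r : Rule} (hr : r.IsLimitLinear)
    (hi : r.HasInstance P)
    (h : ∀ σ τ, IsGrounding P r σ τ → (r.subst σ τ).TypeConsistent) : r.AllSignsAllowed P := by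
  intro U t V c b hT
  have hcmp : ∀ d ∈ r.cbody, ∀ σ τ, IsGrounding P r σ τ →
      (r.subst σ τ).SignsMatch (d.lhs.subst τ) .min .max ∧
      (r.subst σ τ).SignsMatch (d.rhs.subst τ) .max .min := by
    intro d hd σ τ hg
    have := (h σ τ hg).comparisons _ (List.mem_map.2 ⟨d, hd, rfl⟩)
    cases d <;> exact this
  refine ⟨fun hc => ?_, fun hc => ?_⟩
  · refine Rule.signsAllowed_of_signsMatch hr hT.mem_terms (by simp) (by simp) hi
      fun σ τ hg => ?_
    rcases hc with rfl | ⟨rfl, hb⟩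
    · obtain ⟨d, hd, rfl⟩ := hT.exists_lhs
      exact (hcmp d hd σ τ hg).1
    · obtain rfl : b = false := by simpa using hb
      obtain ⟨name, args, hh⟩ := TermIn.head_eq (κ := .min) hT
      have := (h σ τ hg).head
      have e : (r.subst σ τ).head = .numeric .min name (args.map (ObjTerm.subst σ)) (t.subst τ) := by
        rw [Rule.subst, hh]; rfl
      rwa [Rule.HeadConsistent, e] at this
  · refine Rule.signsAllowed_of_signsMatch hr hT.mem_terms (by simp) (by simp) hi
      fun σ τ hg => ?_
    rw [IsMaxTarget, ← or_assoc] at hc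
    rcases hc with hc | ⟨rfl, hb⟩
    · obtain ⟨d, hd, rfl⟩ := hT.exists_rhs hc
      exact (hcmp d hd σ τ hg).2
    · obtain rfl : b = false := by simpa using hb
      obtain ⟨name, args, hh⟩ := TermIn.head_eq (κ := .max) hT
      have := (h σ τ hg).head
      have e : (r.subst σ τ).head = .numeric .max name (args.map (ObjTerm.subst σ)) (t.subst τ) := by
        rw [Rule.subst, hh]; rfl
      rwa [Rule.HeadConsistent, e] at this

/-- Rules without instances impose no condition, whatever signs their terms could produce; hence the
restriction to `HasInstance`. -/
theorem Program.typeConsistent_iff {P : Program} (hP : P.IsLimitLinear) :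
    P.TypeConsistent ↔ ∀ r ∈ P, r.HasInstance P → r.AllSignsAllowed P := by
  constructor
  · exact fun h r hr hi => Rule.allSignsAllowed_of_typeConsistent (hP r hr) hi
      fun σ τ hg => h _ ⟨r, hr, σ, τ, hg.obj, hg.limit, hg.num, rfl⟩
  · rintro h _ ⟨r, hr, σ, τ, h₁, h₂, h₃, rfl⟩
    have hg : IsGrounding P r σ τ := ⟨h₁, h₂, h₃⟩
    exact (h r hr hg.hasInstance).typeConsistent (hP r hr) hg

/-! ### Correctness of the decision procedure -/

theorem occurs_symAt_iff {w : List Sym} {a : Sym} : (Occurs w fun q => SymAt w q a) ↔ a ∈ w := by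
  constructor
  · rintro ⟨t, -, h⟩
    obtain ⟨u, v, rfl, -⟩ := (symAt_iff _ _ _).1 h
    simp
  · intro h
    obtain ⟨u, v, rfl⟩ := List.append_of_mem h
    exact ⟨u.length, by simp, (symAt_append_cons _ _ _ _).2 rfl⟩

theorem mem_encode_iff {a : Sym} (ha : a = .obj ∨ a = .objVar) (r : Rule) :
    a ∈ r.encode ↔ ∃ α ∈ r.atoms, ∃ o ∈ α.args, a ∈ o.encode := by
  have hterm : ∀ t : NumTerm, a ∉ t.encode := by
    intro t h
    have := isTermSym_of_mem_encode h
    rcases ha with rfl | rfl <;> simp [IsTermSym, IsLeafSym, IsFun] at this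
  have hnat : ∀ n, a ∉ encodeNat n := by
    intro n h
    obtain ⟨b, rfl⟩ := mem_encodeNat h
    simp at ha
  have hatom : ∀ α : Atom, a ∈ α.encode ↔ ∃ o ∈ α.args, a ∈ o.encode := by
    intro α
    cases α with
    | object name args =>
      have : a ≠ .objectPred := by rcases ha with rfl | rfl <;> simp
      simp [Atom.encode, Atom.args, hnat, this]
    | numeric κ name args s =>
      have : a ≠ κ.encode := by rcases ha with rfl | rfl <;> cases κ <;> simp [NumKind.encode]
      simp [Atom.encode, Atom.args, hnat, hterm, this]
  have hcmp : ∀ c : Comparison, a ∉ c.encode := by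
    intro c h
    rw [Comparison.encode_eq, List.mem_cons, List.mem_append, List.mem_cons] at h
    rcases h with rfl | h | h | h
    · simp at ha
    · exact hterm _ h
    · rcases ha with rfl | rfl <;> cases c <;> simp [Comparison.sym] at h
    · exact hterm _ h
  have h₁ : a ≠ .arrow := by rcases ha with rfl | rfl <;> simp
  have h₂ : a ≠ .ruleEnd := by rcases ha with rfl | rfl <;> simp
  simp only [Rule.encode, Rule.atoms, List.mem_append, List.mem_cons, List.mem_flatMap, hatom, hcmp,
    h₁, h₂, List.not_mem_nil, or_false, false_or, and_false, exists_false, exists_eq_or_imp]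
  exact or_comm

theorem Rule.objVar_mem_encode {r : Rule} : .objVar ∈ r.encode ↔ r.objVars ≠ [] := by
  rw [mem_encode_iff (.inr rfl)]
  have : ∀ o : ObjTerm, .objVar ∈ o.encode ↔ o.vars ≠ [] := by
    intro o
    cases o <;> simp [ObjTerm.encode, ObjTerm.vars, encodeNat]
  simp [Rule.objVars, Atom.objVars, this]

theorem Program.obj_mem_encode {P : Program} : .obj ∈ P.encode ↔ P.objs ≠ [] := by
  have : ∀ o : ObjTerm, .obj ∈ o.encode ↔ o.objs ≠ [] := by
    intro o
    cases o <;> simp [ObjTerm.encode, ObjTerm.objs, encodeNat]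
  simp [Program.encode, mem_encode_iff (.inl rfl), Program.objs, this]

theorem Program.occurs_int_iff {P : Program} :
    (Occurs P.encode fun q => SymAt P.encode q .int) ↔ P.ints ≠ [] := by
  constructor
  · rintro ⟨t, -, h⟩
    obtain ⟨L, -, hl⟩ := exists_leafPlace_of_symAt (.inl rfl) h
    obtain ⟨k, hk⟩ := Leaf.eq_int_of_mark hl
    exact List.ne_nil_of_mem (L.mem_ints hk)
  · intro h
    obtain ⟨k, hk⟩ := List.exists_mem_of_ne_nil _ h
    obtain ⟨L, hL⟩ := exists_leafPlace_of_mem_ints hk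
    exact ⟨_, L.pos_le, (L.symAt _).2 (by rw [hL]; rfl)⟩

namespace LeafPlace

variable {P : Program} (L : LeafPlace P)

/-- A rule has an instance iff objects and integers are available for those of its variables that
need them. Object variables are located by their symbol alone, numeric ones through their leaves. -/
theorem groundable_iff : Groundable P.encode L.pos ↔ L.r.HasInstance P := by
  have hmark : L.l.mark ≠ .ruleEnd := by cases L.l <;> simp [Leaf.mark]
  refine and_congr ?_ ?_
  · rw [occurs_symAt_iff, Program.obj_mem_encode, ← Rule.objVar_mem_encode]
    constructor
    · intro h hmem
      obtain ⟨u, v, e⟩ := List.append_of_mem hmem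
      have e' : P.encode = (Program.encode L.P₁ ++ u) ++ .objVar :: (v ++ Program.encode L.P₂) := by
        conv_lhs => rw [L.eq]
        rw [Program.encode_append, Program.encode_cons, e]
        simp
      refine h (Program.encode L.P₁ ++ u).length (by rw [e']; simp) ?_ ?_
      · rw [e', symAt_append_cons]
      · exact (LimitDatalog.sameRule_iff L.eq L.eq L.rule_encode_eq e hmark (by simp)).2 rfl
    · intro h t _ hs hr
      obtain ⟨u, v, e, rfl⟩ := (symAt_iff _ _ _).1 hs
      obtain ⟨P₁, r, P₂, u', v', hP, hr', rfl, rfl⟩ := flatMap_eq_append_cons e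
      have hP₁ := (LimitDatalog.sameRule_iff L.eq hP L.rule_encode_eq hr' hmark (by simp)).1 hr
      have hP' := L.eq.symm.trans hP
      rw [hP₁] at hP'
      have hP' := List.append_cancel_left hP'
      simp only [List.cons.injEq] at hP'
      refine h ?_
      rw [hP'.1, hr']
      simp
  · rw [Program.occurs_int_iff]
    constructor
    · intro h m hm
      obtain ⟨t, ht, hm⟩ := List.mem_flatMap.1 hm
      obtain ⟨U, V, c, b, hT⟩ := exists_termIn_of_mem_terms ht
      obtain ⟨x, y, n, F, G, hL⟩ := exists_leafAt_of_mem_vars hm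
      let L' : LeafPlace P := ⟨L.P₁, L.P₂, L.r, U, V, t, _, _, x, y, _, n, F, G, L.eq, hT, hL⟩
      exact (h _ L'.pos_le ((L'.symAt _).2 rfl) ((L.sameRule_iff L').2 rfl)).imp_left
        (L'.occLimit_iff rfl).1
    · intro h t _ hs hr
      obtain ⟨L', hp, hl⟩ := exists_leafPlace_of_symAt (.inr rfl) hs
      obtain ⟨m, hm⟩ := Leaf.eq_var_of_mark hl
      rw [← hp, L.sameRule_iff L'] at hr
      rw [← hp, L'.occLimit_iff hm, ← rule_eq hr]
      have hL := L'.leaf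
      rw [hm] at hL
      refine h m ?_
      rw [rule_eq hr]
      exact mem_numVars L'.term.mem_terms hL.mem_vars

theorem violates_iff {m : ℕ} (hm : L.l = .var m) :
    Violates P.encode L.pos ↔ L.r.IsLimitVar m ∧ L.r.HasInstance P ∧
      (IsMinTarget L.c L.b ∧
          (SignAttained P.ints L.n (L.F ++ L.G) false ∧ ¬ L.r.OccursIn .min m ∨
            SignAttained P.ints L.n (L.F ++ L.G) true ∧ ¬ L.r.OccursIn .max m) ∨
        IsMaxTarget L.c L.b ∧
          (SignAttained P.ints L.n (L.F ++ L.G) false ∧ ¬ L.r.OccursIn .max m ∨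
            SignAttained P.ints L.n (L.F ++ L.G) true ∧ ¬ L.r.OccursIn .min m)) := by
  have hmin := L.occ_iff hm .min
  have hmax := L.occ_iff hm .max
  simp only [NumKind.encode] at hmin hmax
  have hs : SymAt P.encode L.pos .numVar := (L.symAt _).2 (by rw [hm]; rfl)
  rw [Violates, L.occLimit_iff hm, L.groundable_iff, MinTarget, MaxTarget, L.marker_eq,
    L.inBody_iff, L.attains_iff, L.attains_iff, hmin, hmax]
  simp only [hs, true_and, Option.some.injEq, IsMinTarget, IsMaxTarget]

end LeafPlace

/-- By `violates_iff`, a violating position is exactly a leaf refuting `SignsAllowed` in a term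
whose signs are constrained. -/
theorem mem_consistentWords_iff (P : Program) :
    P.encode ∈ consistentWords ↔ ∀ r ∈ P, r.HasInstance P → r.AllSignsAllowed P := by
  constructor
  · intro h r hr hi U t V c b hT
    obtain ⟨P₁, P₂, e⟩ := List.append_of_mem hr
    have key : ∀ x m y n F G, LeafAt t x (.var m) y n F G → r.IsLimitVar m →
        ¬ (IsMinTarget c b ∧ (SignAttained P.ints n (F ++ G) false ∧ ¬ r.OccursIn .min m ∨
            SignAttained P.ints n (F ++ G) true ∧ ¬ r.OccursIn .max m) ∨
          IsMaxTarget c b ∧ (SignAttained P.ints n (F ++ G) false ∧ ¬ r.OccursIn .max m ∨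
            SignAttained P.ints n (F ++ G) true ∧ ¬ r.OccursIn .min m)) := by
      intro x m y n F G hL hm hv
      let L : LeafPlace P := ⟨P₁, P₂, r, U, V, t, c, b, x, y, _, n, F, G, e, hT, hL⟩
      exact h ⟨_, L.pos_le, (L.violates_iff rfl).2 ⟨hm, hi, hv⟩⟩
    refine ⟨fun hc x m y n F G hL hm => ?_, fun hc x m y n F G hL hm => ?_⟩
    · have := key x m y n F G hL hm
      exact ⟨fun hs => by_contra fun hn => this (.inl ⟨hc, .inl ⟨hs, hn⟩⟩),
        fun hs => by_contra fun hn => this (.inl ⟨hc, .inr ⟨hs, hn⟩⟩)⟩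
    · have := key x m y n F G hL hm
      exact ⟨fun hs => by_contra fun hn => this (.inr ⟨hc, .inl ⟨hs, hn⟩⟩),
        fun hs => by_contra fun hn => this (.inr ⟨hc, .inr ⟨hs, hn⟩⟩)⟩
  · rintro h ⟨p, -, hv⟩
    obtain ⟨L, hp, hl⟩ := exists_leafPlace_of_symAt (.inr rfl) hv.1
    obtain ⟨m, hm⟩ := Leaf.eq_var_of_mark hl
    rw [← hp, L.violates_iff hm] at hv
    obtain ⟨hlim, hi, hv⟩ := hv
    obtain ⟨h₁, h₂⟩ := h L.r L.mem hi _ _ _ _ _ L.term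
    have hL := L.leaf
    rw [hm] at hL
    rcases hv with ⟨hc, hv⟩ | ⟨hc, hv⟩
    · obtain ⟨h₃, h₄⟩ := h₁ hc _ _ _ _ _ _ hL hlim
      exact hv.elim (fun hv => hv.2 (h₃ hv.1)) fun hv => hv.2 (h₄ hv.1)
    · obtain ⟨h₃, h₄⟩ := h₂ hc _ _ _ _ _ _ hL hlim
      exact hv.elim (fun hv => hv.2 (h₃ hv.1)) fun hv => hv.2 (h₄ hv.1)

end LimitDatalog

theorem mainTheorem11 :
    ∃ L ∈ Space.LogSpace LimitDatalog.Sym, ∀ P : LimitDatalog.Program,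
      P.IsLimitLinear → (P.encode ∈ L ↔ P.TypeConsistent) :=
  ⟨LimitDatalog.consistentWords, LimitDatalog.consistentWords_mem_logSpace, fun P hP =>
    (LimitDatalog.mem_consistentWords_iff P).trans (P.typeConsistent_iff hP).symm⟩
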